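/- Throughout, digraphs $G=(V,E)$ are finite and simple (no loops, no repeated edges), and an undirected graph is a digraph with $E=E^{-1}$. The undirected complement of $G$ is $(V,\{(a,b): a\ne b,\ (a,b)\notin E\cup E^{-1}\})$. An orientation of a graph is a maximal subset $E'$ of its edges with $E'\cap E'^{-1}=\emptyset$. A graph is transitive if $(a,c)$ is an edge whenever $(a,b),(b,c)$ are edges and $a\neq c$, and $G^*$ denotes the least transitive graph containing $G$. A graph is transitively orientable if it has an orientation that is transitive. There is an algorithm which, given a digraph $G$ with $n$ vertices and $m$ edges (as $n$ and a list of the edges in any order) such that the undirected complement of $G$ is transitively orientable, finds in near-linear time a transitive orientation of the undirected complement of the transitive closure $G^*$. Precisely: there are a single random access machine program (registers and arrays of natural numbers, whose only arithmetic is successor and truncated subtraction, with unit cost per operation) and a constant $C$ such that on every such input the program halts after at most $C\,(n+m+1)\lfloor\log_2(n+m+2)\rfloor$ steps and outputs a listing $v_0,\dots,v_{n-1}$ of the vertices for which $\{(v_i,v_j): i<j,\ v_i \text{ and } v_j \text{ adjacent in the undirected complement of } G^*\}$ is a transitive orientation of the undirected complement of $G^*$. -/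

import Mathlib

/-! ### Simple digraphs

A simple digraph is a loopless `Digraph`; an undirected edge is a pair of opposite directed edges. -/

namespace Digraph

variable {V : Type*}

/-- A digraph is simple iff it has no loops. -/
def IsSimple (G : Digraph V) : Prop := ∀ a, ¬ G.Adj a a

/-- The undirected closure `(V, E ∪ E⁻¹)`. -/
def undirectedClosure (G : Digraph V) : Digraph V where
  Adj a b := G.Adj a b ∨ G.Adj b a

/-- The complement `(V, {(a, b) | a ≠ b} \ E)` (unlike `Gᶜ`, it never has loops). -/
def simpleComplement (G : Digraph V) : Digraph V where
  Adj a b := a ≠ b ∧ ¬ G.Adj a b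

/-- The undirected complement: the complement of the undirected closure. -/
def undirectedComplement (G : Digraph V) : Digraph V :=
  G.undirectedClosure.simpleComplement

/-- `E ∩ E⁻¹ = ∅`. -/
def IsOriented (G : Digraph V) : Prop := ∀ a b, ¬ (G.Adj a b ∧ G.Adj b a)

/-- `H` is an orientation of `G`: a maximal oriented subset of the edges of `G`. -/
def IsOrientationOf (H G : Digraph V) : Prop :=
  Maximal (fun K : Digraph V => K.IsOriented ∧ K ≤ G) H

/-- For all edges `(a, b)`, `(b, c)` with `a ≠ c`, also `(a, c)` is an edge. -/
def IsTransitive (G : Digraph V) : Prop :=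
  ∀ a b c, G.Adj a b → G.Adj b c → a ≠ c → G.Adj a c

/-- `H` is a transitive orientation of `G`. -/
def IsTransitiveOrientationOf (H G : Digraph V) : Prop :=
  H.IsOrientationOf G ∧ H.IsTransitive

/-- `G` possesses a transitive orientation. -/
def IsTransitivelyOrientable (G : Digraph V) : Prop :=
  ∃ H : Digraph V, H.IsTransitiveOrientationOf G

/-- The transitive closure: the least transitive digraph containing `G`
(the intersection of all of them). -/
def transitiveClosure (G : Digraph V) : Digraph V :=
  sInf {H : Digraph V | G ≤ H ∧ H.IsTransitive}

/-- The edges `(a, b)` of `G` for which `a` comes before `b` in the total ordering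
`v 0, v 1, …, v (n - 1)` of the vertices. -/
def orientAlong {n : ℕ} (G : Digraph V) (v : Fin n ≃ V) : Digraph V where
  Adj a b := G.Adj a b ∧ v.symm a < v.symm b

end Digraph

/-! ### A random access machine

Programs over finitely many registers and finitely many arrays of natural numbers. Every
assignment and every test costs one step. The only arithmetic is the successor and truncated
subtraction, so that in `t` steps no number grows by more than `t`: on an input of size `N`,
a computation of `O(N log N)` steps handles only numbers of `O(log N)` bits, and the unit cost
is realistic. -/

namespace RAM

/-- A memory: registers `reg x`, and array cells `arr a i`. -/
structure Memory where
  reg : ℕ → ℕ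
  arr : ℕ → ℕ → ℕ

/-- `reg x := k`. -/
def Memory.setReg (s : Memory) (x k : ℕ) : Memory where
  reg := Function.update s.reg x k
  arr := s.arr

/-- `arr a i := k`. -/
def Memory.setArr (s : Memory) (a i k : ℕ) : Memory where
  reg := s.reg
  arr := Function.update s.arr a (Function.update (s.arr a) i k)

/-- The programs. Registers and arrays are named by numbers that are fixed in the program. -/
inductive Program where
  /-- `reg x := k` for a constant `k` -/
  | const (x k : ℕ)
  /-- `reg x := reg y` -/
  | copy (x y : ℕ)
  /-- `reg x := reg y + 1` -/
  | succ (x y : ℕ)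
  /-- `reg x := reg y - reg z` (zero if `reg y < reg z`) -/
  | sub (x y z : ℕ)
  /-- `reg x := arr a (reg i)` -/
  | load (x a i : ℕ)
  /-- `arr a (reg i) := reg x` -/
  | store (a i x : ℕ)
  /-- `p`, then `q` -/
  | seq (p q : Program)
  /-- `if reg x < reg y then p else q` -/
  | ifLt (x y : ℕ) (p q : Program)
  /-- `while reg x < reg y do p` -/
  | whileLt (x y : ℕ) (p : Program)

/-- `Runs p s t s'`: started in the memory `s`, the program `p` halts after exactly `t` steps
in the memory `s'`. -/
inductive Runs : Program → Memory → ℕ → Memory → Prop where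
  | const (s : Memory) (x k : ℕ) : Runs (.const x k) s 1 (s.setReg x k)
  | copy (s : Memory) (x y : ℕ) : Runs (.copy x y) s 1 (s.setReg x (s.reg y))
  | succ (s : Memory) (x y : ℕ) : Runs (.succ x y) s 1 (s.setReg x (s.reg y + 1))
  | sub (s : Memory) (x y z : ℕ) : Runs (.sub x y z) s 1 (s.setReg x (s.reg y - s.reg z))
  | load (s : Memory) (x a i : ℕ) : Runs (.load x a i) s 1 (s.setReg x (s.arr a (s.reg i)))
  | store (s : Memory) (a i x : ℕ) : Runs (.store a i x) s 1 (s.setArr a (s.reg i) (s.reg x))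
  | seq {p q : Program} {s s₁ s₂ : Memory} {t₁ t₂ : ℕ} :
      Runs p s t₁ s₁ → Runs q s₁ t₂ s₂ → Runs (.seq p q) s (t₁ + t₂) s₂
  | ifLt_true {x y : ℕ} {p q : Program} {s s' : Memory} {t : ℕ} :
      s.reg x < s.reg y → Runs p s t s' → Runs (.ifLt x y p q) s (t + 1) s'
  | ifLt_false {x y : ℕ} {p q : Program} {s s' : Memory} {t : ℕ} :
      ¬ s.reg x < s.reg y → Runs q s t s' → Runs (.ifLt x y p q) s (t + 1) s'
  | while_true {x y : ℕ} {p : Program} {s s₁ s₂ : Memory} {t₁ t₂ : ℕ} :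
      s.reg x < s.reg y → Runs p s t₁ s₁ → Runs (.whileLt x y p) s₁ t₂ s₂ →
      Runs (.whileLt x y p) s (t₁ + t₂ + 1) s₂
  | while_false {x y : ℕ} {p : Program} {s : Memory} :
      ¬ s.reg x < s.reg y → Runs (.whileLt x y p) s 1 s

/-- The input for a digraph on the vertices `0, …, n - 1` with the list of edges `L`: register `0`
holds `n`, register `1` holds the number of edges, and the cells `e` of the arrays `0` and `1` hold
the tail and the head of the `e`-th edge. Everything else is zero. -/
def input (n : ℕ) (L : List (Fin n × Fin n)) : Memory where
  reg x := if x = 0 then n else if x = 1 then L.length else 0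
  arr a e :=
    if a = 0 then (L[e]?.map fun p => (p.1 : ℕ)).getD 0
    else if a = 1 then (L[e]?.map fun p => (p.2 : ℕ)).getD 0
    else 0

/-- The cells `0, …, n - 1` of array `2` hold the vertices `v 0, …, v (n - 1)`. -/
def HasOutput {n : ℕ} (s : Memory) (v : Fin n ≃ Fin n) : Prop :=
  ∀ i : Fin n, s.arr 2 i = v i

end RAM

/-! ### Reasoning about programs: symbolic execution, frame conditions and time bounds. -/

namespace RAM

/-! The transitive closure is never computed. Write `E` for adjacency in the undirected closure of
`G`, and suppose that a linear order of the vertices orients the non-edges of `E` transitively. Then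
it also orients the incomparable pairs of the closure transitively. Indeed, let `a < b < c` with `b`
incomparable to `a` and to `c`. No vertex on a walk between `a` and `c` is `E`-adjacent to `b`, and
an edge of the walk that jumps over `b` would join the ends of two consecutive non-edges through
`b`. So every walk stays on one side of `b`, and `a`, `c` are incomparable
(`isTransitiveOrientationOf_orientAlong_transitiveClosure`). It remains to order the vertices of the
cocomparability graph `E` in near-linear time, without listing its possibly quadratically many
non-edges.

The order arises by refining an ordered partition down to single vertices, such that the order of
the classes always agrees with some transitive orientation `F` of the non-edges (`OrdPart.Agrees`).
Two kinds of refinement preserve this. First, a vertex `x` outside a class splits it into neighbours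
and non-neighbours of `x`. The position of the class relative to `x` tells how `F` orients the
non-edges at `x`, and transitivity then forces the neighbours to the side of `x` (`Agrees.split`).
Second, when such splits have been exhausted, the classes are modules, and `F` may be replaced on a
module by any other transitive orientation (`OrientsCompl.subst`). The last vertex of the module in
a lexicographic breadth first search order is a source of a suitable orientation
(`IsLexOrder.exists_source`), so it may be put in front (`Agrees.exists_isolate`).

For the time bound, a coarse partition into intervals records which splits have been made: no vertex
distinguishes two members of a class in another interval (`OrdPart.Modular`). While an interval
consists of several classes, its first or last class, whichever is shorter, is cut off, and the
partition is split by all edges that leave this class. A vertex takes part in such a step only when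
the interval that contains it shrinks to at most half. So the sum of `(degree + 1) * log` of the
interval length pays for the work (`pot_split_add_le`, `halts_refineStep`,
`exists_runs_refineLoop`).

The basic operation, splitting all classes but one by a linked list, takes time linear in the length
of the list (`halts_splitLoop`). It serves both the search (`Lex.succ`, `halts_lexBFS`) and the
refinement (`halts_splitByClass`, `halts_refineAll`). -/

@[simp] theorem Memory.setReg_reg (s : Memory) (x k y : ℕ) :
    (s.setReg x k).reg y = if y = x then k else s.reg y := by
  simp [Memory.setReg, Function.update_apply]

@[simp] theorem Memory.setReg_arr (s : Memory) (x k : ℕ) : (s.setReg x k).arr = s.arr := rfl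

@[simp] theorem Memory.setArr_reg (s : Memory) (a i k : ℕ) : (s.setArr a i k).reg = s.reg := rfl

@[simp] theorem Memory.setArr_arr (s : Memory) (a i k b : ℕ) :
    (s.setArr a i k).arr b = if b = a then Function.update (s.arr a) i k else s.arr b := by
  simp [Memory.setArr, Function.update_apply]

namespace Program

/-- The program contains no loop. -/
def loopFree : Program → Bool
  | seq p q => p.loopFree && q.loopFree
  | ifLt _ _ p q => p.loopFree && q.loopFree
  | whileLt _ _ _ => false
  | _ => true

/-- The final memory of a loop-free program. -/
def exec : Program → Memory → Memory
  | const x k, s => s.setReg x k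
  | copy x y, s => s.setReg x (s.reg y)
  | succ x y, s => s.setReg x (s.reg y + 1)
  | sub x y z, s => s.setReg x (s.reg y - s.reg z)
  | load x a i, s => s.setReg x (s.arr a (s.reg i))
  | store a i x, s => s.setArr a (s.reg i) (s.reg x)
  | seq p q, s => q.exec (p.exec s)
  | ifLt x y p q, s => if s.reg x < s.reg y then p.exec s else q.exec s
  | whileLt _ _ _, s => s

/-- An upper bound for the running time of a loop-free program. -/
def cost : Program → ℕ
  | seq p q => p.cost + q.cost
  | ifLt _ _ p q => max p.cost q.cost + 1
  | _ => 1

/-- The program contains an assignment to the register `r`. -/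
def writesReg (r : ℕ) : Program → Bool
  | const x _ => x == r
  | copy x _ => x == r
  | succ x _ => x == r
  | sub x _ _ => x == r
  | load x _ _ => x == r
  | store _ _ _ => false
  | seq p q => p.writesReg r || q.writesReg r
  | ifLt _ _ p q => p.writesReg r || q.writesReg r
  | whileLt _ _ p => p.writesReg r

/-- The program contains an assignment to a cell of the array `b`. -/
def writesArr (b : ℕ) : Program → Bool
  | store a _ _ => a == b
  | seq p q => p.writesArr b || q.writesArr b
  | ifLt _ _ p q => p.writesArr b || q.writesArr b
  | whileLt _ _ p => p.writesArr b
  | _ => false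

theorem exists_runs_exec (p : Program) (hp : p.loopFree = true) (s : Memory) :
    ∃ t, Runs p s t (p.exec s) ∧ t ≤ p.cost := by
  induction p generalizing s with
  | const x k => exact ⟨1, .const s x k, le_rfl⟩
  | copy x y => exact ⟨1, .copy s x y, le_rfl⟩
  | succ x y => exact ⟨1, .succ s x y, le_rfl⟩
  | sub x y z => exact ⟨1, .sub s x y z, le_rfl⟩
  | load x a i => exact ⟨1, .load s x a i, le_rfl⟩
  | store a i x => exact ⟨1, .store s a i x, le_rfl⟩
  | seq p q ihp ihq =>
    simp only [loopFree, Bool.and_eq_true] at hp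
    obtain ⟨t₁, h₁, h₁'⟩ := ihp hp.1 s
    obtain ⟨t₂, h₂, h₂'⟩ := ihq hp.2 (p.exec s)
    exact ⟨t₁ + t₂, .seq h₁ h₂, add_le_add h₁' h₂'⟩
  | ifLt x y p q ihp ihq =>
    simp only [loopFree, Bool.and_eq_true] at hp
    by_cases h : s.reg x < s.reg y
    · obtain ⟨t, ht, ht'⟩ := ihp hp.1 s
      refine ⟨t + 1, ?_, by simp only [cost]; omega⟩
      rw [exec, if_pos h]
      exact .ifLt_true h ht
    · obtain ⟨t, ht, ht'⟩ := ihq hp.2 s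
      refine ⟨t + 1, ?_, by simp only [cost]; omega⟩
      rw [exec, if_neg h]
      exact .ifLt_false h ht
  | whileLt x y p => simp [loopFree] at hp

end Program

/-- The memories agree wherever the program makes no assignment. -/
structure Frame (p : Program) (s s' : Memory) : Prop where
  reg : ∀ r, p.writesReg r = false → s'.reg r = s.reg r
  arr : ∀ a, p.writesArr a = false → s'.arr a = s.arr a

theorem Frame.refl (p : Program) (s : Memory) : Frame p s s := ⟨fun _ _ => rfl, fun _ _ => rfl⟩

theorem Frame.trans {p : Program} {s₁ s₂ s₃ : Memory} (h : Frame p s₁ s₂) (h' : Frame p s₂ s₃) :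
    Frame p s₁ s₃ :=
  ⟨fun r hr => (h'.reg r hr).trans (h.reg r hr), fun a ha => (h'.arr a ha).trans (h.arr a ha)⟩

/-- Which registers and arrays a program writes is computed from its text, so each later fact about
untouched memory is obtained with `rfl` as side condition. -/
theorem Runs.frame {p : Program} {s s' : Memory} {t : ℕ} (h : Runs p s t s') : Frame p s s' := by
  induction h with
  | const s x k =>
    refine ⟨fun r hr => ?_, fun a _ => by simp⟩
    have : r ≠ x := by rintro rfl; simp [Program.writesReg] at hr
    simp [this]
  | copy s x y =>
    refine ⟨fun r hr => ?_, fun a _ => by simp⟩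
    have : r ≠ x := by rintro rfl; simp [Program.writesReg] at hr
    simp [this]
  | succ s x y =>
    refine ⟨fun r hr => ?_, fun a _ => by simp⟩
    have : r ≠ x := by rintro rfl; simp [Program.writesReg] at hr
    simp [this]
  | sub s x y z =>
    refine ⟨fun r hr => ?_, fun a _ => by simp⟩
    have : r ≠ x := by rintro rfl; simp [Program.writesReg] at hr
    simp [this]
  | load s x a i =>
    refine ⟨fun r hr => ?_, fun a _ => by simp⟩
    have : r ≠ x := by rintro rfl; simp [Program.writesReg] at hr
    simp [this]
  | store s a i x =>
    refine ⟨fun r _ => by simp, fun b hb => ?_⟩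
    have : b ≠ a := by rintro rfl; simp [Program.writesArr] at hb
    simp [this]
  | seq _ _ ih₁ ih₂ =>
    refine ⟨fun r hr => ?_, fun a ha => ?_⟩
    · simp only [Program.writesReg, Bool.or_eq_false_iff] at hr
      exact (ih₂.reg r hr.2).trans (ih₁.reg r hr.1)
    · simp only [Program.writesArr, Bool.or_eq_false_iff] at ha
      exact (ih₂.arr a ha.2).trans (ih₁.arr a ha.1)
  | ifLt_true _ _ ih =>
    refine ⟨fun r hr => ?_, fun a ha => ?_⟩
    · simp only [Program.writesReg, Bool.or_eq_false_iff] at hr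
      exact ih.reg r hr.1
    · simp only [Program.writesArr, Bool.or_eq_false_iff] at ha
      exact ih.arr a ha.1
  | ifLt_false _ _ ih =>
    refine ⟨fun r hr => ?_, fun a ha => ?_⟩
    · simp only [Program.writesReg, Bool.or_eq_false_iff] at hr
      exact ih.reg r hr.2
    · simp only [Program.writesArr, Bool.or_eq_false_iff] at ha
      exact ih.arr a ha.2
  | while_true _ _ _ ih₁ ih₂ =>
    exact ⟨fun r hr => (ih₂.reg r hr).trans (ih₁.reg r hr),
      fun a ha => (ih₂.arr a ha).trans (ih₁.arr a ha)⟩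
  | while_false _ => exact Frame.refl _ _

/-- Started in `s`, the program halts after at most `T` steps, in a memory that satisfies `Q`. -/
def Halts (p : Program) (s : Memory) (T : ℕ) (Q : Memory → Prop) : Prop :=
  ∃ t s', Runs p s t s' ∧ t ≤ T ∧ Q s'

namespace Halts

variable {p q : Program} {s : Memory} {T T' : ℕ} {Q Q' : Memory → Prop}

theorem mono (h : Halts p s T Q) (hT : T ≤ T') (hQ : ∀ s', Frame p s s' → Q s' → Q' s') :
    Halts p s T' Q' := by
  obtain ⟨t, s', h, ht, h'⟩ := h
  exact ⟨t, s', h, ht.trans hT, hQ s' h.frame h'⟩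

/-- Loop-free blocks are executed symbolically, and `cost` bounds their time over all branches. -/
theorem of_exec (hp : p.loopFree = true) (hT : p.cost ≤ T)
    (hQ : Frame p s (p.exec s) → Q (p.exec s)) : Halts p s T Q := by
  obtain ⟨t, h, ht⟩ := p.exists_runs_exec hp s
  exact ⟨t, _, h, ht.trans hT, hQ h.frame⟩

/-- Sequential composition. -/
theorem comp {T₁ T₂ : ℕ} (hp : Halts p s T₁ Q)
    (hq : ∀ s₁, Frame p s s₁ → Q s₁ → Halts q s₁ T₂ Q') : Halts (.seq p q) s (T₁ + T₂) Q' := by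
  obtain ⟨t₁, s₁, h₁, ht₁, hs₁⟩ := hp
  obtain ⟨t₂, s₂, h₂, ht₂, hs₂⟩ := hq s₁ h₁.frame hs₁
  exact ⟨t₁ + t₂, s₂, .seq h₁ h₂, add_le_add ht₁ ht₂, hs₂⟩

theorem comp_exec {T₁ T₂ : ℕ} (hp : p.loopFree = true) (hT : p.cost ≤ T₁)
    (hq : Frame p s (p.exec s) → Halts q (p.exec s) T₂ Q') :
    Halts (.seq p q) s (T₁ + T₂) Q' :=
  comp (Q := fun s₁ => s₁ = p.exec s) (of_exec hp hT fun _ => rfl) fun _ hf h => h ▸ hq (h ▸ hf)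

theorem ite {x y : ℕ} (hp : s.reg x < s.reg y → Halts p s T Q)
    (hq : ¬ s.reg x < s.reg y → Halts q s T Q) : Halts (.ifLt x y p q) s (T + 1) Q := by
  by_cases h : s.reg x < s.reg y
  · obtain ⟨t, s', h', ht, hs⟩ := hp h
    exact ⟨t + 1, s', .ifLt_true h h', by omega, hs⟩
  · obtain ⟨t, s', h', ht, hs⟩ := hq h
    exact ⟨t + 1, s', .ifLt_false h h', by omega, hs⟩

end Halts

/-- The rule for loops. The invariant `I k` says that time `k` is left. -/
theorem exists_runs_loop {p : Program} {x y : ℕ} {s₀ : Memory} (I : ℕ → Memory → Prop)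
    (h : ∀ k s, Frame p s₀ s → I k s → s.reg x < s.reg y →
      ∃ t, Halts p s t fun s' => ∃ k', t + k' + 1 ≤ k ∧ I k' s')
    (k : ℕ) (h₀ : I k s₀) :
    ∃ t s' k', Runs (.whileLt x y p) s₀ t s' ∧ t + k' ≤ k + 1 ∧ I k' s' ∧
      ¬ s'.reg x < s'.reg y := by
  suffices ∀ k s, Frame p s₀ s → I k s → ∃ t s' k', Runs (.whileLt x y p) s t s' ∧
      t + k' ≤ k + 1 ∧ I k' s' ∧ ¬ s'.reg x < s'.reg y from this k s₀ (Frame.refl _ _) h₀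
  intro k
  induction k using Nat.strong_induction_on with
  | _ k ih =>
    intro s hf hs
    by_cases hxy : s.reg x < s.reg y
    · obtain ⟨t, t₁, s₁, h₁, ht₁, k', hk', hs₁⟩ := h k s hf hs hxy
      obtain ⟨t₂, s₂, k₂, h₂, ht₂, hs₂⟩ := ih k' (by omega) s₁ (hf.trans h₁.frame) hs₁
      exact ⟨t₁ + t₂ + 1, s₂, k₂, .while_true hxy h₁ h₂, by omega, hs₂⟩
    · exact ⟨1, s, k, .while_false hxy, by omega, hs, hxy⟩

/-- For loops whose unspent time is of no further use; an amortised bound needs `exists_runs_loop`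
itself. -/
theorem Halts.loop {p : Program} {x y : ℕ} {s₀ : Memory} (I : ℕ → Memory → Prop)
    (h : ∀ k s, Frame p s₀ s → I k s → s.reg x < s.reg y →
      ∃ t, Halts p s t fun s' => ∃ k', t + k' + 1 ≤ k ∧ I k' s')
    (k : ℕ) (h₀ : I k s₀) :
    Halts (.whileLt x y p) s₀ (k + 1) fun s' => (∃ k', I k' s') ∧ ¬ s'.reg x < s'.reg y := by
  obtain ⟨t, s', k', hr, ht, hI, hlt⟩ := exists_runs_loop I h k h₀
  exact ⟨t, s', hr, by omega, ⟨k', hI⟩, hlt⟩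


/-! ### Linked lists in arrays. -/

/-- `l` is the linked list that starts in the node `k`. The nodes are positive numbers below
`K`; `val` holds the elements and `nxt` the successors, with `0` at the end. -/
def IsList (val nxt : ℕ → ℕ) (K : ℕ) : ℕ → List ℕ → Prop
  | k, [] => k = 0
  | k, y :: l => 0 < k ∧ k < K ∧ val k = y ∧ IsList val nxt K (nxt k) l

/-- A list reads no node from `K` on, so writing to free nodes does no harm. -/
theorem IsList.congr {val nxt val' nxt' : ℕ → ℕ} {K K' : ℕ} (hK : K ≤ K')
    (hv : ∀ k, k < K → val' k = val k) (hn : ∀ k, k < K → nxt' k = nxt k) :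
    ∀ {k : ℕ} {l : List ℕ}, IsList val nxt K k l → IsList val' nxt' K' k l
  | _, [], h => h
  | _, _ :: _, ⟨h₁, h₂, h₃, h₄⟩ =>
    ⟨h₁, h₂.trans_le hK, (hv _ h₂).trans h₃, (hn _ h₂).symm ▸ h₄.congr hK hv hn⟩

theorem IsList.cons {val nxt : ℕ → ℕ} {K k : ℕ} {l : List ℕ} (h : IsList val nxt K k l)
    (hK : 0 < K) (y : ℕ) :
    IsList (Function.update val K y) (Function.update nxt K k) (K + 1) K (y :: l) := by
  refine ⟨hK, K.lt_succ_self, by simp, ?_⟩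
  rw [Function.update_self]
  exact h.congr K.le_succ (fun i hi => by simp [hi.ne]) (fun i hi => by simp [hi.ne])

theorem IsList.eq_nil {val nxt : ℕ → ℕ} {K : ℕ} {l : List ℕ} (h : IsList val nxt K 0 l) :
    l = [] := by
  cases l with
  | nil => rfl
  | cons y l => exact absurd h.1 (lt_irrefl 0)

theorem IsList.exists_eq_cons {val nxt : ℕ → ℕ} {K k : ℕ} {l : List ℕ}
    (h : IsList val nxt K k l) (hk : 0 < k) :
    ∃ l', l = val k :: l' ∧ k < K ∧ IsList val nxt K (nxt k) l' := by
  cases l with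
  | nil => exact absurd h hk.ne'
  | cons y l => exact ⟨l, by rw [h.2.2.1], h.2.1, h.2.2.2⟩

end RAM


/-! ### Transitive orientations of the non-edges of a symmetric relation -/

/-- On the set `C`, the relation `F` is a transitive orientation of the complement of `E`. -/
structure OrientsCompl {V : Type*} (E F : V → V → Prop) (C : Set V) : Prop where
  not_adj : ∀ a ∈ C, ∀ b ∈ C, F a b → ¬ E a b
  total : ∀ a ∈ C, ∀ b ∈ C, a ≠ b → ¬ E a b → F a b ∨ F b a
  asymm : ∀ a ∈ C, ∀ b ∈ C, F a b → ¬ F b a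
  trans : ∀ a ∈ C, ∀ b ∈ C, ∀ c ∈ C, F a b → F b c → F a c

/-- All elements of `M` have the same neighbours in `C \ M`. -/
def IsModuleIn {V : Type*} (E : V → V → Prop) (M C : Set V) : Prop :=
  ∀ a ∈ M, ∀ b ∈ M, ∀ c ∈ C, c ∉ M → (E c a ↔ E c b)

/-- On `C`, every vertex that prefers `c` to an earlier `b`, where both come later than the vertex,
is preceded by a vertex that prefers `b` to `c`. This is the property of the orders that are found
by lexicographic breadth first search. -/
def IsLexOrder {V : Type*} (E : V → V → Prop) (σ : V → ℕ) (C : Set V) : Prop :=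
  ∀ a ∈ C, ∀ b ∈ C, ∀ c ∈ C, σ a < σ b → σ b < σ c → E a c → ¬ E a b →
    ∃ d ∈ C, σ d < σ a ∧ E d b ∧ ¬ E d c

section

variable {V : Type*} {E F F' : V → V → Prop} {C M : Set V}

namespace OrientsCompl

theorem swap (hE : ∀ a b, E a b → E b a) (h : OrientsCompl E F C) :
    OrientsCompl E (fun a b => F b a) C where
  not_adj a ha b hb hab hE' := h.not_adj b hb a ha hab (hE _ _ hE')
  total a ha b hb hab hE' := (h.total a ha b hb hab hE').symm
  asymm a ha b hb hab := h.asymm b hb a ha hab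
  trans a ha b hb c hc hab hbc := h.trans c hc b hb a ha hbc hab

theorem mono {D : Set V} (h : OrientsCompl E F C) (hD : D ⊆ C) : OrientsCompl E F D where
  not_adj a ha b hb := h.not_adj a (hD ha) b (hD hb)
  total a ha b hb := h.total a (hD ha) b (hD hb)
  asymm a ha b hb := h.asymm a (hD ha) b (hD hb)
  trans a ha b hb c hc := h.trans a (hD ha) b (hD hb) c (hD hc)

open Classical in
/-- Replace `F` by `F'` on the module `M` that is represented by `z`. -/
theorem subst (hE : ∀ a b, E a b → E b a) (h : OrientsCompl E F C) (h' : OrientsCompl E F' M)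
    (hM : IsModuleIn E M C) (hMC : M ⊆ C) {z : V} (hz : z ∈ M) :
    OrientsCompl E (fun a b => if a ∈ M ∧ b ∈ M then F' a b else
      F (if a ∈ M then z else a) (if b ∈ M then z else b)) C := by
  have hzC := hMC hz
  have hM' : ∀ a ∈ M, ∀ c ∈ C, c ∉ M → (E a c ↔ E z c) := fun a ha c hc hcM =>
    ⟨fun h => hE _ _ ((hM a ha z hz c hc hcM).1 (hE _ _ h)),
      fun h => hE _ _ ((hM a ha z hz c hc hcM).2 (hE _ _ h))⟩
  constructor
  · intro a ha b hb hab
    by_cases haM : a ∈ M <;> by_cases hbM : b ∈ M <;> simp only [haM, hbM, and_self, and_true,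
      and_false, if_true, if_false] at hab
    · exact h'.not_adj a haM b hbM hab
    · rw [hM' a haM b hb hbM]
      exact h.not_adj z hzC b hb hab
    · rw [hM b hbM z hz a ha haM]
      exact h.not_adj a ha z hzC hab
    · exact h.not_adj a ha b hb hab
  · intro a ha b hb hab hEab
    by_cases haM : a ∈ M <;> by_cases hbM : b ∈ M <;> simp only [haM, hbM, and_self, and_true,
      and_false, if_true, if_false]
    · exact h'.total a haM b hbM hab hEab
    · rw [hM' a haM b hb hbM] at hEab
      exact h.total z hzC b hb (fun e => hbM (e ▸ hz)) hEab
    · rw [hM b hbM z hz a ha haM] at hEab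
      exact h.total a ha z hzC (fun e => haM (e ▸ hz)) hEab
    · exact h.total a ha b hb hab hEab
  · intro a ha b hb hab
    by_cases haM : a ∈ M <;> by_cases hbM : b ∈ M <;> simp only [haM, hbM, and_self, and_true,
      and_false, if_true, if_false] at hab ⊢
    · exact h'.asymm a haM b hbM hab
    · exact h.asymm z hzC b hb hab
    · exact h.asymm a ha z hzC hab
    · exact h.asymm a ha b hb hab
  · intro a ha b hb c hc hab hbc
    by_cases haM : a ∈ M <;> by_cases hbM : b ∈ M <;> by_cases hcM : c ∈ M <;>
      simp only [haM, hbM, hcM, and_self, and_true, and_false, if_true, if_false] at hab hbc ⊢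
    · exact h'.trans a haM b hbM c hcM hab hbc
    · exact hbc
    -- Here `a` and `c` lie in `M` and `b` does not: both are represented by `z`, which would come
    -- before and after `b`.
    · exact absurd hbc (h.asymm z hzC b hb hab)
    · exact h.trans z hzC b hb c hc hab hbc
    · exact hab
    · exact h.trans a ha z hzC c hc hab hbc
    · exact h.trans a ha b hb z hzC hab hbc
    · exact h.trans a ha b hb c hc hab hbc

end OrientsCompl

/-- The vertex `d` distinguishes two elements of the module, hence belongs to it. -/
theorem IsLexOrder.of_isModuleIn {σ : V → ℕ} (h : IsLexOrder E σ C) (hM : IsModuleIn E M C)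
    (hMC : M ⊆ C) : IsLexOrder E σ M := by
  intro a ha b hb c hc hab hbc hac hab'
  obtain ⟨d, hd, hda, hdb, hdc⟩ := h a (hMC ha) b (hMC hb) c (hMC hc) hab hbc hac hab'
  refine ⟨d, ?_, hda, hdb, hdc⟩
  by_contra hdM
  exact hdc ((hM b hb c hc d hd hdM).1 hdb)

/-- In a lexicographic order, if nothing before `y` prefers `y` to the last vertex `z`, then the
vertices from `y` on are a module. -/
theorem IsLexOrder.isModuleIn_suffix {σ : V → ℕ} (h : IsLexOrder E σ C) (hσ : Set.InjOn σ C)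
    {y z : V} (hy : y ∈ C) (hz : z ∈ C) (hzmax : ∀ w ∈ C, σ w ≤ σ z)
    (hyz : ∀ d ∈ C, σ d < σ y → E d y → E d z) :
    IsModuleIn E {w ∈ C | σ y ≤ σ w} C := by
  -- Every vertex before `y` sees the whole suffix as it sees `z`: a vertex that does not would, by
  -- the lexicographic property, be preceded by another such vertex.
  have key : ∀ k : ℕ, ∀ d ∈ C, σ d = k → σ d < σ y → ∀ w ∈ C, σ y ≤ σ w → (E d w ↔ E d z) := by
    intro k
    induction k using Nat.strong_induction_on with
    | _ k ih =>
      rintro d hd rfl hdy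
      have h1 : ∀ u ∈ C, σ y ≤ σ u → σ u < σ z → E d z → E d u := by
        intro u hu hyu huz hdz
        by_contra hdu
        obtain ⟨d', hd', hdd', hdu', hdz'⟩ := h d hd u hu z hz (hdy.trans_le hyu) huz hdz hdu
        exact hdz' ((ih _ hdd' d' hd' rfl (hdd'.trans hdy) u hu hyu).1 hdu')
      intro w hw hyw
      rcases (hzmax w hw).eq_or_lt with hwz | hwz
      · rw [hσ hw hz hwz]
      refine ⟨fun hdw => ?_, h1 w hw hyw hwz⟩
      rcases hyw.eq_or_lt with hyw' | hyw'
      · rw [← hσ hy hw hyw'] at hdw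
        exact hyz d hd hdy hdw
      · refine hyz d hd hdy ?_
        by_contra hdy'
        obtain ⟨d', hd', hdd', hdu', hdz'⟩ := h d hd y hy w hw hdy hyw' hdw hdy'
        have := ih _ hdd' d' hd' rfl (hdd'.trans hdy)
        exact hdz' ((this w hw hyw).2 ((this y hy le_rfl).1 hdu'))
  intro a ha b hb c hc hcM
  have hcy : σ c < σ y := by
    by_contra hcy
    exact hcM ⟨hc, not_lt.1 hcy⟩
  rw [key _ c hc rfl hcy a ha.1 ha.2, key _ c hc rfl hcy b hb.1 hb.2]

/-- The last vertex of a lexicographic order of a cocomparability graph is a source of some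
transitive orientation of the complement. -/
theorem IsLexOrder.exists_source (hE : ∀ a b, E a b → E b a) {σ : V → ℕ} (hC : C.Finite)
    (hσ : Set.InjOn σ C) (hlex : IsLexOrder E σ C) (hF : OrientsCompl E F C) {z : V} (hz : z ∈ C)
    (hzmax : ∀ w ∈ C, σ w ≤ σ z) :
    ∃ F', OrientsCompl E F' C ∧ ∀ y ∈ C, y ≠ z → ¬ E z y → F' z y := by
  induction hk : C.ncard using Nat.strong_induction_on generalizing C F with
  | _ k ih =>
    subst hk
    -- Reduction to a proper module `M` that contains `z`: the solution on `M`, given by induction,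
    -- is substituted into an orientation in which `z` precedes its non-neighbours outside of `M`.
    have step : ∀ M ⊆ C, M ≠ C → z ∈ M → IsModuleIn E M C → ∀ F₁, OrientsCompl E F₁ C →
        (∀ y ∈ C, y ∉ M → ¬ E z y → F₁ z y) →
        ∃ F', OrientsCompl E F' C ∧ ∀ y ∈ C, y ≠ z → ¬ E z y → F' z y := by
      intro M hMC hne hzM hM F₁ hF₁ hsrc
      obtain ⟨F', hF', hF'z⟩ := ih M.ncard (Set.ncard_lt_ncard (hMC.ssubset_of_ne hne) hC)
        (hC.subset hMC) (hσ.mono hMC) (hlex.of_isModuleIn hM hMC) (hF.mono hMC) hzM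
        (fun w hw => hzmax w (hMC hw)) rfl
      refine ⟨_, hF₁.subst hE hF' hM hMC hzM, fun y hy hyz hzy => ?_⟩
      by_cases hyM : y ∈ M
      · simpa [hzM, hyM] using hF'z y hyM hyz hzy
      · simpa [hzM, hyM] using hsrc y hy hyM hzy
    obtain ⟨v, hv, hvmin⟩ := Set.exists_min_image C σ hC ⟨z, hz⟩
    by_cases hvz : v = z
    · subst hvz
      refine ⟨F, hF, fun y hy hyv _ => absurd (hσ hy hv ?_) hyv⟩
      exact le_antisymm (hzmax y hy) (hvmin y hy)
    by_cases hEvz : E v z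
    -- If the first vertex `v` is adjacent to the last one, it is adjacent to all, since nothing
    -- comes before `v` that could justify a non-neighbour. So the remaining vertices are a module.
    · have huniv : ∀ b ∈ C, b ≠ v → E v b := by
        intro b hb hbv
        by_cases hbz : b = z
        · rwa [hbz]
        by_contra hvb
        obtain ⟨d, hd, hdv, -⟩ := hlex v hv b hb z hz
          ((hvmin b hb).lt_of_ne fun e => hbv (hσ hb hv e.symm))
          ((hzmax b hb).lt_of_ne fun e => hbz (hσ hb hz e)) hEvz hvb
        exact absurd (hvmin d hd) (not_le.2 hdv)
      refine step (C \ {v}) Set.sdiff_subset (fun e => ?_) ⟨hz, Ne.symm hvz⟩ ?_ F hF ?_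
      · have := e.symm ▸ hv
        exact this.2 rfl
      · intro a ha b hb c hc hcM
        have : c = v := by
          by_contra hcv
          exact hcM ⟨hc, hcv⟩
        subst this
        exact ⟨fun _ => huniv b hb.1 hb.2, fun _ => huniv a ha.1 ha.2⟩
      · intro y hy hyM hzy
        have : y = v := by
          by_contra hyv
          exact hyM ⟨hy, hyv⟩
        exact absurd (hE _ _ hEvz) (this ▸ hzy)
    -- Otherwise `z` may be taken to precede `v`, reversing the orientation if necessary.
    · obtain ⟨F₁, hF₁, hF₁z⟩ : ∃ F₁, OrientsCompl E F₁ C ∧ F₁ z v := by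
        rcases hF.total v hv z hz hvz hEvz with h | h
        · exact ⟨_, hF.swap hE, h⟩
        · exact ⟨F, hF, h⟩
      -- The earliest `u` other than `v` whose suffix is a module; one exists because the suffix of
      -- `z` is `{z}`.
      obtain ⟨u, ⟨hu, huv, hMu⟩, humin⟩ := Set.exists_min_image
        {u ∈ C | u ≠ v ∧ IsModuleIn E {w ∈ C | σ u ≤ σ w} C} σ (hC.subset (Set.sep_subset _ _))
        ⟨z, hz, Ne.symm hvz, by
          intro a ha b hb c _ _
          rw [hσ ha.1 hz (le_antisymm (hzmax a ha.1) ha.2),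
            hσ hb.1 hz (le_antisymm (hzmax b hb.1) hb.2)]⟩
      -- Since the suffix of `y` is not a module, some earlier `d` is adjacent to `y` but not to
      -- `z`. By induction `z` precedes `d`; if `y` preceded `z`, it would precede its neighbour
      -- `d`.
      have key : ∀ k, ∀ y ∈ C, σ y = k → σ y < σ u → ¬ E y z → F₁ z y := by
        intro k
        induction k using Nat.strong_induction_on with
        | _ k ihk =>
          rintro y hy rfl hyu hyz
          by_cases hyv : y = v
          · exact hyv ▸ hF₁z
          have : ¬ IsModuleIn E {w ∈ C | σ y ≤ σ w} C := fun h =>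
            absurd (humin y ⟨hy, hyv, h⟩) (not_le.2 hyu)
          have : ∃ d ∈ C, σ d < σ y ∧ E d y ∧ ¬ E d z := by
            by_contra! hno
            exact this (hlex.isModuleIn_suffix hσ hy hz hzmax hno)
          obtain ⟨d, hd, hdy, hEdy, hEdz⟩ := this
          have hzd := ihk _ hdy d hd rfl (hdy.trans hyu) hEdz
          have hyz' : y ≠ z := fun e => absurd (hzmax u hu) (not_le.2 (e ▸ hyu))
          rcases hF₁.total y hy z hz hyz' hyz with h | h
          · exact absurd (hE _ _ hEdy) (hF₁.not_adj y hy d hd (hF₁.trans y hy z hz d hd h hzd))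
          · exact h
      refine step {w ∈ C | σ u ≤ σ w} (Set.sep_subset _ _) (fun e => ?_) ⟨hz, hzmax u hu⟩ hMu F₁
        hF₁ ?_
      · have := e.symm ▸ hv
        exact huv (hσ hu hv (le_antisymm this.2 (hvmin u hu)))
      · intro y hy hyM hzy
        exact key _ y hy rfl (by by_contra h; exact hyM ⟨hy, not_lt.1 h⟩)
          fun h => hzy (hE _ _ h)

end

/-! ### From a graph to its transitive closure -/

namespace Digraph

variable {V : Type*} {G : Digraph V}

theorem transGen_of_transitiveClosure_adj {a b : V}
    (h : G.transitiveClosure.Adj a b) : Relation.TransGen G.Adj a b := by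
  -- This digraph may have loops, which is harmless: the infimum ranges over arbitrary transitive
  -- digraphs.
  let K : Digraph V := ⟨fun x y => Relation.TransGen G.Adj x y⟩
  have hK : K ∈ {H : Digraph V | G ≤ H ∧ H.IsTransitive} :=
    ⟨fun x y hxy => Relation.TransGen.single hxy, fun x y z hxy hyz _ => hxy.trans hyz⟩
  exact (sInf_le hK : G.transitiveClosure ≤ K) h

theorem transitiveClosure_adj_of_transGen {a b : V} (h : Relation.TransGen G.Adj a b)
    (hab : a ≠ b) : G.transitiveClosure.Adj a b := by
  have : G.transitiveClosure.Adj a b ↔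
      ∀ H ∈ {H : Digraph V | G ≤ H ∧ H.IsTransitive}, H.Adj a b := Iff.rfl
  rw [this]
  rintro H ⟨hGH, hH⟩
  -- A path may return to `a`, where `IsTransitive` does not provide a loop; hence the alternative
  -- `a = c`.
  have : ∀ c, Relation.TransGen G.Adj a c → a = c ∨ H.Adj a c := by
    intro c hc
    induction hc with
    | single h => exact Or.inr (hGH h)
    | tail _ h ih =>
      rename_i x y _
      by_cases hay : a = y
      · exact Or.inl hay
      rcases ih with rfl | ih
      · exact Or.inr (hGH h)
      · exact Or.inr (hH _ _ _ ih (hGH h) hay)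
  exact (this b h).resolve_left hab

/-- An order that orients the undirected complement of `G` transitively also orients the
undirected complement of the transitive closure transitively. -/
theorem isTransitiveOrientationOf_orientAlong_transitiveClosure {n : ℕ} (v : Fin n ≃ V)
    (h : ∀ a b c, v.symm a < v.symm b → v.symm b < v.symm c → ¬ G.undirectedClosure.Adj a b →
      ¬ G.undirectedClosure.Adj b c → ¬ G.undirectedClosure.Adj a c) :
    (G.transitiveClosure.undirectedComplement.orientAlong v).IsTransitiveOrientationOf
      G.transitiveClosure.undirectedComplement := by
  have hsymm : ∀ a b, G.transitiveClosure.undirectedComplement.Adj a b →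
      G.transitiveClosure.undirectedComplement.Adj b a := by
    rintro a b ⟨hab, h⟩
    exact ⟨hab.symm, fun h' => h h'.symm⟩
  refine ⟨⟨⟨?_, ?_⟩, ?_⟩, ?_⟩
  · rintro a b ⟨h₁, h₂⟩
    exact absurd h₁.2 h₂.2.le.not_gt
  · exact fun a b hab => hab.1
  · rintro K ⟨hK, hKG⟩ hle a b hab
    have hadj := hKG hab
    rcases lt_trichotomy (v.symm a) (v.symm b) with hlt | heq | hgt
    · exact ⟨hadj, hlt⟩
    · exact absurd (v.symm.injective heq) hadj.1
    · exact absurd ⟨hab, hle ⟨hsymm _ _ hadj, hgt⟩⟩ (hK a b)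
  · have hreach : ∀ a b, G.transitiveClosure.undirectedComplement.Adj a b →
        ¬ Relation.TransGen G.Adj a b ∧ ¬ Relation.TransGen G.Adj b a := by
      rintro a b ⟨hab, hnot⟩
      exact ⟨fun h => hnot (Or.inl (transitiveClosure_adj_of_transGen h hab)),
        fun h => hnot (Or.inr (transitiveClosure_adj_of_transGen h hab.symm))⟩
    -- a walk cannot pass a vertex that is incomparable to both ends
    have pass : ∀ a b c, ¬ Relation.ReflTransGen G.Adj a b → ¬ Relation.ReflTransGen G.Adj b c →
        ∀ x, Relation.ReflTransGen G.Adj a x → Relation.ReflTransGen G.Adj x c →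
        ((v.symm a < v.symm b → v.symm x < v.symm b) ∧
          (v.symm b < v.symm a → v.symm b < v.symm x)) := by
      intro a b c hab hbc x hax hxc
      induction hax with
      | refl => exact ⟨id, id⟩
      | tail hax hxy ih =>
        rename_i x y
        have ih := ih (Relation.ReflTransGen.head hxy hxc)
        have hyb : y ≠ b := fun e => hab (e ▸ hax.tail hxy)
        have hyb' : v.symm y ≠ v.symm b := fun e => hyb (v.symm.injective e)
        -- An edge between `b` and a vertex of the walk would give a path from `a` to `b` or from
        -- `b` to `c`.
        have hxb : ¬ G.undirectedClosure.Adj x b := by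
          rintro (h | h)
          · exact hab (hax.tail h)
          · exact hbc (Relation.ReflTransGen.head h (Relation.ReflTransGen.head hxy hxc))
        have hby : ¬ G.undirectedClosure.Adj b y := by
          rintro (h | h)
          · exact hbc (Relation.ReflTransGen.head h hxc)
          · exact hab ((hax.tail hxy).tail h)
        have hsym : ∀ p q, ¬ G.undirectedClosure.Adj p q → ¬ G.undirectedClosure.Adj q p :=
          fun p q hpq hqp => hpq (Or.symm hqp)
        refine ⟨fun hlt => ?_, fun hlt => ?_⟩
        · by_contra hyb''
          exact h x b y (ih.1 hlt) (lt_of_le_of_ne (not_lt.1 hyb'') hyb'.symm) hxb hby (Or.inl hxy)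
        · by_contra hyb''
          exact h y b x (lt_of_le_of_ne (not_lt.1 hyb'') hyb') (ih.2 hlt) (hsym _ _ hby)
            (hsym _ _ hxb) (Or.inr hxy)
    have refl_of : ∀ a b, a ≠ b → ¬ Relation.TransGen G.Adj a b →
        ¬ Relation.ReflTransGen G.Adj a b := by
      intro a b hab hnot h
      rcases Relation.reflTransGen_iff_eq_or_transGen.1 h with h | h
      · exact hab h.symm
      · exact hnot h
    rintro a b c ⟨hab, hab'⟩ ⟨hbc, hbc'⟩ hac
    have h₁ := hreach a b hab
    have h₂ := hreach b c hbc
    have ne₁ : a ≠ b := hab.1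
    have ne₂ : b ≠ c := hbc.1
    refine ⟨⟨hac, ?_⟩, hab'.trans hbc'⟩
    -- A path from `a` to `c` would remain below `b`, and a path from `c` to `a` would remain above
    -- it.
    rintro (h | h)
    · have := (pass a b c (refl_of _ _ ne₁ h₁.1) (refl_of _ _ ne₂ h₂.1) c
        (transGen_of_transitiveClosure_adj h).to_reflTransGen .refl).1 hab'
      exact absurd hbc' this.not_gt
    · have := (pass c b a (refl_of _ _ ne₂.symm h₂.2) (refl_of _ _ ne₁.symm h₁.2) a
        (transGen_of_transitiveClosure_adj h).to_reflTransGen .refl).2 hbc'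
      exact absurd hab' this.not_gt

end Digraph


/-! ### Ordered partitions in arrays -/

/-- The arrays that hold an ordered partition of `0, …, n - 1` into classes: `ord` lists the
elements, `pos` is its inverse, and the class with the name `c` fills the positions from `st c` to
`en c - 1`. The array `tw` is used when classes are split, and `nid` is the next unused name. -/
@[ext]
structure OrdPart where
  ord : ℕ → ℕ
  pos : ℕ → ℕ
  cls : ℕ → ℕ
  st : ℕ → ℕ
  en : ℕ → ℕ
  tw : ℕ → ℕ
  nid : ℕ

namespace OrdPart

/-- `ord` and `pos` are inverse to each other. -/
structure IsPerm (n : ℕ) (P : OrdPart) : Prop where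
  ord_lt : ∀ i < n, P.ord i < n
  pos_lt : ∀ v < n, P.pos v < n
  pos_ord : ∀ i < n, P.pos (P.ord i) = i
  ord_pos : ∀ v < n, P.ord (P.pos v) = v

theorem IsPerm.pos_inj {n : ℕ} {P : OrdPart} (h : P.IsPerm n) {v w : ℕ} (hv : v < n) (hw : w < n)
    (hvw : P.pos v = P.pos w) : v = w := by
  rw [← h.ord_pos v hv, hvw, h.ord_pos w hw]

/-- The arrays represent an ordered partition. -/
structure WF (n : ℕ) (P : OrdPart) : Prop extends P.IsPerm n where
  lo : ∀ v < n, P.st (P.cls v) ≤ P.pos v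
  hi : ∀ v < n, P.pos v < P.en (P.cls v)
  en_le : ∀ v < n, P.en (P.cls v) ≤ n
  cls_eq : ∀ v < n, ∀ w < n, P.st (P.cls v) ≤ P.pos w → P.pos w < P.en (P.cls v) →
    P.cls w = P.cls v
  cls_lt : ∀ v < n, P.cls v < P.nid
  tw_lt : ∀ c, P.tw c < P.nid

/-- `P'` arises from `P` by splitting every class other than `cx` into the elements of `T` and the
others; the former come last in the classes that begin before `px`, and first otherwise. -/
structure Split (n : ℕ) (T : ℕ → Prop) (cx px : ℕ) (P P' : OrdPart) : Prop where
  cls_eq_iff : ∀ v < n, ∀ w < n,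
    (P'.cls v = P'.cls w ↔ P.cls v = P.cls w ∧ (P.cls v = cx ∨ (T v ↔ T w)))
  left : ∀ v < n, ∀ w < n, P.cls v = P.cls w → P.cls v ≠ cx → T v → ¬ T w →
    P.st (P.cls v) < px → P'.pos w < P'.pos v
  right : ∀ v < n, ∀ w < n, P.cls v = P.cls w → P.cls v ≠ cx → T v → ¬ T w →
    px ≤ P.st (P.cls v) → P'.pos v < P'.pos w
  lo : ∀ v < n, P.st (P.cls v) ≤ P'.pos v
  hi : ∀ v < n, P'.pos v < P.en (P.cls v)
  cls_own : ∀ v < n, P.cls v = cx → P'.cls v = cx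
  pos_own : ∀ v < n, P.cls v = cx → P'.pos v = P.pos v

/-- The state while classes are being split; the elements of `T` have been treated. -/
structure Mid (n : ℕ) (T : ℕ → Prop) (cx px : ℕ) (P₀ P : OrdPart) : Prop extends P.IsPerm n where
  nid_le : P₀.nid ≤ P.nid
  tw_lt : ∀ c, P.tw c < P.nid
  cls_old : ∀ v < n, (¬ T v ∨ P₀.cls v = cx) → P.cls v = P₀.cls v
  cls_new : ∀ v < n, T v → P₀.cls v ≠ cx → P.cls v = P.tw (P₀.cls v) ∧ P₀.nid ≤ P.cls v
  tw_inj : ∀ c d, P₀.nid ≤ P.tw c → P.tw c = P.tw d → c = d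
  tw_own : P.tw cx < P₀.nid
  right : ∀ c < P₀.nid, P₀.nid ≤ P.tw c → px ≤ P₀.st c →
    P.st (P.tw c) = P₀.st c ∧ P.en (P.tw c) = P.st c ∧ P.en c = P₀.en c
  left : ∀ c < P₀.nid, P₀.nid ≤ P.tw c → P₀.st c < px →
    P.en (P.tw c) = P₀.en c ∧ P.st (P.tw c) = P.en c ∧ P.st c = P₀.st c
  same : ∀ c < P₀.nid, P.tw c < P₀.nid → P.st c = P₀.st c ∧ P.en c = P₀.en c
  st_le : ∀ c < P₀.nid, P₀.st c ≤ P.st c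
  le_en : ∀ c < P₀.nid, P.en c ≤ P₀.en c
  st_le_en : ∀ c < P₀.nid, P₀.st c ≤ P₀.en c → P.st c ≤ P.en c
  lo : ∀ v < n, P.st (P.cls v) ≤ P.pos v
  hi : ∀ v < n, P.pos v < P.en (P.cls v)
  pos_own : ∀ v < n, P₀.cls v = cx → P.pos v = P₀.pos v

namespace Mid

variable {n cx px : ℕ} {T : ℕ → Prop} {P₀ P : OrdPart}

theorem init (h : P₀.WF n) : Mid n (fun _ => False) cx px P₀ P₀ where
  toIsPerm := h.toIsPerm
  nid_le := le_rfl
  tw_lt := h.tw_lt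
  cls_old _ _ _ := rfl
  cls_new _ _ h := h.elim
  tw_inj c _ hc _ := absurd (h.tw_lt c) (not_lt.2 hc)
  tw_own := h.tw_lt cx
  right c _ hc := absurd (h.tw_lt c) (not_lt.2 hc)
  left c _ hc := absurd (h.tw_lt c) (not_lt.2 hc)
  same _ _ _ := ⟨rfl, rfl⟩
  st_le _ _ := le_rfl
  le_en _ _ := le_rfl
  st_le_en _ _ h := h
  lo := h.lo
  hi := h.hi
  pos_own _ _ _ := rfl

/-- Names below `P₀.nid` are old, all others were created during the current split. The same test on
an entry of `tw` tells whether a class already has a twin, so that `tw` is never cleared between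
splits. -/
theorem cls_dichotomy (h : Mid n T cx px P₀ P) {v : ℕ} (hv : v < n) :
    (P.cls v = P₀.cls v ∧ (¬ T v ∨ P₀.cls v = cx)) ∨
      (P.cls v = P.tw (P₀.cls v) ∧ P₀.nid ≤ P.cls v ∧ T v ∧ P₀.cls v ≠ cx) := by
  by_cases hT : ¬ T v ∨ P₀.cls v = cx
  · exact Or.inl ⟨h.cls_old v hv hT, hT⟩
  · push Not at hT
    obtain ⟨h₁, h₂⟩ := h.cls_new v hv hT.1 hT.2
    exact Or.inr ⟨h₁, h₂, hT⟩

/-- A class and its twin together fill the interval of the old class, in one order or the other. -/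
theorem interval (h₀ : P₀.WF n) (h : Mid n T cx px P₀ P) {v : ℕ} (hv : v < n) :
    P₀.st (P₀.cls v) ≤ P.pos v ∧ P.pos v < P₀.en (P₀.cls v) := by
  have hc := h₀.cls_lt v hv
  have h1 := h.lo v hv
  have h2 := h.hi v hv
  have h3 := h.st_le _ hc
  have h4 := h.le_en _ hc
  have h5 := h.st_le_en _ hc ((h₀.lo v hv).trans (h₀.hi v hv).le)
  rcases h.cls_dichotomy hv with ⟨he, -⟩ | ⟨he, hge, -, -⟩
  · rw [he] at h1 h2
    omega
  · rw [he] at h1 h2 hge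
    rcases le_or_gt px (P₀.st (P₀.cls v)) with hp | hp
    · have := h.right _ hc hge hp
      omega
    · have := h.left _ hc hge hp
      omega

theorem cls₀_eq (h₀ : P₀.WF n) (h : Mid n T cx px P₀ P) {v w : ℕ} (hv : v < n) (hw : w < n)
    (h₁ : P₀.st (P₀.cls v) ≤ P.pos w) (h₂ : P.pos w < P₀.en (P₀.cls v)) :
    P₀.cls w = P₀.cls v := by
  have hp := h.pos_lt w hw
  have h3 := h.interval h₀ hw
  have e1 := h₀.cls_eq v hv _ (h₀.ord_lt _ hp)
  have e2 := h₀.cls_eq w hw _ (h₀.ord_lt _ hp)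
  rw [h₀.pos_ord _ hp] at e1 e2
  rw [← e1 h₁ h₂, ← e2 h3.1 h3.2]

theorem cls_eq_old (h₀ : P₀.WF n) (h : Mid n T cx px P₀ P) {c w : ℕ} (hw : w < n)
    (hc : ∃ v < n, P₀.cls v = c) (h₁ : P.st c ≤ P.pos w) (h₂ : P.pos w < P.en c) :
    P.cls w = c ∧ P₀.cls w = c := by
  obtain ⟨v, hv, rfl⟩ := hc
  have hc := h₀.cls_lt v hv
  have h3 := h.st_le _ hc
  have h4 := h.le_en _ hc
  have e := h.cls₀_eq h₀ hv hw (by omega) (by omega)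
  refine ⟨?_, e⟩
  rcases h.cls_dichotomy hw with ⟨he, -⟩ | ⟨he, hge, -, -⟩
  · rw [he, e]
  · exfalso
    have h5 := h.lo w hw
    have h6 := h.hi w hw
    rw [he, e] at h5 h6 hge
    rcases le_or_gt px (P₀.st (P₀.cls v)) with hp | hp
    · have := h.right _ hc hge hp
      omega
    · have := h.left _ hc hge hp
      omega

/-- Old and new names are disjoint, and `tw` is injective where its values are new; so a class
breaks exactly into its treated and its untreated elements. -/
theorem cls_iff (h₀ : P₀.WF n) (h : Mid n T cx px P₀ P) {v w : ℕ} (hv : v < n) (hw : w < n) :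
    P.cls v = P.cls w ↔ P₀.cls v = P₀.cls w ∧ (P₀.cls v = cx ∨ (T v ↔ T w)) := by
  have hc := h₀.cls_lt v hv
  have hd := h₀.cls_lt w hw
  rcases h.cls_dichotomy hv with ⟨he, h1⟩ | ⟨he, hge, hT, h1⟩ <;>
    rcases h.cls_dichotomy hw with ⟨he', h1'⟩ | ⟨he', hge', hT', h1'⟩
  · rw [he, he']
    refine ⟨fun e => ⟨e, ?_⟩, fun e => e.1⟩
    rw [e] at h1 ⊢
    tauto
  · refine ⟨fun e => by omega, fun e => ?_⟩
    rw [e.1] at h1 e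
    tauto
  · refine ⟨fun e => by omega, fun e => ?_⟩
    rw [e.1] at h1 e
    tauto
  · rw [he, he']
    refine ⟨fun e => ⟨h.tw_inj _ _ (he ▸ hge) e, by tauto⟩, fun e => by rw [e.1]⟩

theorem split (h₀ : P₀.WF n) (h : Mid n T cx px P₀ P) : Split n T cx px P₀ P where
  cls_eq_iff v hv w hw := h.cls_iff h₀ hv hw
  left v hv w hw e hcx hTv hTw hp := by
    have h1 := h.cls_new v hv hTv hcx
    have h2 := h.cls_old w hw (Or.inl hTw)
    have h3 := h.lo v hv
    have h4 := h.hi w hw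
    rw [h1.1] at h3 h1
    rw [h2, ← e] at h4
    have := h.left _ (h₀.cls_lt v hv) h1.2 hp
    omega
  right v hv w hw e hcx hTv hTw hp := by
    have h1 := h.cls_new v hv hTv hcx
    have h2 := h.cls_old w hw (Or.inl hTw)
    have h3 := h.hi v hv
    have h4 := h.lo w hw
    rw [h1.1] at h3 h1
    rw [h2, ← e] at h4
    have := h.right _ (h₀.cls_lt v hv) h1.2 hp
    omega
  lo v hv := (h.interval h₀ hv).1
  hi v hv := (h.interval h₀ hv).2
  cls_own v hv e := (h.cls_old v hv (Or.inr e)).trans e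
  pos_own := h.pos_own

theorem wf (h₀ : P₀.WF n) (h : Mid n T cx px P₀ P) : P.WF n where
  toIsPerm := h.toIsPerm
  lo := h.lo
  hi := h.hi
  en_le v hv := by
    have hc := h₀.cls_lt v hv
    have h3 := h.st_le _ hc
    have h4 := h.le_en _ hc
    have h5 := h.st_le_en _ hc ((h₀.lo v hv).trans (h₀.hi v hv).le)
    have h6 := h₀.en_le v hv
    rcases h.cls_dichotomy hv with ⟨he, -⟩ | ⟨he, hge, -, -⟩
    · rw [he]
      omega
    · rw [he] at hge ⊢
      rcases le_or_gt px (P₀.st (P₀.cls v)) with hp | hp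
      · have := h.right _ hc hge hp
        omega
      · have := h.left _ hc hge hp
        omega
  cls_eq v hv w hw h₁ h₂ := by
    have hc := h₀.cls_lt v hv
    rcases h.cls_dichotomy hv with ⟨he, -⟩ | ⟨he, hge, hT, hcx⟩
    · rw [he] at h₁ h₂ ⊢
      exact (h.cls_eq_old h₀ hw ⟨v, hv, rfl⟩ h₁ h₂).1
    · have h3 := h.st_le _ hc
      have h4 := h.le_en _ hc
      have h5 := h.st_le_en _ hc ((h₀.lo v hv).trans (h₀.hi v hv).le)
      rw [he] at h₁ h₂ hge
      have key : P₀.cls w = P₀.cls v ∧ (P.pos w < P.st (P₀.cls v) ∨ P.en (P₀.cls v) ≤ P.pos w) := by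
        rcases le_or_gt px (P₀.st (P₀.cls v)) with hp | hp
        · have := h.right _ hc hge hp
          exact ⟨h.cls₀_eq h₀ hv hw (by omega) (by omega), by omega⟩
        · have := h.left _ hc hge hp
          exact ⟨h.cls₀_eq h₀ hv hw (by omega) (by omega), by omega⟩
      rcases h.cls_dichotomy hw with ⟨he', -⟩ | ⟨he', -, -, -⟩
      · have h6 := h.lo w hw
        have h7 := h.hi w hw
        rw [he', key.1] at h6 h7
        omega
      · rw [he', he, key.1]
  cls_lt v hv := by
    have hc := h₀.cls_lt v hv
    have hn := h.nid_le
    rcases h.cls_dichotomy hv with ⟨he, -⟩ | ⟨he, hge, -, -⟩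
    · omega
    · rw [he]
      exact h.tw_lt _
  tw_lt := h.tw_lt

/-- An element that needs not be moved. -/
theorem skip (h₀ : P₀.WF n) (h : Mid n T cx px P₀ P) {y : ℕ} (hy : y < n)
    (hc : P₀.nid ≤ P.cls y ∨ P.cls y = cx) : Mid n (fun v => T v ∨ v = y) cx px P₀ P := by
  have hcy := h₀.cls_lt y hy
  -- A list of neighbours repeats a vertex if `G` contains an edge in both directions; a new class
  -- name shows that the vertex has been moved before.
  have : T y ∨ P₀.cls y = cx := by
    rcases h.cls_dichotomy hy with ⟨he, -⟩ | ⟨-, -, hT, -⟩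
    · rw [he] at hc
      exact Or.inr (hc.resolve_left (by omega))
    · exact Or.inl hT
  exact
    { h with
      cls_old := fun v hv hv' => h.cls_old v hv (by tauto)
      cls_new := fun v hv hv' hcx => by
        refine h.cls_new v hv ?_ hcx
        rcases hv' with hv' | rfl
        · exact hv'
        · exact this.resolve_right hcx }

open Function in
/-- Create an empty class `nid` beside the class `c`. -/
theorem create (h₀ : P₀.WF n) (h : Mid n T cx px P₀ P) {c b : ℕ} (hc : c < P₀.nid) (hcx : c ≠ cx)
    (htw : P.tw c < P₀.nid) (hb : b = if P.st c < px then P.en c else P.st c) :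
    Mid n T cx px P₀ { P with
      tw := update P.tw c P.nid
      st := update P.st P.nid b
      en := update P.en P.nid b
      nid := P.nid + 1 } := by
  have hn := h.nid_le
  have htw' : ∀ d, P.tw d ≠ P.nid := fun d => (h.tw_lt d).ne
  have hcls : ∀ v < n, P.cls v < P.nid := (h.wf h₀).cls_lt
  have hsame := h.same c hc htw
  have hst : ∀ d < P.nid, update P.st P.nid b d = P.st d := fun d hd => update_of_ne hd.ne _ _
  have hen : ∀ d < P.nid, update P.en P.nid b d = P.en d := fun d hd => update_of_ne hd.ne _ _
  refine
    { h with
      nid_le := by dsimp only; omega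
      tw_lt := ?_, cls_new := ?_, tw_inj := ?_, tw_own := ?_, right := ?_, left := ?_
      same := ?_, st_le := ?_, le_en := ?_, st_le_en := ?_, lo := ?_, hi := ?_ }
  · intro d
    have := h.tw_lt d
    by_cases hd : d = c
    · simp [hd]
    · simp only [update_of_ne hd]
      omega
  · intro v hv hT hv'
    have hne : P₀.cls v ≠ c := by
      intro e
      have := h.cls_new v hv hT hv'
      rw [e] at this
      omega
    simpa only [update_of_ne hne] using h.cls_new v hv hT hv'
  · intro d e hd hde
    simp only [update_apply] at hd hde
    split_ifs at hd hde with h1 h2 h3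
    · rw [h1, h2]
    · exact absurd hde.symm (htw' e)
    · exact absurd hde (htw' d)
    · exact h.tw_inj d e hd hde
  · simpa only [update_of_ne (Ne.symm hcx)] using h.tw_own
  · intro d hd hge hp
    by_cases hdc : d = c
    · subst hdc
      have : ¬ P.st d < px := by omega
      rw [if_neg this] at hb
      simp only [update_self, hst d (by omega), hen d (by omega)]
      omega
    · simp only [update_of_ne hdc] at hge ⊢
      rw [hst d (by omega), hen d (by omega), hst _ (h.tw_lt d), hen _ (h.tw_lt d)]
      exact h.right d hd hge hp
  · intro d hd hge hp
    by_cases hdc : d = c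
    · subst hdc
      have : P.st d < px := by omega
      rw [if_pos this] at hb
      simp only [update_self, hst d (by omega), hen d (by omega)]
      omega
    · simp only [update_of_ne hdc] at hge ⊢
      rw [hst d (by omega), hen d (by omega), hst _ (h.tw_lt d), hen _ (h.tw_lt d)]
      exact h.left d hd hge hp
  · intro d hd hlt
    by_cases hdc : d = c
    · subst hdc
      simp only [update_self] at hlt
      omega
    · simp only [update_of_ne hdc] at hlt ⊢
      rw [hst d (by omega), hen d (by omega)]
      exact h.same d hd hlt
  · intro d hd
    simpa only [hst d (show d < P.nid by omega)] using h.st_le d hd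
  · intro d hd
    simpa only [hen d (show d < P.nid by omega)] using h.le_en d hd
  · intro d hd
    simpa only [hst d (show d < P.nid by omega), hen d (show d < P.nid by omega)]
      using h.st_le_en d hd
  · intro v hv
    simpa only [hst _ (hcls v hv)] using h.lo v hv
  · intro v hv
    simpa only [hen _ (hcls v hv)] using h.hi v hv

end Mid

open Function in
/-- Exchange the element `y` with the element at position `t`. -/
theorem IsPerm.swap {n : ℕ} {P : OrdPart} (h : P.IsPerm n) {y t : ℕ} (hy : y < n) (ht : t < n) :
    ({ P with
      ord := update (update P.ord (P.pos y) (P.ord t)) t y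
      pos := update (update P.pos (P.ord t) (P.pos y)) y t } : OrdPart).IsPerm n := by
  have hpy := h.pos_lt y hy
  have hot := h.ord_lt t ht
  constructor
  · intro i hi
    have := h.ord_lt i hi
    simp only [update_apply]
    split_ifs <;> assumption
  · intro v hv
    have := h.pos_lt v hv
    simp only [update_apply]
    split_ifs <;> assumption
  · intro i hi
    simp only [update_apply]
    have e₁ := h.pos_ord i hi
    have e₂ := h.pos_ord t ht
    grind
  · intro v hv
    simp only [update_apply]
    have e₁ := h.ord_pos v hv
    have e₂ := h.ord_pos y hy
    grind

-- The second case excludes that `y` is already at position `t`, where nothing is displaced.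
open Function in
theorem swap_pos_cases {n : ℕ} {P : OrdPart} (h : P.IsPerm n) {y t v : ℕ} (hy : y < n) (ht : t < n)
    (hv : v < n) :
    (v = y ∧ update (update P.pos (P.ord t) (P.pos y)) y t v = t) ∨
    (v ≠ y ∧ P.pos v = t ∧ update (update P.pos (P.ord t) (P.pos y)) y t v = P.pos y ∧ P.pos y ≠ t) ∨
    (v ≠ y ∧ P.pos v ≠ t ∧ update (update P.pos (P.ord t) (P.pos y)) y t v = P.pos v) := by
  have e₁ := h.ord_pos v hv
  have e₂ := h.ord_pos y hy
  have e₃ := h.pos_ord t ht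
  simp only [update_apply]
  grind

namespace Mid

variable {n cx px : ℕ} {T : ℕ → Prop} {P₀ P : OrdPart}

open Function in
/-- Move `y` from the right end of a class into the next class. -/
theorem move_left (h₀ : P₀.WF n) (h : Mid n T cx px P₀ P) {y c t : ℕ} (hy : y < n)
    (hyc : P.cls y = c) (hc : c < P₀.nid) (hcx : c ≠ cx) (htw : P₀.nid ≤ P.tw c)
    (hpx : P.st c < px) (ht : t + 1 = P.en c) :
    Mid n (fun v => T v ∨ v = y) cx px P₀ { P with
      ord := update (update P.ord (P.pos y) (P.ord t)) t y
      pos := update (update P.pos (P.ord t) (P.pos y)) y t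
      cls := update P.cls y (P.tw c)
      st := update P.st (P.tw c) t
      en := update P.en c t } := by
  have hwf := h.wf h₀
  have hyc₀ : P₀.cls y = c := by
    rcases h.cls_dichotomy hy with ⟨he, -⟩ | ⟨he, hge, -, -⟩
    · rw [← he, hyc]
    · omega
  have hT : ¬ T y := fun hT => by
    have := (h.cls_new y hy hT (hyc₀ ▸ hcx)).2
    omega
  have hlo := h.lo y hy
  have hhi := h.hi y hy
  rw [hyc] at hlo hhi
  have htn : t < n := by
    have := hwf.en_le y hy
    rw [hyc] at this
    omega
  -- The element at the boundary position `t`, with which `y` changes places, lies in `c` too. So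
  -- the exchange stays within `c`, and moving the boundary by one transfers exactly `y`.
  have hz := h.cls_eq_old h₀ (h.ord_lt t htn) ⟨y, hy, hyc₀⟩
  rw [h.pos_ord t htn] at hz
  have hz := hz (by omega) (by omega)
  have hpx₀ : P₀.st c < px := (h.st_le c hc).trans_lt hpx
  have hl := h.left c hc htw hpx₀
  have htwc : P.tw c ≠ c := by omega
  have hst : ∀ d, d ≠ P.tw c → update P.st (P.tw c) t d = P.st d := fun d hd => update_of_ne hd _ _
  have hen : ∀ d, d ≠ c → update P.en c t d = P.en d := fun d hd => update_of_ne hd _ _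
  have hold : ∀ d < P₀.nid, d ≠ P.tw c := fun d hd => by omega
  refine
    { IsPerm.swap h.toIsPerm hy htn with
      nid_le := h.nid_le, tw_lt := h.tw_lt, tw_inj := h.tw_inj, tw_own := h.tw_own
      cls_old := ?_, cls_new := ?_, right := ?_, left := ?_
      same := ?_, st_le := ?_, le_en := ?_, st_le_en := ?_, lo := ?_, hi := ?_, pos_own := ?_ }
  · intro v hv hv'
    have : v ≠ y := by
      rintro rfl
      rcases hv' with hv' | hv'
      · exact hv' (Or.inr rfl)
      · exact hcx (hyc₀ ▸ hv')
    simp only [update_of_ne this]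
    exact h.cls_old v hv (by tauto)
  · intro v hv hv' hvx
    by_cases hvy : v = y
    · subst hvy
      simp only [update_self, hyc₀]
      exact ⟨trivial, htw⟩
    · simp only [update_of_ne hvy]
      exact h.cls_new v hv (by tauto) hvx
  · intro d hd hge hp
    have hge : P₀.nid ≤ P.tw d := hge
    have hdc : d ≠ c := fun e => by subst e; omega
    have : P.tw d ≠ P.tw c := fun e => hdc (h.tw_inj _ _ hge e)
    simp only [hst _ this, hst _ (hold d hd), hen _ hdc, hen (P.tw d) (by omega)]
    exact h.right d hd hge hp
  · intro d hd hge hp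
    have hge : P₀.nid ≤ P.tw d := hge
    by_cases hdc : d = c
    · subst hdc
      simp only [update_self, hst _ (hold d hd), hen _ htwc]
      exact ⟨hl.1, trivial, hl.2.2⟩
    · have : P.tw d ≠ P.tw c := fun e => hdc (h.tw_inj _ _ hge e)
      simp only [hst _ this, hst _ (hold d hd), hen _ hdc, hen (P.tw d) (by omega)]
      exact h.left d hd hge hp
  · intro d hd hlt
    have hdc : d ≠ c := fun e => by subst e; dsimp only at hlt; omega
    simp only [hst _ (hold d hd), hen _ hdc]
    exact h.same d hd hlt
  · intro d hd
    simpa only [hst _ (hold d hd)] using h.st_le d hd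
  · intro d hd
    have := h.le_en d hd
    simp only [update_apply]
    split_ifs with e
    · subst e
      omega
    · exact this
  · intro d hd hle
    have := h.st_le_en d hd hle
    simp only [hst _ (hold d hd), update_apply]
    split_ifs with e
    · subst e
      omega
    · exact this
  · intro v hv
    have hv1 := h.lo v hv
    have hv2 := h.hi v hv
    rcases swap_pos_cases h.toIsPerm hy htn hv with ⟨rfl, e⟩ | ⟨hvy, e, e', hne⟩ | ⟨hvy, hvt, e⟩
    · simp only [e, update_self, le_refl]
    · have : v = P.ord t := by rw [← e, h.ord_pos v hv]
      simp only [e', update_of_ne hvy]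
      rw [this, hz.1, hst _ htwc.symm]
      exact hlo
    · simp only [e, update_of_ne hvy]
      by_cases hvc : P.cls v = P.tw c
      · rw [hvc] at hv1 ⊢
        rw [update_self]
        omega
      · rwa [hst _ hvc]
  · intro v hv
    have hv1 := h.lo v hv
    have hv2 := h.hi v hv
    rcases swap_pos_cases h.toIsPerm hy htn hv with ⟨rfl, e⟩ | ⟨hvy, e, e', hne⟩ | ⟨hvy, hvt, e⟩
    · simp only [e, update_self, hen _ htwc]
      have := h.le_en c hc
      omega
    · have : v = P.ord t := by rw [← e, h.ord_pos v hv]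
      simp only [e', update_of_ne hvy]
      rw [this, hz.1, update_self]
      omega
    · simp only [e, update_of_ne hvy]
      by_cases hvc : P.cls v = c
      · rw [hvc] at hv2 ⊢
        rw [update_self]
        omega
      · rwa [hen _ hvc]
  · intro v hv hv'
    rcases swap_pos_cases h.toIsPerm hy htn hv with ⟨rfl, e⟩ | ⟨hvy, e, e', hne⟩ | ⟨hvy, hvt, e⟩
    · exact absurd (hyc₀.symm.trans hv') hcx
    · have : v = P.ord t := by rw [← e, h.ord_pos v hv]
      rw [this] at hv'
      exact absurd (hz.2.symm.trans hv') hcx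
    · simpa only [e] using h.pos_own v hv hv'

open Function in
/-- Move `y` from the left end of a class into the previous class. -/
theorem move_right (h₀ : P₀.WF n) (h : Mid n T cx px P₀ P) {y c t : ℕ} (hy : y < n)
    (hyc : P.cls y = c) (hc : c < P₀.nid) (hcx : c ≠ cx) (htw : P₀.nid ≤ P.tw c)
    (hpx : ¬ P.st c < px) (ht : t = P.st c) :
    Mid n (fun v => T v ∨ v = y) cx px P₀ { P with
      ord := update (update P.ord (P.pos y) (P.ord t)) t y
      pos := update (update P.pos (P.ord t) (P.pos y)) y t
      cls := update P.cls y (P.tw c)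
      st := update P.st c (t + 1)
      en := update P.en (P.tw c) (t + 1) } := by
  have hwf := h.wf h₀
  have hyc₀ : P₀.cls y = c := by
    rcases h.cls_dichotomy hy with ⟨he, -⟩ | ⟨he, hge, -, -⟩
    · rw [← he, hyc]
    · omega
  have hT : ¬ T y := fun hT => by
    have := (h.cls_new y hy hT (hyc₀ ▸ hcx)).2
    omega
  have hlo := h.lo y hy
  have hhi := h.hi y hy
  rw [hyc] at hlo hhi
  have htn : t < n := by
    have := hwf.en_le y hy
    rw [hyc] at this
    omega
  have hz := h.cls_eq_old h₀ (h.ord_lt t htn) ⟨y, hy, hyc₀⟩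
  rw [h.pos_ord t htn] at hz
  have hz := hz (by omega) (by omega)
  -- The program compares the current start of the class with the pivot. This decides as the
  -- original start would: on the left of the pivot the start never changes, and on the right it
  -- only grows.
  have hpx₀ : px ≤ P₀.st c := by
    by_contra hlt
    have := h.left c hc htw (by omega)
    omega
  have hl := h.right c hc htw hpx₀
  have htwc : P.tw c ≠ c := by omega
  have hen : ∀ d, d ≠ P.tw c → update P.en (P.tw c) (t + 1) d = P.en d :=
    fun d hd => update_of_ne hd _ _
  have hst : ∀ d, d ≠ c → update P.st c (t + 1) d = P.st d := fun d hd => update_of_ne hd _ _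
  have hold : ∀ d < P₀.nid, d ≠ P.tw c := fun d hd => by omega
  refine
    { IsPerm.swap h.toIsPerm hy htn with
      nid_le := h.nid_le, tw_lt := h.tw_lt, tw_inj := h.tw_inj, tw_own := h.tw_own
      cls_old := ?_, cls_new := ?_, right := ?_, left := ?_
      same := ?_, st_le := ?_, le_en := ?_, st_le_en := ?_, lo := ?_, hi := ?_, pos_own := ?_ }
  · intro v hv hv'
    have : v ≠ y := by
      rintro rfl
      rcases hv' with hv' | hv'
      · exact hv' (Or.inr rfl)
      · exact hcx (hyc₀ ▸ hv')
    simp only [update_of_ne this]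
    exact h.cls_old v hv (by tauto)
  · intro v hv hv' hvx
    by_cases hvy : v = y
    · subst hvy
      simp only [update_self, hyc₀]
      exact ⟨trivial, htw⟩
    · simp only [update_of_ne hvy]
      exact h.cls_new v hv (by tauto) hvx
  · intro d hd hge hp
    have hge : P₀.nid ≤ P.tw d := hge
    by_cases hdc : d = c
    · subst hdc
      simp only [update_self, hen _ (hold d hd), hst _ htwc]
      exact ⟨hl.1, trivial, hl.2.2⟩
    · have : P.tw d ≠ P.tw c := fun e => hdc (h.tw_inj _ _ hge e)
      simp only [hen _ this, hen _ (hold d hd), hst _ hdc, hst (P.tw d) (by omega)]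
      exact h.right d hd hge hp
  · intro d hd hge hp
    have hge : P₀.nid ≤ P.tw d := hge
    have hdc : d ≠ c := fun e => by subst e; omega
    have : P.tw d ≠ P.tw c := fun e => hdc (h.tw_inj _ _ hge e)
    simp only [hen _ this, hen _ (hold d hd), hst _ hdc, hst (P.tw d) (by omega)]
    exact h.left d hd hge hp
  · intro d hd hlt
    have hdc : d ≠ c := fun e => by subst e; dsimp only at hlt; omega
    simp only [hen _ (hold d hd), hst _ hdc]
    exact h.same d hd hlt
  · intro d hd
    have := h.st_le d hd
    simp only [update_apply]
    split_ifs with e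
    · subst e
      omega
    · exact this
  · intro d hd
    simpa only [hen _ (hold d hd)] using h.le_en d hd
  · intro d hd hle
    have := h.st_le_en d hd hle
    simp only [hen _ (hold d hd), update_apply]
    split_ifs with e
    · subst e
      omega
    · exact this
  · intro v hv
    have hv1 := h.lo v hv
    have hv2 := h.hi v hv
    rcases swap_pos_cases h.toIsPerm hy htn hv with ⟨rfl, e⟩ | ⟨hvy, e, e', hne⟩ | ⟨hvy, hvt, e⟩
    · simp only [e, update_self, hst _ htwc]
      have := h.st_le c hc
      omega
    · have : v = P.ord t := by rw [← e, h.ord_pos v hv]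
      simp only [e', update_of_ne hvy]
      rw [this, hz.1, update_self]
      omega
    · simp only [e, update_of_ne hvy]
      by_cases hvc : P.cls v = c
      · rw [hvc] at hv1 ⊢
        rw [update_self]
        omega
      · rwa [hst _ hvc]
  · intro v hv
    have hv1 := h.lo v hv
    have hv2 := h.hi v hv
    rcases swap_pos_cases h.toIsPerm hy htn hv with ⟨rfl, e⟩ | ⟨hvy, e, e', hne⟩ | ⟨hvy, hvt, e⟩
    · simp only [e, update_self]
      omega
    · have : v = P.ord t := by rw [← e, h.ord_pos v hv]
      simp only [e', update_of_ne hvy]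
      rw [this, hz.1, hen _ htwc.symm]
      exact hhi
    · simp only [e, update_of_ne hvy]
      by_cases hvc : P.cls v = P.tw c
      · rw [hvc] at hv2 ⊢
        rw [update_self]
        omega
      · rwa [hen _ hvc]
  · intro v hv hv'
    rcases swap_pos_cases h.toIsPerm hy htn hv with ⟨rfl, e⟩ | ⟨hvy, e, e', hne⟩ | ⟨hvy, hvt, e⟩
    · exact absurd (hyc₀.symm.trans hv') hcx
    · have : v = P.ord t := by rw [← e, h.ord_pos v hv]
      rw [this] at hv'
      exact absurd (hz.2.symm.trans hv') hcx
    · simpa only [e] using h.pos_own v hv hv'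

end Mid

end OrdPart


/-! ### Splitting the classes of an ordered partition by a linked list -/

namespace RAM

infixr:60 ";;" => Program.seq

-- Notations instead of definitions, so that `rfl`, `decide` and `simp` meet numerals.
notation "rN" => (0 : ℕ)
notation "rM" => (1 : ℕ)
notation "rZero" => (2 : ℕ)
notation "rOne" => (3 : ℕ)
notation "rNid" => (4 : ℕ)
notation "rTop" => (5 : ℕ)
notation "rFree" => (6 : ℕ)
notation "rPtr" => (7 : ℕ)
notation "rBase" => (8 : ℕ)
notation "rOwn" => (9 : ℕ)
notation "rPiv" => (10 : ℕ)
notation "rElt" => (11 : ℕ)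
notation "rCls" => (12 : ℕ)
notation "rTwin" => (13 : ℕ)
notation "rTo" => (14 : ℕ)
notation "rOther" => (15 : ℕ)
notation "rFrom" => (16 : ℕ)
notation "rFlag" => (17 : ℕ)
notation "rSt" => (18 : ℕ)
notation "rBd" => (19 : ℕ)
notation "aTail" => (0 : ℕ)
notation "aHead" => (1 : ℕ)
notation "aOrd" => (2 : ℕ)
notation "aPos" => (3 : ℕ)
notation "aCls" => (4 : ℕ)
notation "aSt" => (5 : ℕ)
notation "aEn" => (6 : ℕ)
notation "aTw" => (7 : ℕ)
notation "aVal" => (8 : ℕ)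
notation "aNxt" => (9 : ℕ)
notation "aAdj" => (10 : ℕ)
notation "aBkt" => (11 : ℕ)
notation "aSrc" => (12 : ℕ)
notation "aSig" => (13 : ℕ)
notation "aZe" => (14 : ℕ)

/-- The ordered partition in a memory. -/
def Memory.part (s : Memory) : OrdPart where
  ord := s.arr aOrd
  pos := s.arr aPos
  cls := s.arr aCls
  st := s.arr aSt
  en := s.arr aEn
  tw := s.arr aTw
  nid := s.reg rNid

open Program

/-- Provide the class `rCls` with a twin class `rTwin`; `rBd` is the boundary between them. -/
def twinBlock : Program :=
  load rTwin aTw rCls ;; load rSt aSt rCls ;; copy rBd rSt ;;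
  ifLt rSt rPiv (load rBd aEn rCls) (copy rBd rSt) ;;
  ifLt rTwin rBase
    (copy rTwin rNid ;; store aTw rCls rTwin ;; store aSt rTwin rBd ;; store aEn rTwin rBd ;;
      succ rNid rNid)
    (copy rTwin rTwin)

/-- Move `rElt` from its class `rCls` to the twin class `rTwin`. -/
def moveBlock : Program :=
  load rFrom aPos rElt ;;
  ifLt rSt rPiv
    (sub rTo rBd rOne ;; store aEn rCls rTo ;; store aSt rTwin rTo)
    (copy rTo rBd ;; succ rBd rBd ;; store aSt rCls rBd ;; store aEn rTwin rBd) ;;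
  load rOther aOrd rTo ;; store aOrd rFrom rOther ;; store aPos rOther rFrom ;;
  store aOrd rTo rElt ;; store aPos rElt rTo ;; store aCls rElt rTwin

/-- Fetch the next element, and set `rFlag` if it has to be moved. -/
def fetchBlock : Program :=
  load rElt aVal rPtr ;; load rPtr aNxt rPtr ;; load rCls aCls rElt ;; const rFlag 0 ;;
  ifLt rCls rOwn (const rFlag 1) (copy rFlag rFlag) ;;
  ifLt rOwn rCls (const rFlag 1) (copy rFlag rFlag) ;;
  ifLt rCls rBase (copy rFlag rFlag) (const rFlag 0)

/-- Split all classes but `rOwn` by the list that starts in the node `rPtr`. -/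
def splitLoop : Program :=
  copy rBase rNid ;;
  whileLt rZero rPtr (fetchBlock ;;
    ifLt rZero rFlag (twinBlock ;; moveBlock) (copy rFlag rFlag))

open OrdPart Function

theorem halts_twinBlock {n : ℕ} {T : ℕ → Prop} {P₀ : OrdPart} {s : Memory} (h₀ : P₀.WF n)
    (hbase : s.reg rBase = P₀.nid) (h : Mid n T (s.reg rOwn) (s.reg rPiv) P₀ s.part)
    (hc : s.reg rCls < P₀.nid) (hcx : s.reg rCls ≠ s.reg rOwn) :
    Halts twinBlock s 15 fun s' => Mid n T (s.reg rOwn) (s.reg rPiv) P₀ s'.part ∧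
      s'.part.cls = s.part.cls ∧ s'.reg rTwin = s'.part.tw (s.reg rCls) ∧
      P₀.nid ≤ s'.reg rTwin ∧ s'.reg rSt = s'.part.st (s.reg rCls) ∧
      s'.reg rBd = if s'.part.st (s.reg rCls) < s.reg rPiv then s'.part.en (s.reg rCls)
        else s'.part.st (s.reg rCls) := by
  have hcn : s.reg rCls ≠ s.reg rNid := (hc.trans_le h.nid_le).ne
  refine Halts.of_exec rfl (by decide) fun _ => ?_
  by_cases htw : s.arr aTw (s.reg rCls) < P₀.nid
  · have := h.create h₀ hc hcx htw rfl
    by_cases hp : s.arr aSt (s.reg rCls) < s.reg rPiv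
    · simp [twinBlock, exec, Memory.part, hp, htw, hbase, hcn] at this ⊢
      exact ⟨this, h.nid_le⟩
    · simp [twinBlock, exec, Memory.part, hp, htw, hbase, hcn] at this ⊢
      exact ⟨this, h.nid_le⟩
  · by_cases hp : s.arr aSt (s.reg rCls) < s.reg rPiv
    · simp [twinBlock, exec, Memory.part, hp, htw, hbase] at h ⊢
      exact ⟨h, not_lt.1 htw⟩
    · simp [twinBlock, exec, Memory.part, hp, htw, hbase] at h ⊢
      exact ⟨h, not_lt.1 htw⟩

theorem halts_moveBlock {n : ℕ} {T : ℕ → Prop} {P₀ : OrdPart} {s : Memory} (h₀ : P₀.WF n)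
    (hone : s.reg rOne = 1) (h : Mid n T (s.reg rOwn) (s.reg rPiv) P₀ s.part)
    (hy : s.reg rElt < n) (hyc : s.part.cls (s.reg rElt) = s.reg rCls)
    (hc : s.reg rCls < P₀.nid) (hcx : s.reg rCls ≠ s.reg rOwn)
    (htw : s.reg rTwin = s.part.tw (s.reg rCls)) (htw' : P₀.nid ≤ s.reg rTwin)
    (hst : s.reg rSt = s.part.st (s.reg rCls))
    (hbd : s.reg rBd = if s.part.st (s.reg rCls) < s.reg rPiv then s.part.en (s.reg rCls)
      else s.part.st (s.reg rCls)) :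
    Halts moveBlock s 15 fun s' =>
      Mid n (fun v => T v ∨ v = s.reg rElt) (s.reg rOwn) (s.reg rPiv) P₀ s'.part := by
  refine Halts.of_exec rfl (by decide) fun _ => ?_
  by_cases hp : s.part.st (s.reg rCls) < s.reg rPiv
  · rw [if_pos hp] at hbd
    have hhi := h.hi _ hy
    rw [hyc] at hhi
    have ht : s.reg rBd - 1 + 1 = s.part.en (s.reg rCls) := by omega
    have := h.move_left h₀ hy hyc hc hcx (htw ▸ htw') hp ht
    rw [← htw] at this
    have hp' : s.reg rSt < s.reg rPiv := hst ▸ hp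
    simp [moveBlock, exec, Memory.part, hp', hone] at this ⊢
    exact this
  · rw [if_neg hp] at hbd
    have := h.move_right h₀ hy hyc hc hcx (htw ▸ htw') hp hbd
    rw [← htw] at this
    have hp' : ¬ s.reg rSt < s.reg rPiv := hst ▸ hp
    simp [moveBlock, exec, Memory.part, hp'] at this ⊢
    exact this

theorem halts_fetchBlock (s : Memory) :
    Halts fetchBlock s 14 fun s' => s'.part = s.part ∧
      s'.reg rPtr = s.arr aNxt (s.reg rPtr) ∧ s'.reg rElt = s.arr aVal (s.reg rPtr) ∧
      s'.reg rCls = s.part.cls (s.arr aVal (s.reg rPtr)) ∧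
      (0 < s'.reg rFlag ↔ s.part.cls (s.arr aVal (s.reg rPtr)) < s.reg rBase ∧
        s.part.cls (s.arr aVal (s.reg rPtr)) ≠ s.reg rOwn) := by
  refine Halts.of_exec rfl (by decide) fun _ => ?_
  simp only [Memory.part]
  rcases lt_trichotomy (s.arr aCls (s.arr aVal (s.reg rPtr))) (s.reg rOwn) with h | h | h <;>
    by_cases h' : s.arr aCls (s.arr aVal (s.reg rPtr)) < s.reg rBase
  · simp [fetchBlock, exec, h, h', h.not_gt, h.ne]
  · simp [fetchBlock, exec, h, h', h.not_gt]
  · rw [h] at h'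
    simp [fetchBlock, exec, h, h']
  · rw [h] at h'
    simp [fetchBlock, exec, h, h']
  · simp [fetchBlock, exec, h, h', h.not_gt, h.ne']
  · simp [fetchBlock, exec, h, h', h.not_gt]

/-- An entry costs at most 14 steps for fetching, 30 for twin and move, and 2 for tests, rounded up
to 50. In the invariant, `T` holds the entries already read and `rem` is the rest of the list. -/
theorem halts_splitLoop {n K : ℕ} {l : List ℕ} {s : Memory} (hzero : s.reg rZero = 0)
    (hone : s.reg rOne = 1) (hwf : s.part.WF n)
    (hl : IsList (s.arr aVal) (s.arr aNxt) K (s.reg rPtr) l) (hln : ∀ y ∈ l, y < n) :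
    Halts splitLoop s (50 * l.length + 2) fun s' =>
      Split n (· ∈ l) (s.reg rOwn) (s.reg rPiv) s.part s'.part ∧ s'.part.WF n := by
  have key : ∀ s₁ : Memory, Frame (copy rBase rNid) s s₁ → s₁ = (copy rBase rNid).exec s →
      Halts (whileLt rZero rPtr (fetchBlock ;;
        ifLt rZero rFlag (twinBlock ;; moveBlock) (copy rFlag rFlag))) s₁
        (50 * l.length + 1) fun s' =>
        Split n (· ∈ l) (s.reg rOwn) (s.reg rPiv) s.part s'.part ∧ s'.part.WF n := by
    intro s₁ hf he
    have hpart : s₁.part = s.part := by rw [he]; rfl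
    have hbase : s₁.reg rBase = s.part.nid := by rw [he]; rfl
    have hown : s₁.reg rOwn = s.reg rOwn := hf.reg _ rfl
    have hpiv : s₁.reg rPiv = s.reg rPiv := hf.reg _ rfl
    refine (Halts.loop (fun k s' => ∃ T rem, Mid n T (s.reg rOwn) (s.reg rPiv) s.part s'.part ∧
      IsList (s.arr aVal) (s.arr aNxt) K (s'.reg rPtr) rem ∧ (∀ v, T v ∨ v ∈ rem ↔ v ∈ l) ∧
      k = 50 * rem.length) ?_ (50 * l.length) ?_).mono le_rfl ?_
    · rintro _ s' hf' ⟨T, rem, hmid, hlist, hT, rfl⟩ hlt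
      have hval : s'.arr aVal = s.arr aVal := (hf'.arr _ rfl).trans (hf.arr _ rfl)
      have hnxt : s'.arr aNxt = s.arr aNxt := (hf'.arr _ rfl).trans (hf.arr _ rfl)
      have hz' : s'.reg rZero = 0 := ((hf'.reg _ rfl).trans (hf.reg _ rfl)).trans hzero
      have ho' : s'.reg rOne = 1 := ((hf'.reg _ rfl).trans (hf.reg _ rfl)).trans hone
      have hown' : s'.reg rOwn = s.reg rOwn := (hf'.reg _ rfl).trans hown
      have hpiv' : s'.reg rPiv = s.reg rPiv := (hf'.reg _ rfl).trans hpiv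
      have hbase' : s'.reg rBase = s.part.nid := (hf'.reg _ rfl).trans hbase
      obtain ⟨rem', rfl, hK, hlist'⟩ := hlist.exists_eq_cons (by omega)
      set y := s.arr aVal (s'.reg rPtr) with hy
      have hyn : y < n := hln y ((hT y).1 (Or.inr List.mem_cons_self))
      refine ⟨14 + (30 + 1), ?_⟩
      refine Halts.comp (halts_fetchBlock s') fun s₂ hf₂ ⟨hpart₂, hptr₂, helt₂, hcls₂, hflag₂⟩ => ?_
      rw [hnxt] at hptr₂
      rw [hval, ← hy] at helt₂ hcls₂ hflag₂
      rw [hbase', hown'] at hflag₂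
      have hrem : 50 * (y :: rem').length = 50 * rem'.length + 50 :=
        by rw [List.length_cons, mul_add, mul_one]
      have fin : ∀ s'' : Memory, s''.reg rPtr = s₂.reg rPtr →
          Mid n (fun v => T v ∨ v = y) (s.reg rOwn) (s.reg rPiv) s.part s''.part →
          ∃ k', 14 + (30 + 1) + k' + 1 ≤ 50 * (y :: rem').length ∧
            ∃ T rem, Mid n T (s.reg rOwn) (s.reg rPiv) s.part s''.part ∧
              IsList (s.arr aVal) (s.arr aNxt) K (s''.reg rPtr) rem ∧
              (∀ v, T v ∨ v ∈ rem ↔ v ∈ l) ∧ k' = 50 * rem.length := by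
        intro s'' hptr hmid''
        refine ⟨_, by omega, _, rem', hmid'', ?_, ?_, rfl⟩
        · rwa [hptr, hptr₂]
        · intro v
          rw [← hT v, List.mem_cons]
          tauto
      refine Halts.ite (fun hlt₂ => ?_) (fun hlt₂ => ?_)
      · rw [hf₂.reg rZero rfl, hz', hflag₂, ← hcls₂] at hlt₂
        rw [← hpart₂] at hmid hcls₂
        refine Halts.comp (T₁ := 15) (T₂ := 15)
          (halts_twinBlock hwf ((hf₂.reg _ rfl).trans hbase') (T := T) ?_ hlt₂.1 ?_)
          fun s₃ hf₃ ⟨hm₃, hc₃, h₃, h₃', hst₃, hbd₃⟩ => (halts_moveBlock hwf (T := T) ?_ ?_ ?_ ?_ ?_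
            ?_ ?_ ?_ ?_ ?_).mono le_rfl fun s₄ hf₄ hm₄ => ?_
        · rw [hf₂.reg rOwn rfl, hf₂.reg rPiv rfl, hown', hpiv']
          exact hmid
        · rw [hf₂.reg rOwn rfl, hown']
          exact hlt₂.2
        · rw [hf₃.reg rOne rfl, hf₂.reg rOne rfl, ho']
        · rwa [hf₃.reg rOwn rfl, hf₃.reg rPiv rfl]
        · rwa [hf₃.reg rElt rfl, helt₂]
        · rw [hf₃.reg rElt rfl, helt₂, hf₃.reg rCls rfl, hc₃, hcls₂]
        · rw [hf₃.reg rCls rfl]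
          exact hlt₂.1
        · rw [hf₃.reg rCls rfl, hf₃.reg rOwn rfl, hf₂.reg rOwn rfl, hown']
          exact hlt₂.2
        · rw [hf₃.reg rCls rfl, h₃]
        · exact h₃'
        · rw [hf₃.reg rCls rfl, hst₃]
        · rw [hf₃.reg rCls rfl, hf₃.reg rPiv rfl, hbd₃]
        · refine fin s₄ ((hf₄.reg rPtr rfl).trans (hf₃.reg rPtr rfl)) ?_
          rwa [hf₃.reg rElt rfl, helt₂, hf₃.reg rOwn rfl, hf₃.reg rPiv rfl, hf₂.reg rOwn rfl,
            hf₂.reg rPiv rfl, hown', hpiv'] at hm₄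
      · refine Halts.of_exec rfl (by decide) fun hf₃ => fin _ rfl ?_
        rw [hf₂.reg rZero rfl, hz', hflag₂] at hlt₂
        have : (exec (copy rFlag rFlag) s₂).part = s'.part := hpart₂ ▸ rfl
        rw [this]
        exact hmid.skip hwf hyn (by omega)
    · refine ⟨fun _ => False, l, by rw [hpart]; exact Mid.init hwf, ?_, ?_, rfl⟩
      · rwa [hf.reg rPtr rfl]
      · simp
    · rintro s' hf' ⟨⟨k, T, rem, hmid, hlist, hT, -⟩, hlt⟩
      have hz' : s'.reg rZero = 0 := ((hf'.reg _ rfl).trans (hf.reg _ rfl)).trans hzero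
      have : s'.reg rPtr = 0 := by omega
      rw [this] at hlist
      have hrem := hlist.eq_nil
      subst hrem
      have hT' : T = (· ∈ l) := by
        funext v
        simpa using hT v
      rw [hT'] at hmid
      exact ⟨hmid.split hwf, hmid.wf hwf⟩
  have := Halts.comp_exec (T₁ := 1) (p := copy rBase rNid) rfl le_rfl fun hf => key _ hf rfl
  exact this.mono (by omega) fun _ _ h => h

end RAM


/-! ### Splitting by neighbourhoods -/

namespace OrdPart

variable {n : ℕ} {P P' P'' : OrdPart}

namespace WF

theorem eq_of_mem_interval (h : P.WF n) {v w j : ℕ} (hv : v < n) (hw : w < n)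
    (h₁ : P.st (P.cls v) ≤ j) (h₂ : j < P.en (P.cls v)) (h₃ : P.st (P.cls w) ≤ j)
    (h₄ : j < P.en (P.cls w)) : P.cls v = P.cls w := by
  have hj : j < n := h₂.trans_le (h.en_le v hv)
  have e₁ := h.cls_eq v hv _ (h.ord_lt j hj)
  have e₂ := h.cls_eq w hw _ (h.ord_lt j hj)
  rw [h.pos_ord j hj] at e₁ e₂
  rw [← e₁ h₁ h₂, ← e₂ h₃ h₄]

theorem en_le_st (h : P.WF n) {a b : ℕ} (ha : a < n) (hb : b < n) (hab : P.cls a ≠ P.cls b)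
    (hlt : P.pos a < P.pos b) : P.en (P.cls a) ≤ P.st (P.cls b) := by
  by_contra hcon
  have h1 := h.lo a ha
  have h2 := h.hi a ha
  have h3 := h.lo b hb
  have h4 := h.hi b hb
  rcases le_or_gt (P.st (P.cls b)) (P.pos a) with h5 | h5
  · exact hab (h.eq_of_mem_interval ha hb h1 h2 h5 (by omega))
  · exact hab (h.eq_of_mem_interval ha hb (j := P.st (P.cls b)) (by omega) (by omega) le_rfl
      (by omega))

/-- A singleton class fills a single position, which fixes the place of its element in every
refinement. -/
theorem st_eq_of_single (h : P.WF n) {v : ℕ} (hv : v < n)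
    (hs : ∀ w < n, P.cls w = P.cls v → w = v) :
    P.st (P.cls v) = P.pos v ∧ P.en (P.cls v) = P.pos v + 1 := by
  have key : ∀ j, P.st (P.cls v) ≤ j → j < P.en (P.cls v) → j = P.pos v := by
    intro j h₁ h₂
    have hj : j < n := h₂.trans_le (h.en_le v hv)
    have e₁ := h.cls_eq v hv _ (h.ord_lt j hj)
    rw [h.pos_ord j hj] at e₁
    have := hs _ (h.ord_lt j hj) (e₁ h₁ h₂)
    rw [← this, h.pos_ord j hj]
  have h1 := h.lo v hv
  have h2 := h.hi v hv
  have h3 := key (P.st (P.cls v)) le_rfl (by omega)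
  have h4 := key (P.en (P.cls v) - 1) (by omega) (by omega)
  omega

end WF

/-- The classes of `P'` lie in those of `P`. -/
structure Refines (n : ℕ) (P P' : OrdPart) : Prop where
  cls_eq : ∀ v < n, ∀ w < n, P'.cls v = P'.cls w → P.cls v = P.cls w
  lo : ∀ v < n, P.st (P.cls v) ≤ P'.pos v
  hi : ∀ v < n, P'.pos v < P.en (P.cls v)

theorem Refines.refl (h : P.WF n) : Refines n P P := ⟨fun _ _ _ _ h => h, h.lo, h.hi⟩

theorem Split.refines {T : ℕ → Prop} {cx px : ℕ} (h : Split n T cx px P P') : Refines n P P' :=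
  ⟨fun v hv w hw e => ((h.cls_eq_iff v hv w hw).1 e).1, h.lo, h.hi⟩

namespace Refines

theorem pos_lt (h : Refines n P P') (hP : P.WF n) {a b : ℕ} (ha : a < n) (hb : b < n)
    (hab : P.cls a ≠ P.cls b) (hlt : P.pos a < P.pos b) : P'.pos a < P'.pos b :=
  ((h.hi a ha).trans_le (hP.en_le_st ha hb hab hlt)).trans_le (h.lo b hb)

theorem pos_lt_iff (h : Refines n P P') (hP : P.WF n) {a b : ℕ} (ha : a < n) (hb : b < n)
    (hab : P.cls a ≠ P.cls b) : P'.pos a < P'.pos b ↔ P.pos a < P.pos b := by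
  refine ⟨fun h' => ?_, h.pos_lt hP ha hb hab⟩
  rcases lt_trichotomy (P.pos a) (P.pos b) with h1 | h1 | h1
  · exact h1
  · exact absurd (congrArg P.cls (hP.pos_inj ha hb h1)) hab
  · exact absurd h' (h.pos_lt hP hb ha hab.symm h1).not_gt

theorem interval (h : Refines n P P') (hP' : P'.WF n) {v j : ℕ} (hv : v < n)
    (h₁ : P'.st (P'.cls v) ≤ j) (h₂ : j < P'.en (P'.cls v)) :
    P.st (P.cls v) ≤ j ∧ j < P.en (P.cls v) := by
  have hj : j < n := h₂.trans_le (hP'.en_le v hv)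
  have hu := hP'.ord_lt j hj
  have e := hP'.cls_eq v hv _ hu
  rw [hP'.pos_ord j hj] at e
  have e' := h.cls_eq _ hu v hv (e h₁ h₂)
  have h3 := h.lo _ hu
  have h4 := h.hi _ hu
  rw [e', hP'.pos_ord j hj] at h3 h4
  exact ⟨h3, h4⟩

theorem trans (h : Refines n P P') (hP' : P'.WF n) (h' : Refines n P' P'') : Refines n P P'' where
  cls_eq v hv w hw e := h.cls_eq v hv w hw (h'.cls_eq v hv w hw e)
  lo v hv := (h.interval hP' hv (h'.lo v hv) (h'.hi v hv)).1
  hi v hv := (h.interval hP' hv (h'.lo v hv) (h'.hi v hv)).2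

theorem pos_eq_of_single (h : Refines n P P') (hP : P.WF n) {v : ℕ} (hv : v < n)
    (hs : ∀ w < n, P.cls w = P.cls v → w = v) : P'.pos v = P.pos v := by
  have h1 := hP.st_eq_of_single hv hs
  have h2 := h.lo v hv
  have h3 := h.hi v hv
  omega

end Refines

/-- The order of the classes of `P` agrees with `F` on the non-edges of `E`. -/
def Agrees (n : ℕ) (E F : ℕ → ℕ → Prop) (P : OrdPart) : Prop :=
  ∀ a < n, ∀ b < n, P.cls a ≠ P.cls b → P.pos a < P.pos b → ¬ E a b → F a b

/-- Suppose `x` comes before the class. Then `F` leads from `x` to each non-neighbour `w` in it. If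
`F` led from `w` to a neighbour `u` of `x`, it would lead from `x` to `u`, although they are
adjacent. So neighbours come first, and symmetrically last if `x` comes after the class. `T` may be
only part of the neighbourhood, as long as it contains all neighbours in each class that it meets.
-/
theorem Agrees.split {E F : ℕ → ℕ → Prop} {T : ℕ → Prop} {x : ℕ} (hE : ∀ a b, E a b → E b a)
    (hF : OrientsCompl E F {v | v < n}) (hP : P.WF n) (h : Agrees n E F P) (hx : x < n)
    (hs : Split n T (P.cls x) (P.pos x) P P') (hT : ∀ u, T u → E x u)
    (hT' : ∀ u < n, ∀ w < n, T u → ¬ T w → P.cls u = P.cls w → ¬ E x w) : Agrees n E F P' := by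
  intro a ha b hb hab hlt hEab
  by_cases hc : P.cls a = P.cls b
  · have hiff := hs.cls_eq_iff a ha b hb
    have h1 : ¬ (P.cls a = P.cls x ∨ (T a ↔ T b)) := fun h => hab (hiff.2 ⟨hc, h⟩)
    push Not at h1
    obtain ⟨hax, hTab⟩ := h1
    have hne : a ≠ b := fun e => hab (e ▸ rfl)
    by_cases hTa : T a
    · have hTb : ¬ T b := by tauto
      have hp : P.pos x ≤ P.st (P.cls a) := by
        by_contra hp
        exact absurd hlt (hs.left a ha b hb hc hax hTa hTb (not_le.1 hp)).not_gt
      have hEb := hT' a ha b hb hTa hTb hc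
      have hxb : P.pos x < P.pos b := by
        refine (hp.trans (hc ▸ hP.lo b hb)).lt_of_ne fun e => hax ?_
        rw [hc, hP.pos_inj hx hb e]
      have hFb := h x hx b hb (fun e => hax (hc.trans e.symm)) hxb hEb
      refine (hF.total a ha b hb hne hEab).resolve_right fun hba => ?_
      exact hF.not_adj x hx a ha (hF.trans x hx b hb a ha hFb hba) (hT a hTa)
    · have hTb : T b := by tauto
      have hp : P.st (P.cls a) < P.pos x := by
        by_contra hp
        exact absurd hlt (hs.right b hb a ha hc.symm (hc ▸ hax) hTb hTa
          (hc ▸ not_lt.1 hp)).not_gt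
      have hEa := hT' b hb a ha hTb hTa hc.symm
      have hax' : P.pos a < P.pos x := by
        by_contra hcon
        have := hP.hi a ha
        exact hax (hP.cls_eq a ha x hx hp.le (by omega)).symm
      have hFa := h a ha x hx hax hax' fun h => hEa (hE _ _ h)
      refine (hF.total a ha b hb hne hEab).resolve_right fun hba => ?_
      exact hF.not_adj b hb x hx (hF.trans b hb a ha x hx hba hFa) (hE _ _ (hT b hTb))
  · exact h a ha b hb hc ((hs.refines.pos_lt_iff hP ha hb hc).1 hlt) hEab

/-- The invariant of lexicographic breadth first search after `i` steps. -/
structure Lex (n : ℕ) (E : ℕ → ℕ → Prop) (i : ℕ) (P : OrdPart) : Prop where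
  single : ∀ v < n, P.pos v < i → ∀ w < n, P.cls w = P.cls v → w = v
  lex : ∀ a < n, ∀ b < n, ∀ c < n, P.pos a < i → P.pos a < P.pos b →
    (P.pos b < P.pos c ∨ P.cls b = P.cls c) → E a c → ¬ E a b →
    ∃ d < n, P.pos d < P.pos a ∧ E d b ∧ ¬ E d c
  sep : ∀ b < n, ∀ c < n, i ≤ P.pos b → P.pos b < P.pos c → P.cls b ≠ P.cls c →
    ∃ d < n, P.pos d < i ∧ E d b ∧ ¬ E d c

theorem Lex.zero {E : ℕ → ℕ → Prop} (h : ∀ v < n, ∀ w < n, P.cls v = P.cls w) : Lex n E 0 P where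
  single _ _ h := absurd h (Nat.not_lt_zero _)
  lex _ _ _ _ _ _ h := absurd h (Nat.not_lt_zero _)
  sep b hb c hc _ _ hne := absurd (h b hb c hc) hne

/-- One round of the search isolates the first unvisited vertex `x` and moves its neighbours to the
front of their classes. Earlier vertices are singletons and stay in place. Pairs that are separated
now have `x` as their witness, and pairs separated before keep theirs. The property `Lex.lex`
includes pairs in a common class, so that it survives any later order within the class. -/
theorem Lex.succ {E : ℕ → ℕ → Prop} {i x : ℕ} (hi : i < n) (hP : P.WF n) (h : Lex n E i P)
    (hx : x = P.ord i) (hP' : P'.WF n) (hs : Split n (· = x) P.nid 0 P P') (hP'' : P''.WF n)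
    (hs' : Split n (E x) (P'.cls x) (P'.pos x) P' P'') :
    Lex n E (i + 1) P'' ∧ ∀ j ≤ i, P''.ord j = P.ord j := by
  have hxn : x < n := hx ▸ hP.ord_lt i hi
  have hxi : P.pos x = i := hx ▸ hP.pos_ord i hi
  have hcnid : ∀ v < n, P.cls v ≠ P.nid := fun v hv => (hP.cls_lt v hv).ne
  have hiff : ∀ v < n, ∀ w < n, (P'.cls v = P'.cls w ↔ P.cls v = P.cls w ∧ (v = x ↔ w = x)) := by
    intro v hv w hw
    rw [hs.cls_eq_iff v hv w hw]
    simp [hcnid v hv]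
  have hsingle₁ : ∀ w < n, P'.cls w = P'.cls x → w = x := fun w hw e =>
    ((hiff w hw x hxn).1 e).2.2 rfl
  -- All positions before `i` belong to singletons, so the class of `x` begins at `i`, and isolating
  -- `x` to the left leaves it there.
  have hpos₁ : P'.pos x = i := by
    have hge : i ≤ P'.pos x := by
      by_contra hcon
      have hlo := hs.lo x hxn
      have hhi := hs.hi x hxn
      have hj : P'.pos x < n := hP'.pos_lt x hxn
      have e := hP.cls_eq x hxn _ (hP.ord_lt _ hj)
      rw [hP.pos_ord _ hj] at e
      have := h.single _ (hP.ord_lt _ hj) (by rw [hP.pos_ord _ hj]; omega) x hxn (e hlo hhi).symm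
      have e₂ := hP.pos_ord _ hj
      rw [← this] at e₂
      omega
    by_contra hne
    have hu := hP'.ord_lt i hi
    have hui := hP'.pos_ord i hi
    by_cases hc : P.cls (P'.ord i) = P.cls x
    · have hux : P'.ord i ≠ x := fun e => hne (by rw [← e, hui])
      have := hs.right x hxn _ hu hc.symm (hcnid x hxn) rfl hux (Nat.zero_le _)
      omega
    · have h1 : P'.pos (P'.ord i) < P'.pos x := by omega
      have h2 := (hs.refines.pos_lt_iff hP hu hxn hc).1 h1
      have h3 := hs.refines.pos_eq_of_single hP hu (h.single _ hu (by omega))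
      omega
  have href := hs.refines.trans hP' hs'.refines
  have hposlt : ∀ v < n, P.pos v < i → P''.pos v = P.pos v := fun v hv hvi =>
    href.pos_eq_of_single hP hv (h.single v hv hvi)
  have hposx : P''.pos x = i := by
    rw [hs'.refines.pos_eq_of_single hP' hxn hsingle₁, hpos₁]
  have hposle : ∀ v < n, P.pos v ≤ i → P''.pos v = P.pos v := by
    intro v hv hvi
    rcases hvi.lt_or_eq with hlt | heq
    · exact hposlt v hv hlt
    · rw [hP.pos_inj hv hxn (heq.trans hxi.symm), hposx, hxi]
  have hord : ∀ j ≤ i, P''.ord j = P.ord j := by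
    intro j hj
    have hjn : j < n := hj.trans_lt hi
    have h1 := hposle _ (hP.ord_lt j hjn) (by rwa [hP.pos_ord j hjn])
    rw [hP.pos_ord j hjn] at h1
    rw [← hP''.ord_pos _ (hP.ord_lt j hjn), h1]
  have hposle' : ∀ v < n, P''.pos v ≤ i → P''.pos v = P.pos v := by
    intro v hv hvi
    have h1 := hord _ hvi
    rw [hP''.ord_pos v hv] at h1
    have h2 := hP.pos_ord _ (hvi.trans_lt hi)
    rw [← h1] at h2
    exact h2.symm
  have hgt : ∀ v < n, i < P''.pos v ↔ i < P.pos v := by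
    intro v hv
    constructor <;> intro hlt <;> by_contra hcon
    · have := hposle v hv (not_lt.1 hcon)
      omega
    · have := hposle' v hv (not_lt.1 hcon)
      omega
  have hclsx : ∀ v < n, v ≠ x → P'.cls v ≠ P'.cls x := fun v hv hvx e => hvx (hsingle₁ v hv e)
  have hcls'' : ∀ v < n, ∀ w < n, v ≠ x → w ≠ x → P.cls v = P.cls w →
      (P''.cls v = P''.cls w ↔ (E x v ↔ E x w)) := by
    intro v hv w hw hvx hwx e
    rw [hs'.cls_eq_iff v hv w hw, hiff v hv w hw]
    simp [e, hvx, hwx, hclsx v hv hvx]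
  have hnear : ∀ v < n, ∀ w < n, i < P.pos v → v ≠ x → w ≠ x → P.cls v = P.cls w → E x v →
      ¬ E x w → P''.pos v < P''.pos w := by
    intro v hv w hw hvi hvx hwx e hEv hEw
    refine hs'.right v hv w hw ((hiff v hv w hw).2 ⟨e, by tauto⟩) (hclsx v hv hvx) hEv hEw ?_
    by_contra hcon
    refine hclsx v hv hvx (hP'.cls_eq v hv x hxn (not_le.1 hcon).le ?_).symm
    refine lt_trans ?_ (hP'.hi v hv)
    rw [hpos₁]
    by_contra hvi'
    have h1 := hs'.refines.lo v hv
    have h2 := hP'.lo v hv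
    have h4 := hP'.eq_of_mem_interval hv hxn (j := P'.pos x) (not_le.1 hcon).le
    have h5 := hP'.lo x hxn
    have h6 := hP'.hi x hxn
    by_cases hc : P.cls v = P.cls x
    · have := hs.right x hxn v hv hc.symm (hcnid x hxn) rfl hvx (Nat.zero_le _)
      omega
    · have := (hs.refines.pos_lt_iff hP hxn hv (Ne.symm hc)).2 (by omega)
      omega
  have hsx : ∀ w < n, P''.cls w = P''.cls x → w = x := fun w hw e =>
    hsingle₁ w hw (hs'.refines.cls_eq w hw x hxn e)
  refine ⟨⟨?_, ?_, ?_⟩, hord⟩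
  · intro v hv hvi w hw e
    have h1 := hposle' v hv (Nat.lt_succ_iff.1 hvi)
    rcases (Nat.lt_succ_iff.1 hvi).lt_or_eq with hlt | heq
    · exact h.single v hv (by omega) w hw (href.cls_eq w hw v hv e)
    · have : v = x := hP.pos_inj hv hxn (by omega)
      subst this
      exact hsx w hw e
  · intro a ha b hb c hc hai hab hbc hEac hEab
    have h1 := hposle' a ha (Nat.lt_succ_iff.1 hai)
    have hbc' : P.pos b < P.pos c ∨ P.cls b = P.cls c := by
      by_cases e : P.cls b = P.cls c
      · exact Or.inr e
      · rcases hbc with hbc | hbc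
        · exact Or.inl ((href.pos_lt_iff hP hb hc e).1 hbc)
        · exact absurd (href.cls_eq b hb c hc hbc) e
    rcases (Nat.lt_succ_iff.1 hai).lt_or_eq with hlt | heq
    · have hab' : P.pos a < P.pos b := by
        by_contra hcon
        have := hposle b hb (by omega)
        omega
      obtain ⟨d, hd, hda, hd'⟩ := h.lex a ha b hb c hc (by omega) hab' hbc' hEac hEab
      refine ⟨d, hd, ?_, hd'⟩
      rw [hposlt d hd (by omega)]
      omega
    · have : a = x := hP.pos_inj ha hxn (by omega)
      subst this
      have hbi : i < P.pos b := (hgt b hb).1 (by omega)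
      have hba : b ≠ a := fun e => by subst e; omega
      have hca : c ≠ a := by
        rintro rfl
        rcases hbc with hbc | hbc
        · omega
        · exact hba (hsx b hb hbc)
      by_cases e : P.cls b = P.cls c
      -- Within a common class the neighbours of `a`, the vertex just visited, have been moved
      -- ahead; so the non-neighbour `b` is neither before `c` nor in the class of `c`.
      · exfalso
        have hci : i < P.pos c := by
          by_contra hcon
          rcases (not_lt.1 hcon).lt_or_eq with h2 | h2
          · have := h.single c hc h2 b hb e
            subst this
            omega
          · exact hca (hP.pos_inj hc hxn (by omega))
        have h2 := hnear c hc b hb hci hca hba e.symm hEac hEab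
        rcases hbc with hbc | hbc
        · omega
        · have := (hcls'' b hb c hc hba hca e).1 hbc
          tauto
      · obtain ⟨d, hd, hda, hd'⟩ := h.sep b hb c hc hbi.le (hbc'.resolve_right e) e
        refine ⟨d, hd, ?_, hd'⟩
        rw [hposlt d hd (by omega)]
        omega
  · intro b hb c hc hbi hbc hne
    have hb' : i < P.pos b := (hgt b hb).1 (by omega)
    have hc' : i < P.pos c := (hgt c hc).1 (by omega)
    have hbx : b ≠ x := fun e => by subst e; omega
    have hcx : c ≠ x := fun e => by subst e; omega
    by_cases e : P.cls b = P.cls c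
    · have h2 := hcls'' b hb c hc hbx hcx e
      refine ⟨x, hxn, by omega, ?_⟩
      by_cases hEb : E x b
      · exact ⟨hEb, by tauto⟩
      · have h3 := hnear c hc b hb hc' hcx hbx e.symm (by tauto) hEb
        omega
    · obtain ⟨d, hd, hda, hd'⟩ :=
        h.sep b hb c hc hb'.le ((href.pos_lt_iff hP hb hc e).1 hbc) e
      refine ⟨d, hd, ?_, hd'⟩
      rw [hposlt d hd hda]
      omega

theorem Lex.isLexOrder {E : ℕ → ℕ → Prop} (hP : P.WF n) (h : Lex n E n P) :
    IsLexOrder E P.pos {v | v < n} := fun a ha b hb c hc hab hbc hEac hEab =>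
  h.lex a ha b hb c hc (hP.pos_lt a ha) hab (Or.inl hbc) hEac hEab

end OrdPart


/-! ### Lexicographic breadth first search -/

/-- The lists of neighbours of a symmetric relation on `0, …, n - 1`. -/
structure IsAdjList (n : ℕ) (adj : ℕ → List ℕ) : Prop where
  symm : ∀ v w, w ∈ adj v → v ∈ adj w
  lt : ∀ v w, w ∈ adj v → w < n

theorem OrdPart.IsPerm.sum_ord {n : ℕ} {P : OrdPart} (h : P.IsPerm n) (f : ℕ → ℕ → ℕ) :
    ∑ j ∈ Finset.range n, f (P.ord j) j = ∑ v ∈ Finset.range n, f v (P.pos v) := by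
  refine Finset.sum_nbij' P.ord P.pos ?_ ?_ ?_ ?_ ?_ <;> simp only [Finset.mem_range]
  · exact h.ord_lt
  · exact h.pos_lt
  · exact h.pos_ord
  · exact h.ord_pos
  · intro j hj
    rw [h.pos_ord j hj]

namespace RAM

open Program OrdPart

notation "rI" => (20 : ℕ)
notation "rX" => (21 : ℕ)

/-- The linked lists of the neighbours are in the memory; all nodes are below `rFree`. -/
structure GraphMem (n : ℕ) (adj : ℕ → List ℕ) (s : Memory) : Prop where
  n_eq : s.reg rN = n
  zero : s.reg rZero = 0
  one : s.reg rOne = 1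
  free_pos : 0 < s.reg rFree
  list : ∀ v < n, IsList (s.arr aVal) (s.arr aNxt) (s.reg rFree) (s.arr aAdj v) (adj v)

theorem GraphMem.congr {n : ℕ} {adj : ℕ → List ℕ} {s s' : Memory} (h : GraphMem n adj s)
    (h₀ : s'.reg rN = s.reg rN) (h₁ : s'.reg rZero = s.reg rZero) (h₂ : s'.reg rOne = s.reg rOne)
    (h₃ : s'.reg rFree = s.reg rFree) (h₄ : s'.arr aAdj = s.arr aAdj)
    (h₅ : ∀ k < s.reg rFree, s'.arr aVal k = s.arr aVal k)
    (h₆ : ∀ k < s.reg rFree, s'.arr aNxt k = s.arr aNxt k) : GraphMem n adj s' where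
  n_eq := h₀.trans h.n_eq
  zero := h₁.trans h.zero
  one := h₂.trans h.one
  free_pos := h₃ ▸ h.free_pos
  list v hv := by
    rw [h₃, h₄]
    exact (h.list v hv).congr le_rfl h₅ h₆

/-- Split all classes but that of the element in register `r` by the list at `rPtr`. -/
def pivot (r : ℕ) : Program := (load rOwn aCls r ;; load rPiv aPos r) ;; splitLoop

/-- Split off the element in register `r` from its class, to the left. -/
def isolate (r : ℕ) : Program :=
  (store aVal rFree r ;; store aNxt rFree rZero ;; copy rPtr rFree ;; copy rOwn rNid ;;
    const rPiv 0) ;; splitLoop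

variable {n : ℕ} {adj : ℕ → List ℕ} {s : Memory}

theorem GraphMem.of_pivot {r : ℕ} {s' : Memory} (h : GraphMem n adj s)
    (hf : Frame (pivot r) s s') : GraphMem n adj s' :=
  h.congr (hf.reg _ rfl) (hf.reg _ rfl) (hf.reg _ rfl) (hf.reg _ rfl) (hf.arr _ rfl)
    (fun _ _ => by rw [hf.arr _ rfl]) (fun _ _ => by rw [hf.arr _ rfl])

theorem halts_pivot {K r : ℕ} {l : List ℕ} (hr : r ≠ rOwn) (hg : GraphMem n adj s)
    (hwf : s.part.WF n) (hl : IsList (s.arr aVal) (s.arr aNxt) K (s.reg rPtr) l)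
    (hln : ∀ y ∈ l, y < n) :
    Halts (pivot r) s (50 * l.length + 4) fun s' =>
      Split n (· ∈ l) (s.part.cls (s.reg r)) (s.part.pos (s.reg r)) s.part s'.part ∧
        s'.part.WF n ∧ GraphMem n adj s' := by
  suffices Halts (pivot r) s (2 + (50 * l.length + 2)) fun s' =>
      Split n (· ∈ l) (s.part.cls (s.reg r)) (s.part.pos (s.reg r)) s.part s'.part ∧
        s'.part.WF n from
    this.mono (by omega) fun s' hf h => ⟨h.1, h.2, hg.of_pivot hf⟩
  refine Halts.comp_exec rfl le_rfl fun hf => ?_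
  have hpart : ((load rOwn aCls r ;; load rPiv aPos r).exec s).part = s.part := rfl
  refine (halts_splitLoop ?_ ?_ (hpart ▸ hwf) (K := K) (l := l) ?_ hln).mono le_rfl
    fun s' _ h => ?_
  · rw [hf.reg _ rfl, hg.zero]
  · rw [hf.reg _ rfl, hg.one]
  · rwa [hf.reg _ rfl, hf.arr _ rfl, hf.arr _ rfl]
  · simpa [exec, hpart, hr, Memory.part] using h

/-- The list with one entry is put into the first free node, which is not reserved, as it is needed
only during the split. The unused name in `rOwn` exempts no class, and with `rPiv` zero every class
counts as lying on the right, so that the element goes to the front. -/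
theorem halts_isolate {r : ℕ} (hg : GraphMem n adj s) (hwf : s.part.WF n) (hr : s.reg r < n) :
    Halts (isolate r) s 57 fun s' =>
      Split n (· = s.reg r) s.part.nid 0 s.part s'.part ∧ s'.part.WF n ∧ GraphMem n adj s' := by
  refine Halts.comp_exec (T₁ := 5) (T₂ := 52) rfl le_rfl fun hf => ?_
  set s₁ := exec _ s with hs₁
  have hpart : s₁.part = s.part := rfl
  have hval : s₁.arr aVal = Function.update (s.arr aVal) (s.reg rFree) (s.reg r) := rfl
  have hnxt : s₁.arr aNxt = Function.update (s.arr aNxt) (s.reg rFree) (s.reg rZero) := rfl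
  have hptr : s₁.reg rPtr = s.reg rFree := rfl
  have hown : s₁.reg rOwn = s.part.nid := rfl
  have hpiv : s₁.reg rPiv = 0 := rfl
  have hg₁ : GraphMem n adj s₁ := by
    refine hg.congr rfl rfl rfl rfl rfl (fun k hk => ?_) (fun k hk => ?_)
    · rw [hval, Function.update_of_ne hk.ne]
    · rw [hnxt, Function.update_of_ne hk.ne]
  clear_value s₁
  have := halts_splitLoop (n := n) (K := s.reg rFree + 1) (l := [s.reg r]) hg₁.zero hg₁.one
    (hpart ▸ hwf) ?_ (by simpa using hr)
  · refine this.mono le_rfl fun s' hf' h => ⟨?_, h.2, ?_⟩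
    · have h := h.1
      rw [hpart, hown, hpiv] at h
      simpa using h
    · exact hg₁.congr (hf'.reg _ rfl) (hf'.reg _ rfl) (hf'.reg _ rfl) (hf'.reg _ rfl)
        (hf'.arr _ rfl) (fun _ _ => by rw [hf'.arr _ rfl]) (fun _ _ => by rw [hf'.arr _ rfl])
  · rw [hptr, hval, hnxt, hg.zero]
    exact ⟨hg.free_pos, Nat.lt_succ_self _, by simp, by simp [IsList]⟩

/-- Make all elements one class, leaving the order of the elements unchanged. -/
def initPart : Program :=
  (copy rX rNid ;; succ rNid rNid ;; store aSt rX rZero ;; store aEn rX rN ;; const rI 0) ;;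
  whileLt rI rN (store aCls rI rX ;; succ rI rI)

theorem GraphMem.of_initPart {s' : Memory} (h : GraphMem n adj s)
    (hf : Frame initPart s s') : GraphMem n adj s' :=
  h.congr (hf.reg _ rfl) (hf.reg _ rfl) (hf.reg _ rfl) (hf.reg _ rfl) (hf.arr _ rfl)
    (fun _ _ => by rw [hf.arr _ rfl]) (fun _ _ => by rw [hf.arr _ rfl])

/-- The class receives an unused name, and the entries of `tw` stay below `nid`; so the partition
can be reset between search and refinement without clearing arrays. -/
theorem halts_initPart (hn : s.reg rN = n) (hzero : s.reg rZero = 0) (hperm : s.part.IsPerm n)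
    (htw : ∀ c, s.part.tw c < s.part.nid) :
    Halts initPart s (3 * n + 6) fun s' => s'.part.WF n ∧ s'.part.ord = s.part.ord ∧
      s'.part.pos = s.part.pos ∧ ∀ v < n, ∀ w < n, s'.part.cls v = s'.part.cls w := by
  refine (Halts.comp_exec (T₁ := 5) (T₂ := 3 * n + 1) rfl le_rfl fun hf => ?_).mono (by omega)
    fun _ _ h => h
  set s₁ := exec _ s with hs₁
  have h1 : s₁.reg rX = s.part.nid := rfl
  have h2 : s₁.reg rNid = s.part.nid + 1 := rfl
  have h3 : s₁.arr aSt s.part.nid = 0 := by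
    simp [hs₁, exec, Memory.part, hzero]
  have h4 : s₁.arr aEn s.part.nid = n := by
    simp [hs₁, exec, Memory.part, hn]
  have h5 : s₁.reg rI = 0 := rfl
  have h6 : s₁.reg rN = n := hn
  have h7 : s₁.arr aOrd = s.arr aOrd := rfl
  have h8 : s₁.arr aPos = s.arr aPos := rfl
  have h9 : s₁.arr aTw = s.arr aTw := rfl
  clear_value s₁
  refine (Halts.loop (fun k s' => s'.reg rI ≤ n ∧ (∀ v < s'.reg rI, s'.arr aCls v = s.part.nid) ∧
    k = 3 * (n - s'.reg rI)) ?_ (3 * n) (by simp [h5])).mono le_rfl ?_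
  · rintro _ s₂ hf₂ ⟨hi, hc, rfl⟩ hlt
    rw [hf₂.reg rN rfl, h6] at hlt
    have hx : s₂.reg rX = s.part.nid := (hf₂.reg _ rfl).trans h1
    refine ⟨2, Halts.of_exec rfl le_rfl fun _ => ⟨3 * (n - (s₂.reg rI + 1)), by omega, ?_, ?_, ?_⟩⟩
    · simpa [exec] using hlt
    · simp only [exec, Memory.setReg_reg, Memory.setArr_reg, Memory.setReg_arr, Memory.setArr_arr,
        if_true, hx]
      intro v hv
      rcases (Nat.lt_succ_iff.1 hv).lt_or_eq with h | h
      · rw [Function.update_of_ne h.ne]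
        exact hc v h
      · rw [h, Function.update_self]
    · simp [exec]
  · rintro s₂ hf₂ ⟨⟨k, hi, hc, -⟩, hlt⟩
    rw [hf₂.reg rN rfl, h6] at hlt
    have hcls : ∀ v < n, s₂.part.cls v = s.part.nid := fun v hv => hc v (by omega)
    have hord : s₂.part.ord = s.part.ord := (hf₂.arr aOrd rfl).trans h7
    have hpos : s₂.part.pos = s.part.pos := (hf₂.arr aPos rfl).trans h8
    have htw' : s₂.part.tw = s.part.tw := (hf₂.arr aTw rfl).trans h9
    have hst : s₂.part.st s.part.nid = 0 := (congrFun (hf₂.arr aSt rfl) _).trans h3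
    have hen : s₂.part.en s.part.nid = n := (congrFun (hf₂.arr aEn rfl) _).trans h4
    have hnid : s₂.part.nid = s.part.nid + 1 := (hf₂.reg rNid rfl).trans h2
    refine ⟨?_, hord, hpos, fun v hv w hw => by rw [hcls v hv, hcls w hw]⟩
    constructor
    · constructor
      · rw [hord]
        exact hperm.ord_lt
      · rw [hpos]
        exact hperm.pos_lt
      · rw [hord, hpos]
        exact hperm.pos_ord
      · rw [hord, hpos]
        exact hperm.ord_pos
    · intro v hv
      rw [hcls v hv, hst]
      exact Nat.zero_le _
    · intro v hv
      rw [hcls v hv, hen, hpos]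
      exact hperm.pos_lt v hv
    · intro v hv
      rw [hcls v hv, hen]
    · intro v hv w hw _ _
      rw [hcls v hv, hcls w hw]
    · intro v hv
      rw [hcls v hv, hnid]
      exact Nat.lt_succ_self _
    · intro c
      rw [htw', hnid]
      exact (htw c).trans (Nat.lt_succ_self _)

/-- Lexicographic breadth first search; the order goes to the array `aSig`. -/
def lexBFS : Program :=
  const rI 0 ;;
  whileLt rI rN ((load rX aOrd rI ;; store aSig rI rX) ;; isolate rX ;; load rPtr aAdj rX ;;
    pivot rX ;; succ rI rI)

theorem halts_lexBFS (hadj : IsAdjList n adj) (hg : GraphMem n adj s) (hwf : s.part.WF n)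
    (hone : ∀ v < n, ∀ w < n, s.part.cls v = s.part.cls w) :
    Halts lexBFS s (∑ v ∈ Finset.range n, (50 * (adj v).length + 80) + 2) fun s' =>
      GraphMem n adj s' ∧ s'.part.WF n ∧ Lex n (fun a b => b ∈ adj a) n s'.part ∧
        ∀ j < n, s'.arr aSig j = s'.part.ord j := by
  set W := ∑ v ∈ Finset.range n, (50 * (adj v).length + 80) with hW
  refine (Halts.comp_exec (T₁ := 1) (T₂ := W + 1) rfl le_rfl fun hf => ?_).mono (by omega)
    fun _ _ h => h
  set s₁ := exec _ s with hs₁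
  have hpart : s₁.part = s.part := rfl
  have hi₁ : s₁.reg rI = 0 := rfl
  have hg₁ : GraphMem n adj s₁ := hg.congr rfl rfl rfl rfl rfl (fun _ _ => rfl) fun _ _ => rfl
  clear_value s₁
  -- The time left and the cost of the visited vertices always add up to `W`. A sum over positions
  -- is a sum over vertices by `IsPerm.sum_ord`, so the budget is never exceeded.
  refine (Halts.loop (fun k s' => GraphMem n adj s' ∧ s'.part.WF n ∧ s'.reg rI ≤ n ∧
    Lex n (fun a b => b ∈ adj a) (s'.reg rI) s'.part ∧
    (∀ j < s'.reg rI, s'.arr aSig j = s'.part.ord j) ∧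
    k + ∑ j ∈ Finset.range (s'.reg rI), (50 * (adj (s'.part.ord j)).length + 80) = W) ?_ W
    ?_).mono le_rfl ?_
  · rintro k s₂ - ⟨hg₂, hwf₂, hin, hlex, hsig, hk⟩ hlt
    rw [hg₂.n_eq] at hlt
    set i := s₂.reg rI with hi
    set x := s₂.part.ord i with hx
    have hxn : x < n := hwf₂.ord_lt i hlt
    have hsum : ∑ j ∈ Finset.range (i + 1), (50 * (adj (s₂.part.ord j)).length + 80) ≤ W := by
      rw [hW, ← hwf₂.toIsPerm.sum_ord fun v _ => 50 * (adj v).length + 80]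
      refine Finset.sum_le_sum_of_subset ?_
      intro j
      simp only [Finset.mem_range]
      omega
    rw [Finset.sum_range_succ, ← hx] at hsum
    refine ⟨2 + (57 + (1 + (50 * (adj x).length + 4 + 1))), ?_⟩
    refine Halts.comp_exec rfl le_rfl fun hf₃ => ?_
    set s₃ := exec _ s₂ with hs₃
    have hpart₃ : s₃.part = s₂.part := rfl
    have hx₃ : s₃.reg rX = x := rfl
    have hi₃ : s₃.reg rI = i := rfl
    have hsig₃ : s₃.arr aSig = Function.update (s₂.arr aSig) i x := rfl
    have hg₃ : GraphMem n adj s₃ := hg₂.congr rfl rfl rfl rfl rfl (fun _ _ => rfl) fun _ _ => rfl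
    clear_value s₃
    refine Halts.comp (halts_isolate hg₃ (hpart₃ ▸ hwf₂) (by rwa [hx₃]))
      fun s₄ hf₄ ⟨hsp₄, hwf₄, hg₄⟩ => ?_
    have hx₄ : s₄.reg rX = x := (hf₄.reg _ rfl).trans hx₃
    rw [hpart₃, hx₃] at hsp₄
    refine Halts.comp_exec rfl le_rfl fun hf₅ => ?_
    set s₅ := exec _ s₄ with hs₅
    have hpart₅ : s₅.part = s₄.part := rfl
    have hptr₅ : s₅.reg rPtr = s₅.arr aAdj x := by
      rw [← hx₄]
      rfl
    have hg₅ : GraphMem n adj s₅ := hg₄.congr rfl rfl rfl rfl rfl (fun _ _ => rfl) fun _ _ => rfl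
    have hx₅ : s₅.reg rX = x := hx₄
    clear_value s₅
    refine Halts.comp (halts_pivot (K := s₅.reg rFree) (l := adj x) (by decide) hg₅
      (hpart₅ ▸ hwf₄) (hptr₅ ▸ hg₅.list x hxn) (fun y hy => hadj.lt x y hy))
      fun s₆ hf₆ ⟨hsp₆, hwf₆, hg₆⟩ => ?_
    rw [hx₅, hpart₅] at hsp₆
    refine Halts.of_exec rfl le_rfl fun hf₇ => ?_
    have hi₆ : s₆.reg rI = i := by
      rw [hf₆.reg _ rfl, hf₅.reg _ rfl, hf₄.reg _ rfl, hi₃]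
    have hsig₆ : s₆.arr aSig = Function.update (s₂.arr aSig) i x := by
      rw [hf₆.arr _ rfl, hf₅.arr _ rfl, hf₄.arr _ rfl, hsig₃]
    obtain ⟨hlex₆, hord₆⟩ := hlex.succ hlt hwf₂ hx hwf₄ hsp₄ hwf₆ hsp₆
    set s₇ := exec _ s₆ with hs₇
    have hpart₇ : s₇.part = s₆.part := rfl
    have hi₇ : s₇.reg rI = i + 1 := by rw [← hi₆]; rfl
    have hsig₇ : s₇.arr aSig = s₆.arr aSig := rfl
    have hg₇ : GraphMem n adj s₇ := hg₆.congr rfl rfl rfl rfl rfl (fun _ _ => rfl) fun _ _ => rfl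
    clear_value s₇
    refine ⟨k - (50 * (adj x).length + 80), by omega, hg₇, hpart₇ ▸ hwf₆, by omega, ?_, ?_, ?_⟩
    · rw [hpart₇, hi₇]
      exact hlex₆
    · intro j hj
      rw [hi₇] at hj
      rw [hsig₇, hsig₆, hpart₇, hord₆ j (by omega)]
      rcases (Nat.lt_succ_iff.1 hj).lt_or_eq with h | h
      · rw [Function.update_of_ne h.ne]
        exact hsig j h
      · rw [h, Function.update_self]
    · rw [hi₇, Finset.sum_range_succ, hpart₇, hord₆ i le_rfl, ← hx]
      have : ∑ j ∈ Finset.range i, (50 * (adj (s₆.part.ord j)).length + 80) =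
          ∑ j ∈ Finset.range i, (50 * (adj (s₂.part.ord j)).length + 80) := by
        refine Finset.sum_congr rfl fun j hj => ?_
        rw [hord₆ j (Finset.mem_range.1 hj).le]
      rw [this]
      omega
  · refine ⟨hg₁, hpart ▸ hwf, by omega, ?_, by simp [hi₁], by simp [hi₁]⟩
    rw [hi₁]
    exact Lex.zero (by rwa [hpart])
  · rintro s₂ hf₂ ⟨⟨k, hg₂, hwf₂, hin, hlex, hsig, -⟩, hlt⟩
    rw [hg₂.n_eq] at hlt
    have : s₂.reg rI = n := by omega
    rw [this] at hlex hsig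
    exact ⟨hg₂, hwf₂, hlex, hsig⟩

end RAM


/-! ### Refining by all edges that leave a class -/

namespace OrdPart

/-- `P` arises from `P₀` by splitting along edges between the class `c` and other classes. -/
structure ClassSplit (n : ℕ) (E : ℕ → ℕ → Prop) (c : ℕ) (P₀ P : OrdPart) : Prop where
  wf : P.WF n
  refines : Refines n P₀ P
  agrees : ∀ F, OrientsCompl E F {v | v < n} → Agrees n E F P₀ → Agrees n E F P
  tame : ∀ y < n, ∀ z < n, P₀.cls y = P₀.cls z → P₀.cls y ≠ c →
    (∀ a < n, P₀.cls a = c → (E a y ↔ E a z)) → P.cls y = P.cls z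

namespace ClassSplit

variable {n c x : ℕ} {E : ℕ → ℕ → Prop} {P₀ P P' : OrdPart}

theorem init (h : P₀.WF n) : ClassSplit n E c P₀ P₀ :=
  ⟨h, Refines.refl h, fun _ _ h => h, fun _ _ _ _ h _ _ => h⟩

/-- Split by all neighbours of an element of `c`. -/
theorem split_of_mem (hE : ∀ a b, E a b → E b a) (h : ClassSplit n E c P₀ P) (hx : x < n)
    (hxc : P₀.cls x = c) (hs : Split n (E x) (P.cls x) (P.pos x) P P') (hP' : P'.WF n) :
    ClassSplit n E c P₀ P' where
  wf := hP'
  refines := h.refines.trans h.wf hs.refines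
  agrees F hF h₀ := (h.agrees F hF h₀).split hE hF h.wf hx hs (fun _ h => h) fun _ _ _ _ _ h _ => h
  tame y hy z hz hyz hyc hE := (hs.cls_eq_iff y hy z hz).2
    ⟨h.tame y hy z hz hyz hyc hE, Or.inr (hE x hx hxc)⟩

/-- Split by all neighbours in `c` of an element. -/
theorem split_of_subset (hE : ∀ a b, E a b → E b a) (h : ClassSplit n E c P₀ P) (hx : x < n)
    {T : ℕ → Prop} (hT : (∀ y, T y ↔ y < n ∧ P₀.cls y = c ∧ E x y) ∨ ∀ y, ¬ T y)
    (hs : Split n T (P.cls x) (P.pos x) P P') (hP' : P'.WF n) :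
    ClassSplit n E c P₀ P' where
  wf := hP'
  refines := h.refines.trans h.wf hs.refines
  agrees F hF h₀ := by
    refine (h.agrees F hF h₀).split hE hF h.wf hx hs (fun u hu => ?_) fun u hu w hw hTu hTw e => ?_
    · rcases hT with hT | hT
      · exact ((hT u).1 hu).2.2
      · exact absurd hu (hT u)
    · rcases hT with hT | hT
      -- A class that meets `T` lies within `c`, and there `T` is the whole neighbourhood of `x`.
      · have h1 := h.refines.cls_eq u hu w hw e
        have h2 := ((hT u).1 hTu).2.1
        exact fun hxw => hTw ((hT w).2 ⟨hw, by rw [← h1, h2], hxw⟩)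
      · exact absurd hTu (hT u)
  tame y hy z hz hyz hyc hE := by
    refine (hs.cls_eq_iff y hy z hz).2 ⟨h.tame y hy z hz hyz hyc hE, Or.inr ?_⟩
    rcases hT with hT | hT
    · rw [hT, hT]
      have : P₀.cls z ≠ c := hyz ▸ hyc
      tauto
    · simp [hT]

end ClassSplit

end OrdPart

/-! ### Pivots inside a class, and buckets for the vertices that it sees. -/

namespace RAM

open Program OrdPart

notation "rJ" => (22 : ℕ)
notation "rHi" => (23 : ℕ)
notation "rA" => (24 : ℕ)
notation "rB" => (25 : ℕ)
notation "rQ" => (26 : ℕ)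
notation "rKk" => (27 : ℕ)
notation "rTmp" => (28 : ℕ)

variable {n : ℕ} {adj : ℕ → List ℕ} {s : Memory}

/-- The buckets are in the memory, in the nodes from `rFree` to `rTop - 1`. -/
structure BktMem (n : ℕ) (bkt : ℕ → List ℕ) (s : Memory) : Prop where
  list : ∀ b < n, IsList (s.arr aVal) (s.arr aNxt) (s.reg rTop) (s.arr aBkt b) (bkt b)
  src_lt : ∀ k, s.reg rFree ≤ k → k < s.reg rTop → s.arr aSrc k < n
  src : ∀ b < n, bkt b ≠ [] → ∃ k, s.reg rFree ≤ k ∧ k < s.reg rTop ∧ s.arr aSrc k = b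
  sum : s.reg rFree + ∑ b ∈ Finset.range n, (bkt b).length = s.reg rTop

theorem BktMem.congr {bkt : ℕ → List ℕ} {s' : Memory} (h : BktMem n bkt s)
    (h₀ : s'.reg rFree = s.reg rFree) (h₁ : s'.reg rTop = s.reg rTop)
    (h₂ : s'.arr aVal = s.arr aVal) (h₃ : s'.arr aNxt = s.arr aNxt)
    (h₄ : s'.arr aBkt = s.arr aBkt) (h₅ : s'.arr aSrc = s.arr aSrc) : BktMem n bkt s' := by
  constructor
  · rw [h₁, h₂, h₃, h₄]
    exact h.list
  · rw [h₀, h₁, h₅]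
    exact h.src_lt
  · rw [h₀, h₁, h₅]
    exact h.src
  · rw [h₀, h₁]
    exact h.sum

open Function in
theorem sum_length_update (bkt : ℕ → List ℕ) {b : ℕ} (hb : b < n) (l : List ℕ) :
    ∑ x ∈ Finset.range n, (update bkt b l x).length + (bkt b).length =
      ∑ x ∈ Finset.range n, (bkt x).length + l.length := by
  have hm := Finset.mem_range.2 hb
  have h : ∑ x ∈ (Finset.range n).erase b, (update bkt b l x).length =
      ∑ x ∈ (Finset.range n).erase b, (bkt x).length :=
    Finset.sum_congr rfl fun x hx => by rw [update_of_ne (Finset.ne_of_mem_erase hx)]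
  rw [← Finset.add_sum_erase _ _ hm, ← Finset.add_sum_erase _ (fun x => (bkt x).length) hm, h,
    update_self]
  omega

/-- Put `rA` into the bucket of `rB`. -/
def push : Program :=
  store aVal rTop rA ;; load rTmp aBkt rB ;; store aNxt rTop rTmp ;; store aBkt rB rTop ;;
    store aSrc rTop rB ;; succ rTop rTop

open Function in
theorem halts_push {bkt : ℕ → List ℕ} (hg : GraphMem n adj s) (hb : BktMem n bkt s)
    (hbn : s.reg rB < n) :
    Halts push s 6 fun s' => GraphMem n adj s' ∧
      BktMem n (update bkt (s.reg rB) (s.reg rA :: bkt (s.reg rB))) s' ∧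
      (∀ k < s.reg rFree, s'.arr aNxt k = s.arr aNxt k) ∧
      (∀ k < s.reg rFree, s'.arr aVal k = s.arr aVal k) := by
  have hle : s.reg rFree ≤ s.reg rTop := by
    rw [← hb.sum]
    exact Nat.le_add_right _ _
  refine Halts.of_exec rfl le_rfl fun hf => ?_
  set s' := exec _ s with hs'
  have h1 : s'.arr aVal = update (s.arr aVal) (s.reg rTop) (s.reg rA) := rfl
  have h2 : s'.arr aNxt = update (s.arr aNxt) (s.reg rTop) (s.arr aBkt (s.reg rB)) := rfl
  have h3 : s'.arr aBkt = update (s.arr aBkt) (s.reg rB) (s.reg rTop) := rfl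
  have h4 : s'.arr aSrc = update (s.arr aSrc) (s.reg rTop) (s.reg rB) := rfl
  have h5 : s'.reg rTop = s.reg rTop + 1 := rfl
  have h6 : s'.reg rFree = s.reg rFree := rfl
  have h7 : ∀ k < s.reg rFree, s'.arr aVal k = s.arr aVal k := fun k hk => by
    rw [h1, update_of_ne (hk.trans_le hle).ne]
  have h8 : ∀ k < s.reg rFree, s'.arr aNxt k = s.arr aNxt k := fun k hk => by
    rw [h2, update_of_ne (hk.trans_le hle).ne]
  have hg' := hg.congr (s' := s') rfl rfl rfl rfl rfl h7 h8
  clear_value s'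
  refine ⟨hg', ⟨?_, ?_, ?_, ?_⟩, h8, h7⟩
  · intro b hbn'
    rw [h1, h2, h3, h5]
    by_cases e : b = s.reg rB
    · subst e
      rw [update_self, update_self]
      exact (hb.list _ hbn').cons (hg.free_pos.trans_le hle) _
    · rw [update_of_ne e, update_of_ne e]
      exact (hb.list _ hbn').congr (Nat.le_succ _) (fun k hk => update_of_ne hk.ne _ _)
        fun k hk => update_of_ne hk.ne _ _
  · intro k hk hk'
    rw [h4]
    by_cases e : k = s.reg rTop
    · subst e
      rwa [update_self]
    · rw [update_of_ne e]
      exact hb.src_lt k (by omega) (by omega)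
  · intro b hbn' hne
    rw [h4, h5, h6]
    by_cases e : b = s.reg rB
    · exact ⟨s.reg rTop, by omega, by omega, by rw [update_self, e]⟩
    · rw [update_of_ne e] at hne
      obtain ⟨k, hk, hk', hk''⟩ := hb.src b hbn' hne
      exact ⟨k, hk, by omega, by rwa [update_of_ne hk'.ne]⟩
  · have h9 := sum_length_update bkt hbn (s.reg rA :: bkt (s.reg rB))
    have h10 := hb.sum
    rw [List.length_cons] at h9
    rw [h5, h6]
    omega

/-- Put `rA` into the buckets of all its neighbours. -/
def pushLoop : Program :=
  load rQ aAdj rA ;;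
  whileLt rZero rQ (load rB aVal rQ ;; push ;; load rQ aNxt rQ)

theorem halts_pushLoop {bkt : ℕ → List ℕ} (hadj : IsAdjList n adj) (hg : GraphMem n adj s)
    (hb : BktMem n bkt s) (han : s.reg rA < n) :
    Halts pushLoop s (10 * (adj (s.reg rA)).length + 2) fun s' => GraphMem n adj s' ∧
      s'.reg rTop = s.reg rTop + (adj (s.reg rA)).length ∧
      ∃ bkt', BktMem n bkt' s' ∧
        ∀ b y, y ∈ bkt' b ↔ y ∈ bkt b ∨ (y = s.reg rA ∧ b ∈ adj (s.reg rA)) := by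
  set a := s.reg rA with ha
  refine (Halts.comp_exec (T₁ := 1) (T₂ := 10 * (adj a).length + 1) rfl le_rfl fun hf => ?_).mono
    (by omega) fun _ _ h => h
  set s₁ := exec _ s with hs₁
  have hq₁ : s₁.reg rQ = s.arr aAdj a := rfl
  have ha₁ : s₁.reg rA = a := rfl
  have hg₁ : GraphMem n adj s₁ := hg.congr rfl rfl rfl rfl rfl (fun _ _ => rfl) fun _ _ => rfl
  have hb₁ : BktMem n bkt s₁ := hb.congr rfl rfl rfl rfl rfl rfl
  have htop₁ : s₁.reg rTop = s.reg rTop := rfl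
  have hfree₁ : s₁.reg rFree = s.reg rFree := rfl
  clear_value s₁
  -- The list being read lies in nodes below `rFree`, while the buckets use nodes from there on, so
  -- pushing does not disturb it. `done` and `rem` are the parts already read and still to come.
  refine (Halts.loop (fun k s' => GraphMem n adj s' ∧ ∃ (bkt' : ℕ → List ℕ) (done rem : List ℕ), BktMem n bkt' s' ∧
    IsList (s'.arr aVal) (s'.arr aNxt) (s.reg rFree) (s'.reg rQ) rem ∧
    (∀ b y, y ∈ bkt' b ↔ y ∈ bkt b ∨ (y = a ∧ b ∈ done)) ∧
    (∀ b, b ∈ done ∨ b ∈ rem ↔ b ∈ adj a) ∧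
    s'.reg rTop + rem.length = s.reg rTop + (adj a).length ∧
    k = 10 * rem.length) ?_ (10 * (adj a).length) ?_).mono le_rfl ?_
  · rintro _ s₂ hf₂ ⟨hg₂, bkt₂, done, rem, hb₂, hl₂, hmem, hdone, htop₂, rfl⟩ hlt
    rw [hg₂.zero] at hlt
    obtain ⟨rem', rfl, hK, hl'⟩ := hl₂.exists_eq_cons hlt
    set b := s₂.arr aVal (s₂.reg rQ) with hbdef
    have hbn : b < n := hadj.lt a b ((hdone b).1 (Or.inr List.mem_cons_self))
    have ha₂ : s₂.reg rA = a := (hf₂.reg _ rfl).trans ha₁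
    have hfree₂ : s₂.reg rFree = s.reg rFree := (hf₂.reg _ rfl).trans hfree₁
    refine ⟨1 + (6 + 1), Halts.comp_exec rfl le_rfl fun hf₃ => ?_⟩
    set s₃ := exec _ s₂ with hs₃
    have hq₃ : s₃.reg rQ = s₂.reg rQ := rfl
    have hb₃ : s₃.reg rB = b := rfl
    have ha₃ : s₃.reg rA = a := ha₂
    have htop₃ : s₃.reg rTop = s₂.reg rTop := rfl
    have hfree₃ : s₃.reg rFree = s.reg rFree := hfree₂
    have hval₃ : s₃.arr aVal = s₂.arr aVal := rfl
    have hnxt₃ : s₃.arr aNxt = s₂.arr aNxt := rfl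
    have hg₃ : GraphMem n adj s₃ := hg₂.congr rfl rfl rfl rfl rfl (fun _ _ => rfl) fun _ _ => rfl
    have hbm₃ : BktMem n bkt₂ s₃ := hb₂.congr rfl rfl rfl rfl rfl rfl
    clear_value s₃
    refine Halts.comp ((halts_push hg₃ hbm₃ (by rwa [hb₃])).mono le_rfl fun s₄ hf₄ h₄ =>
      (⟨?_, h₄⟩ : s₄.reg rTop = s₂.reg rTop + 1 ∧ _)) fun s₄ hf₄ ⟨htop₄, hg₄, hbm₄, hn₄, hv₄⟩ => ?_
    · have h5 := h₄.2.1.sum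
      have h6 := hbm₃.sum
      have h7 := sum_length_update bkt₂ (show s₃.reg rB < n by rwa [hb₃])
        (s₃.reg rA :: bkt₂ (s₃.reg rB))
      rw [List.length_cons] at h7
      rw [hf₄.reg rFree rfl] at h5
      omega
    · refine Halts.of_exec rfl le_rfl fun hf₅ => ?_
      set s₅ := exec _ s₄ with hs₅
      have hq₅ : s₅.reg rQ = s₄.arr aNxt (s₄.reg rQ) := rfl
      have hg₅ : GraphMem n adj s₅ := hg₄.congr rfl rfl rfl rfl rfl (fun _ _ => rfl) fun _ _ => rfl
      have hbm₅ := hbm₄.congr (s' := s₅) rfl rfl rfl rfl rfl rfl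
      have htop₅ : s₅.reg rTop = s₄.reg rTop := rfl
      have hval₅ : s₅.arr aVal = s₄.arr aVal := rfl
      have hnxt₅ : s₅.arr aNxt = s₄.arr aNxt := rfl
      clear_value s₅
      rw [hb₃, ha₃] at hbm₅
      rw [hfree₃] at hn₄ hv₄
      refine ⟨10 * rem'.length, by rw [List.length_cons]; omega, hg₅, _, b :: done, rem', hbm₅, ?_,
        ?_, ?_, ?_, rfl⟩
      · rw [hq₅, hf₄.reg rQ rfl, hq₃, hn₄ _ hK, hnxt₃, hval₅, hnxt₅]
        exact hl'.congr le_rfl (fun k hk => (hv₄ k hk).trans (by rw [hval₃]))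
          fun k hk => (hn₄ k hk).trans (by rw [hnxt₃])
      · intro b' y
        by_cases e : b' = b
        · subst e
          rw [Function.update_self, List.mem_cons, hmem]
          simp only [List.mem_cons, true_or, and_true]
          tauto
        · rw [Function.update_of_ne e, hmem]
          simp [e]
      · intro b'
        rw [← hdone, List.mem_cons, List.mem_cons]
        tauto
      · rw [List.length_cons] at htop₂
        omega
  · refine ⟨hg₁, bkt, [], adj a, hb₁, ?_, by simp, by simp, by omega, rfl⟩
    rw [hq₁, ← hfree₁, ← hf.arr aAdj rfl]
    exact hg₁.list a han
  · rintro s₂ hf₂ ⟨⟨k, hg₂, bkt₂, done, rem, hb₂, hl₂, hmem, hdone, htop₂, -⟩, hlt⟩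
    rw [hg₂.zero] at hlt
    have hq : s₂.reg rQ = 0 := by omega
    rw [hq] at hl₂
    have := hl₂.eq_nil
    subst this
    refine ⟨hg₂, by simpa using htop₂, bkt₂, hb₂, fun b y => ?_⟩
    rw [hmem, ← hdone]
    simp

/-- Split by the neighbourhoods of the elements at the positions from `rJ` to `rHi - 1`, and put
these elements into the buckets of their neighbours. -/
def splitInner : Program :=
  copy rTop rFree ;;
  whileLt rJ rHi (load rA aOrd rJ ;; pushLoop ;; load rPtr aAdj rA ;; pivot rA ;; succ rJ rJ)

/-- Split by the buckets, and empty them. -/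
def splitOuter : Program :=
  copy rKk rFree ;;
  whileLt rKk rTop ((load rB aSrc rKk ;; load rPtr aBkt rB ;; store aBkt rB rZero) ;; pivot rB ;;
    succ rKk rKk)

/-- All pivots belong to `c`, the class exempt from their splits. So `c` keeps its name and
positions, and can be scanned while everything else is rearranged. The bucket of `b` collects the
neighbours of `b` in `c`, by which `c` is split afterwards. -/
theorem halts_splitInner (hadj : IsAdjList n adj) (hg : GraphMem n adj s) (hwf : s.part.WF n)
    (hbkt : ∀ b < n, s.arr aBkt b = 0) {v c : ℕ} (hv : v < n) (hvc : s.part.cls v = c)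
    (hlo : s.reg rJ = s.part.st c) (hhi : s.reg rHi = s.part.en c) :
    Halts splitInner s (∑ j ∈ Finset.Ico (s.part.st c) (s.part.en c),
        (60 * (adj (s.part.ord j)).length + 10) + 2) fun s' =>
      GraphMem n adj s' ∧ ClassSplit n (fun a b => b ∈ adj a) c s.part s'.part ∧
      (∀ a < n, s.part.cls a = c → ∀ y < n, ∀ z < n, s.part.cls y ≠ c → s.part.cls z ≠ c →
        s'.part.cls y = s'.part.cls z → (y ∈ adj a ↔ z ∈ adj a)) ∧
      s'.reg rTop = s.reg rFree +
        ∑ j ∈ Finset.Ico (s.part.st c) (s.part.en c), (adj (s.part.ord j)).length ∧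
      ∃ bkt, BktMem n bkt s' ∧ ∀ b y, y ∈ bkt b ↔ y < n ∧ s.part.cls y = c ∧ y ∈ adj b := by
  set P₀ := s.part with hP₀
  set lo := P₀.st c with hlodef
  set hi := P₀.en c with hhidef
  have hlohi : lo < hi := by
    have h1 := hwf.lo v hv
    have h2 := hwf.hi v hv
    rw [hvc] at h1 h2
    omega
  have hin : hi ≤ n := by
    have := hwf.en_le v hv
    rwa [hvc] at this
  have hcls : ∀ y < n, (P₀.cls y = c ↔ lo ≤ P₀.pos y ∧ P₀.pos y < hi) := by
    intro y hy
    constructor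
    · rintro rfl
      exact ⟨hwf.lo y hy, hwf.hi y hy⟩
    · rintro ⟨h1, h2⟩
      rw [← hvc]
      exact hwf.cls_eq v hv y hy (by rwa [hvc]) (by rwa [hvc])
  set W := ∑ j ∈ Finset.Ico lo hi, (60 * (adj (P₀.ord j)).length + 10) with hW
  refine (Halts.comp_exec (T₁ := 1) (T₂ := W + 1) rfl le_rfl fun hf => ?_).mono (by omega)
    fun _ _ h => h
  set s₁ := exec _ s with hs₁
  have hpart₁ : s₁.part = P₀ := rfl
  have hj₁ : s₁.reg rJ = lo := hlo
  have hhi₁ : s₁.reg rHi = hi := hhi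
  have hfree₁ : s₁.reg rFree = s.reg rFree := rfl
  have htop₁ : s₁.reg rTop = s.reg rFree := rfl
  have hbkt₁ : s₁.arr aBkt = s.arr aBkt := rfl
  have hg₁ : GraphMem n adj s₁ := hg.congr rfl rfl rfl rfl rfl (fun _ _ => rfl) fun _ _ => rfl
  clear_value s₁
  refine (Halts.loop (fun k s' => GraphMem n adj s' ∧ lo ≤ s'.reg rJ ∧ s'.reg rJ ≤ hi ∧
    ClassSplit n (fun a b => b ∈ adj a) c P₀ s'.part ∧
    (∀ y < n, P₀.cls y = c → s'.part.pos y = P₀.pos y ∧ s'.part.cls y = c) ∧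
    (∀ a < n, P₀.cls a = c → P₀.pos a < s'.reg rJ → ∀ y < n, ∀ z < n, P₀.cls y ≠ c →
      P₀.cls z ≠ c → s'.part.cls y = s'.part.cls z → (y ∈ adj a ↔ z ∈ adj a)) ∧
    s'.reg rTop = s.reg rFree + ∑ j ∈ Finset.Ico lo (s'.reg rJ), (adj (P₀.ord j)).length ∧
    (∃ bkt, BktMem n bkt s' ∧ ∀ b y, y ∈ bkt b ↔ (y < n ∧ P₀.cls y = c ∧ y ∈ adj b) ∧
      P₀.pos y < s'.reg rJ) ∧
    k = ∑ j ∈ Finset.Ico (s'.reg rJ) hi, (60 * (adj (P₀.ord j)).length + 10)) ?_ W ?_).mono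
    le_rfl ?_
  · rintro _ s₂ hf₂ ⟨hg₂, hjlo, hjhi, hpr, hfix, hhom, htop₂, ⟨bkt, hbm₂, hmem⟩, rfl⟩ hlt
    rw [hf₂.reg rHi rfl, hhi₁] at hlt
    set j := s₂.reg rJ with hj
    set a := P₀.ord j with ha
    have hjn : j < n := hlt.trans_le hin
    have han : a < n := hwf.ord_lt j hjn
    have hapos : P₀.pos a = j := hwf.pos_ord j hjn
    have hac : P₀.cls a = c := (hcls a han).2 ⟨by omega, by omega⟩
    have ha₂ : s₂.part.ord j = a := by
      rw [← hapos, ← (hfix a han hac).1, hpr.wf.ord_pos a han]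
    rw [← Finset.sum_Ioo_add_eq_sum_Ico hlt, ← ha]
    refine ⟨1 + (10 * (adj a).length + 2 + (1 + (50 * (adj a).length + 4 + 1))), ?_⟩
    refine Halts.comp_exec rfl le_rfl fun hf₃ => ?_
    set s₃ := exec _ s₂ with hs₃
    have hpart₃ : s₃.part = s₂.part := rfl
    have ha₃ : s₃.reg rA = a := by
      rw [← ha₂]
      rfl
    have htop₃ : s₃.reg rTop = s₂.reg rTop := rfl
    have hj₃ : s₃.reg rJ = j := rfl
    have hg₃ : GraphMem n adj s₃ := hg₂.congr rfl rfl rfl rfl rfl (fun _ _ => rfl) fun _ _ => rfl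
    have hbm₃ : BktMem n bkt s₃ := hbm₂.congr rfl rfl rfl rfl rfl rfl
    clear_value s₃
    have hpush := halts_pushLoop hadj hg₃ hbm₃ (by rwa [ha₃])
    rw [ha₃] at hpush
    refine Halts.comp hpush fun s₄ hf₄ ⟨hg₄, htop₄, bkt', hbm₄, hmem₄⟩ => ?_
    have hpart₄ : s₄.part = s₂.part := by
      rw [← hpart₃]
      simp only [Memory.part]
      rw [hf₄.arr aOrd rfl, hf₄.arr aPos rfl, hf₄.arr aCls rfl, hf₄.arr aSt rfl, hf₄.arr aEn rfl,
        hf₄.arr aTw rfl, hf₄.reg rNid rfl]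
    have ha₄ : s₄.reg rA = a := (hf₄.reg _ rfl).trans ha₃
    refine Halts.comp_exec rfl le_rfl fun hf₅ => ?_
    set s₅ := exec _ s₄ with hs₅
    have hpart₅ : s₅.part = s₂.part := hpart₄
    have hptr₅ : s₅.reg rPtr = s₅.arr aAdj a := by
      rw [← ha₄]
      rfl
    have ha₅ : s₅.reg rA = a := ha₄
    have hg₅ : GraphMem n adj s₅ := hg₄.congr rfl rfl rfl rfl rfl (fun _ _ => rfl) fun _ _ => rfl
    have hbm₅ : BktMem n bkt' s₅ := hbm₄.congr rfl rfl rfl rfl rfl rfl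
    clear_value s₅
    refine Halts.comp (halts_pivot (K := s₅.reg rFree) (l := adj a) (by decide) hg₅
      (hpart₅ ▸ hpr.wf) (hptr₅ ▸ hg₅.list a han) (fun y hy => hadj.lt a y hy))
      fun s₆ hf₆ ⟨hsp₆, hwf₆, hg₆⟩ => ?_
    rw [ha₅, hpart₅] at hsp₆
    refine Halts.of_exec rfl le_rfl fun hf₇ => ?_
    have hj₆ : s₆.reg rJ = j := by
      rw [hf₆.reg _ rfl, hf₅.reg _ rfl, hf₄.reg _ rfl, hj₃]
    have htop₆ : s₆.reg rTop = s₂.reg rTop + (adj a).length := by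
      rw [hf₆.reg _ rfl, hf₅.reg _ rfl, htop₄, htop₃]
    have hbm₆ : BktMem n bkt' s₆ := hbm₅.congr (hf₆.reg _ rfl) (hf₆.reg _ rfl) (hf₆.arr _ rfl)
      (hf₆.arr _ rfl) (hf₆.arr _ rfl) (hf₆.arr _ rfl)
    set s₇ := exec _ s₆ with hs₇
    have hpart₇ : s₇.part = s₆.part := rfl
    have hj₇ : s₇.reg rJ = j + 1 := by rw [← hj₆]; rfl
    have htop₇ : s₇.reg rTop = s₆.reg rTop := rfl
    have hg₇ : GraphMem n adj s₇ := hg₆.congr rfl rfl rfl rfl rfl (fun _ _ => rfl) fun _ _ => rfl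
    have hbm₇ : BktMem n bkt' s₇ := hbm₆.congr rfl rfl rfl rfl rfl rfl
    clear_value s₇
    have hca : s₂.part.cls a = c := (hfix a han hac).2
    refine ⟨_, ?_, hg₇, by omega, by omega, ?_, ?_, ?_, ?_, ⟨bkt', hbm₇, ?_⟩, rfl⟩
    · have : Finset.Ico (s₇.reg rJ) hi = Finset.Ioo j hi := by
        ext k
        simp only [Finset.mem_Ico, Finset.mem_Ioo]
        omega
      rw [this]
      omega
    · rw [hpart₇]
      exact hpr.split_of_mem hadj.symm han hac hsp₆ hwf₆
    · intro y hy hyc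
      obtain ⟨h1, h2⟩ := hfix y hy hyc
      rw [hpart₇, hsp₆.pos_own y hy (h2.trans hca.symm), hsp₆.cls_own y hy (h2.trans hca.symm)]
      exact ⟨h1, hca⟩
    · intro a' ha' ha'c ha'j y hy z hz hyc hzc hyz
      rw [hpart₇, hsp₆.cls_eq_iff y hy z hz] at hyz
      rw [hj₇] at ha'j
      rcases (Nat.lt_succ_iff.1 ha'j).lt_or_eq with hlt' | heq
      · exact hhom a' ha' ha'c hlt' y hy z hz hyc hzc hyz.1
      · have : a' = a := hwf.pos_inj ha' han (heq.trans hapos.symm)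
        rw [this]
        refine hyz.2.resolve_left fun e => hyc ?_
        rw [hpr.refines.cls_eq y hy a han e, hac]
    · rw [hj₇, Finset.sum_Ico_succ_top hjlo, ← ha]
      omega
    · intro b y
      rw [hmem₄, hmem, hj₇]
      constructor
      · rintro (h | ⟨rfl, h⟩)
        · exact ⟨h.1, by omega⟩
        · exact ⟨⟨han, hac, hadj.symm _ _ h⟩, by omega⟩
      · rintro ⟨⟨h1, h2, h3⟩, h4⟩
        rcases (Nat.lt_succ_iff.1 h4).lt_or_eq with hlt' | heq
        · exact Or.inl ⟨⟨h1, h2, h3⟩, hlt'⟩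
        · have : y = a := hwf.pos_inj h1 han (heq.trans hapos.symm)
          exact Or.inr ⟨this, this ▸ hadj.symm _ _ h3⟩
  · refine ⟨hg₁, by omega, by omega, ?_, ?_, ?_, ?_, ⟨fun _ => [], ⟨?_, ?_, ?_, ?_⟩, ?_⟩, ?_⟩
    · rw [hpart₁]
      exact ClassSplit.init hwf
    · intro y hy hyc
      rw [hpart₁]
      exact ⟨rfl, hyc⟩
    · intro a ha hac hlt
      have := (hcls a ha).1 hac
      omega
    · rw [hj₁, htop₁]
      simp
    · intro b hb
      rw [hbkt₁]
      exact hbkt b hb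
    · intro k h1 h2
      omega
    · intro b _ h
      exact absurd rfl h
    · simp [hfree₁, htop₁]
    · intro b y
      simp only [List.not_mem_nil, false_iff, not_and, not_lt]
      rintro ⟨h1, h2, -⟩
      have := (hcls y h1).1 h2
      omega
    · rw [hj₁]
  · rintro s₂ hf₂ ⟨⟨_, hg₂, hjlo, hjhi, hpr, hfix, hhom, htop₂, ⟨bkt, hbm₂, hmem⟩, rfl⟩, hlt⟩
    rw [hf₂.reg rHi rfl, hhi₁] at hlt
    have hj : s₂.reg rJ = hi := by omega
    rw [hj] at hhom htop₂ hmem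
    refine ⟨hg₂, hpr, fun a ha hac => hhom a ha hac ((hcls a ha).1 hac).2, htop₂, bkt, hbm₂, ?_⟩
    intro b y
    rw [hmem]
    refine ⟨fun h => h.1, fun h => ⟨h, ((hcls y h.1).1 h.2.1).2⟩⟩

end RAM


/-! ### Splitting a class by the vertices that see it. -/

namespace RAM

open Program OrdPart

variable {n : ℕ} {adj : ℕ → List ℕ} {s : Memory}

/-- Buckets are found by running through their nodes, so one bucket is met once for each entry. The
first visit uses it and empties it, later visits find an empty list. This costs 50 for each entry
and 10 for each node. -/
theorem halts_splitOuter {P₀ : OrdPart} {c : ℕ} {bkt : ℕ → List ℕ} (hadj : IsAdjList n adj)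
    (hg : GraphMem n adj s) (hpr : ClassSplit n (fun a b => b ∈ adj a) c P₀ s.part)
    (hb : BktMem n bkt s) (hmem : ∀ b y, y ∈ bkt b ↔ y < n ∧ P₀.cls y = c ∧ y ∈ adj b) :
    Halts splitOuter s (60 * (s.reg rTop - s.reg rFree) + 2) fun s' =>
      GraphMem n adj s' ∧ (∀ b < n, s'.arr aBkt b = 0) ∧
      ClassSplit n (fun a b => b ∈ adj a) c P₀ s'.part ∧ Refines n s.part s'.part ∧
      ∀ b < n, P₀.cls b ≠ c → ∀ y < n, ∀ z < n, P₀.cls y = c → P₀.cls z = c →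
        s'.part.cls y = s'.part.cls z → (y ∈ adj b ↔ z ∈ adj b) := by
  set D := s.reg rTop - s.reg rFree with hD
  refine (Halts.comp_exec (T₁ := 1) (T₂ := 60 * D + 1) rfl le_rfl fun hf => ?_).mono (by omega)
    fun _ _ h => h
  set s₁ := exec _ s with hs₁
  have hpart₁ : s₁.part = s.part := rfl
  have hkk₁ : s₁.reg rKk = s.reg rFree := rfl
  have htop₁ : s₁.reg rTop = s.reg rTop := rfl
  have hfree₁ : s₁.reg rFree = s.reg rFree := rfl
  have hsrc₁ : s₁.arr aSrc = s.arr aSrc := rfl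
  have hg₁ : GraphMem n adj s₁ := hg.congr rfl rfl rfl rfl rfl (fun _ _ => rfl) fun _ _ => rfl
  have hb₁ : BktMem n bkt s₁ := hb.congr rfl rfl rfl rfl rfl rfl
  clear_value s₁
  have hle : s.reg rFree ≤ s.reg rTop := by
    rw [← hb.sum]
    exact Nat.le_add_right _ _
  -- What a used bucket achieves for `b`. It survives refinement, so it can be recorded when the
  -- bucket is emptied.
  let Hom (P : OrdPart) (b : ℕ) : Prop := P₀.cls b ≠ c → ∀ y < n, ∀ z < n, P₀.cls y = c →
    P₀.cls z = c → P.cls y = P.cls z → (y ∈ adj b ↔ z ∈ adj b)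
  refine (Halts.loop (fun k s' => GraphMem n adj s' ∧ s.reg rFree ≤ s'.reg rKk ∧
    s'.reg rKk ≤ s.reg rTop ∧ ClassSplit n (fun a b => b ∈ adj a) c P₀ s'.part ∧
    Refines n s.part s'.part ∧ ∃ bkt' : ℕ → List ℕ,
      (∀ b < n, IsList (s'.arr aVal) (s'.arr aNxt) (s.reg rTop) (s'.arr aBkt b) (bkt' b)) ∧
      (∀ b < n, (∀ y, y ∈ bkt' b ↔ y < n ∧ P₀.cls y = c ∧ y ∈ adj b) ∨
        (bkt' b = [] ∧ Hom s'.part b)) ∧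
      (∀ b < n, bkt' b ≠ [] → ∃ k, s'.reg rKk ≤ k ∧ k < s.reg rTop ∧ s.arr aSrc k = b) ∧
      k = 50 * ∑ b ∈ Finset.range n, (bkt' b).length + 10 * (s.reg rTop - s'.reg rKk))
    ?_ (60 * D) ?_).mono le_rfl ?_
  · rintro _ s₂ hf₂ ⟨hg₂, hkk, hkk', hpr₂, href₂, bkt₂, hl₂, hst₂, hsrc₂, rfl⟩ hlt
    rw [hf₂.reg rTop rfl, htop₁] at hlt
    set k := s₂.reg rKk with hk
    have hsrcarr : s₂.arr aSrc = s.arr aSrc := (hf₂.arr _ rfl).trans hsrc₁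
    set b := s.arr aSrc k with hbdef
    have hbn : b < n := hb.src_lt k hkk hlt
    refine ⟨3 + (50 * (bkt₂ b).length + 4 + 1), ?_⟩
    refine Halts.comp_exec rfl le_rfl fun hf₃ => ?_
    set s₃ := exec _ s₂ with hs₃
    have hb₃ : s₃.reg rB = b := by
      rw [hbdef, ← hsrcarr]
      rfl
    have hptr₃ : s₃.reg rPtr = s₂.arr aBkt b := by
      rw [← hb₃]
      rfl
    have hbkt₃ : s₃.arr aBkt = Function.update (s₂.arr aBkt) b 0 := by
      rw [← hb₃, ← hg₂.zero]
      rfl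
    have hpart₃ : s₃.part = s₂.part := rfl
    have hkk₃ : s₃.reg rKk = k := rfl
    have hval₃ : s₃.arr aVal = s₂.arr aVal := rfl
    have hnxt₃ : s₃.arr aNxt = s₂.arr aNxt := rfl
    have hg₃ : GraphMem n adj s₃ := hg₂.congr rfl rfl rfl rfl rfl (fun _ _ => rfl) fun _ _ => rfl
    clear_value s₃
    have hlb : ∀ y ∈ bkt₂ b, y < n := fun y hy => by
      rcases hst₂ b hbn with h | h
      · exact ((h y).1 hy).1
      · rw [h.1] at hy
        exact absurd hy List.not_mem_nil
    refine Halts.comp (halts_pivot (K := s.reg rTop) (l := bkt₂ b) (by decide) hg₃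
      (hpart₃ ▸ hpr₂.wf) (by rw [hptr₃, hval₃, hnxt₃]; exact hl₂ b hbn) hlb)
      fun s₄ hf₄ ⟨hsp₄, hwf₄, hg₄⟩ => ?_
    rw [hb₃, hpart₃] at hsp₄
    refine Halts.of_exec rfl le_rfl fun hf₅ => ?_
    have hkk₄ : s₄.reg rKk = k := (hf₄.reg _ rfl).trans hkk₃
    set s₅ := exec _ s₄ with hs₅
    have hpart₅ : s₅.part = s₄.part := rfl
    have hkk₅ : s₅.reg rKk = k + 1 := by rw [← hkk₄]; rfl
    have hval₅ : s₅.arr aVal = s₂.arr aVal := (hf₄.arr aVal rfl).trans hval₃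
    have hnxt₅ : s₅.arr aNxt = s₂.arr aNxt := (hf₄.arr aNxt rfl).trans hnxt₃
    have hbkt₅ : s₅.arr aBkt = Function.update (s₂.arr aBkt) b 0 := (hf₄.arr aBkt rfl).trans hbkt₃
    have hg₅ : GraphMem n adj s₅ := hg₄.congr rfl rfl rfl rfl rfl (fun _ _ => rfl) fun _ _ => rfl
    clear_value s₅
    have hsum := sum_length_update bkt₂ hbn []
    rw [List.length_nil] at hsum
    have hHom : ∀ b', Hom s₂.part b' → Hom s₄.part b' := fun b' h hb' y hy z hz hyc hzc e =>
      h hb' y hy z hz hyc hzc (hsp₄.refines.cls_eq y hy z hz e)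
    refine ⟨_, ?_, hg₅, by omega, by omega, ?_, ?_, Function.update bkt₂ b [], ?_, ?_, ?_, rfl⟩
    · omega
    · rw [hpart₅]
      refine hpr₂.split_of_subset hadj.symm hbn ?_ hsp₄ hwf₄
      rcases hst₂ b hbn with h | h
      · exact Or.inl h
      · exact Or.inr fun y => by simp [h.1]
    · rw [hpart₅]
      exact href₂.trans hpr₂.wf hsp₄.refines
    · intro b' hb'
      rw [hval₅, hnxt₅, hbkt₅]
      by_cases e : b' = b
      · subst e
        rw [Function.update_self, Function.update_self]
        rfl
      · rw [Function.update_of_ne e, Function.update_of_ne e]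
        exact hl₂ b' hb'
    · intro b' hb'
      rw [hpart₅]
      by_cases e : b' = b
      · rw [e, Function.update_self]
        refine Or.inr ⟨rfl, ?_⟩
        rcases hst₂ b hbn with h | h
        · intro hbc y hy z hz hyc hzc hyz
          rw [hsp₄.cls_eq_iff y hy z hz] at hyz
          -- As `b` lies outside of `c`, the exemption of its own class from the split does not
          -- concern the elements of `c`.
          have hyb : s₂.part.cls y ≠ s₂.part.cls b := fun e' => hbc (by
            rw [← hpr₂.refines.cls_eq y hy b hbn e', hyc])
          have := hyz.2.resolve_left hyb
          rw [h, h] at this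
          tauto
        · exact hHom b h.2
      · rw [Function.update_of_ne e]
        exact (hst₂ b' hb').imp_right fun h => ⟨h.1, hHom b' h.2⟩
    · intro b' hb' hne
      by_cases e : b' = b
      · rw [e, Function.update_self] at hne
        exact absurd rfl hne
      · rw [Function.update_of_ne e] at hne
        obtain ⟨k', h1, h2, h3⟩ := hsrc₂ b' hb' hne
        refine ⟨k', ?_, h2, h3⟩
        rcases h1.lt_or_eq with h | h
        · omega
        · exact absurd (h3.symm.trans (by rw [← h])) e
  · refine ⟨hg₁, by omega, by omega, hpart₁ ▸ hpr, by rw [hpart₁]; exact Refines.refl hpr.wf, bkt, ?_,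
      fun b _ => Or.inl (hmem b), ?_, ?_⟩
    · rw [← htop₁]
      exact hb₁.list
    · rw [hkk₁]
      exact hb.src
    · have := hb.sum
      omega
  · rintro s₂ hf₂ ⟨⟨_, hg₂, hkk, hkk', hpr₂, href₂, bkt₂, hl₂, hst₂, hsrc₂, rfl⟩, hlt⟩
    rw [hf₂.reg rTop rfl, htop₁] at hlt
    have hnil : ∀ b < n, bkt₂ b = [] := by
      intro b hb
      by_contra hne
      obtain ⟨k, h1, h2, -⟩ := hsrc₂ b hb hne
      omega
    refine ⟨hg₂, fun b hb => ?_, hpr₂, href₂, fun b hb => ?_⟩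
    · have := hl₂ b hb
      rwa [hnil b hb] at this
    · rcases hst₂ b hb with h | h
      · intro _ y hy z hz hyc hzc _
        rw [hnil b hb] at h
        have h1 := h y
        have h2 := h z
        simp only [List.not_mem_nil, false_iff] at h1 h2
        tauto
      · exact h.2

/-- Refine the partition by all edges that leave the class at the positions from `rJ` to
`rHi - 1`. -/
def splitByClass : Program := splitInner ;; splitOuter

/-- The buckets receive one node for each list entry of each element of the class, so both halves
are linear in `D`, apart from a constant for each element; their factors of 60 add up to 120. -/
theorem halts_splitByClass (hadj : IsAdjList n adj) (hg : GraphMem n adj s) (hwf : s.part.WF n)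
    (hbkt : ∀ b < n, s.arr aBkt b = 0) {v c : ℕ} (hv : v < n) (hvc : s.part.cls v = c)
    (hlo : s.reg rJ = s.part.st c) (hhi : s.reg rHi = s.part.en c) :
    Halts splitByClass s (∑ j ∈ Finset.Ico (s.part.st c) (s.part.en c),
        (120 * (adj (s.part.ord j)).length + 10) + 4) fun s' =>
      GraphMem n adj s' ∧ (∀ b < n, s'.arr aBkt b = 0) ∧
      ClassSplit n (fun a b => b ∈ adj a) c s.part s'.part ∧
      (∀ a < n, s.part.cls a = c → ∀ y < n, ∀ z < n, s.part.cls y ≠ c → s.part.cls z ≠ c →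
        s'.part.cls y = s'.part.cls z → (y ∈ adj a ↔ z ∈ adj a)) ∧
      ∀ b < n, s.part.cls b ≠ c → ∀ y < n, ∀ z < n, s.part.cls y = c → s.part.cls z = c →
        s'.part.cls y = s'.part.cls z → (y ∈ adj b ↔ z ∈ adj b) := by
  set D := ∑ j ∈ Finset.Ico (s.part.st c) (s.part.en c), (adj (s.part.ord j)).length with hD
  have hsum : ∑ j ∈ Finset.Ico (s.part.st c) (s.part.en c),
        (120 * (adj (s.part.ord j)).length + 10) =
      ∑ j ∈ Finset.Ico (s.part.st c) (s.part.en c),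
        (60 * (adj (s.part.ord j)).length + 10) + 60 * D := by
    rw [hD, Finset.mul_sum, ← Finset.sum_add_distrib]
    exact Finset.sum_congr rfl fun _ _ => by omega
  rw [hsum]
  refine (Halts.comp (T₂ := 60 * D + 2) (halts_splitInner hadj hg hwf hbkt hv hvc hlo hhi)
    fun s₁ hf₁ ⟨hg₁, hpr₁, hom₁, htop₁, bkt, hb₁, hmem⟩ => ?_).mono (by omega) fun _ _ h => h
  refine (halts_splitOuter hadj hg₁ hpr₁ hb₁ hmem).mono ?_
    fun s₂ _ ⟨hg₂, hbkt₂, hpr₂, href₂, hom₂⟩ => ⟨hg₂, hbkt₂, hpr₂, ?_, hom₂⟩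
  · rw [hf₁.reg rFree rfl, htop₁]
    omega
  · exact fun a ha hac y hy z hz hyc hzc e =>
      hom₁ a ha hac y hy z hz hyc hzc (href₂.cls_eq y hy z hz e)

end RAM


/-! ### The coarse partition -/

namespace OrdPart

/-- A partition of the positions `0, …, n - 1` into intervals: the interval that contains the
position `j` begins with `qs j`, and the interval that begins with `i` ends before `ze i`. -/
structure Coarse (n : ℕ) (qs ze : ℕ → ℕ) : Prop where
  le : ∀ j < n, qs j ≤ j
  lt : ∀ j < n, j < ze (qs j)
  ze_le : ∀ j < n, ze (qs j) ≤ n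
  eq : ∀ j < n, ∀ i < n, qs j ≤ i → i < ze (qs j) → qs i = qs j

/-- The classes of `P` lie in the intervals of a coarse partition, and they are not split by
vertices outside of their interval. -/
structure Modular (n : ℕ) (E : ℕ → ℕ → Prop) (P : OrdPart) (qs ze : ℕ → ℕ) : Prop where
  wf : P.WF n
  coarse : Coarse n qs ze
  fine : ∀ v < n, ∀ w < n, P.cls v = P.cls w → qs (P.pos v) = qs (P.pos w)
  hom : ∀ x < n, ∀ y < n, ∀ z < n, P.cls y = P.cls z → qs (P.pos x) ≠ qs (P.pos y) →
    (E x y ↔ E x z)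

variable {n : ℕ} {E : ℕ → ℕ → Prop} {P P' : OrdPart} {qs ze : ℕ → ℕ}

namespace Coarse

theorem qs_qs (h : Coarse n qs ze) {j : ℕ} (hj : j < n) : qs (qs j) = qs j :=
  h.eq j hj _ ((h.le j hj).trans_lt hj) le_rfl ((h.le j hj).trans_lt (h.lt j hj))

/-- Otherwise the interval containing `ze (qs j)` would begin earlier and overlap the interval of
`j`. -/
theorem qs_ze (h : Coarse n qs ze) {j : ℕ} (hj : j < n) (hz : ze (qs j) < n) :
    qs (ze (qs j)) = ze (qs j) := by
  by_contra hne
  have h1 := h.le _ hz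
  have h2 := h.lt _ hz
  have h3 := h.lt j hj
  have h4 := h.le j hj
  have e1 := h.eq j hj (ze (qs j) - 1) (by omega) (by omega) (by omega)
  have e2 := h.eq _ hz (ze (qs j) - 1) (by omega) (by omega) (by omega)
  have h5 := h.lt _ hz
  rw [← e2, e1] at h5
  omega

open Function in
/-- Split the interval of `p` at `t`. -/
theorem split (h : Coarse n qs ze) {p t : ℕ} (hpn : p < n) (hp : qs p = p) (hpt : p < t)
    (ht : t < ze p) :
    Coarse n (fun j => if t ≤ j ∧ j < ze p then t else qs j)
      (update (update ze t (ze p)) p t) := by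
  have hzp := h.ze_le p hpn
  rw [hp] at hzp
  have hin : ∀ j < n, qs j = p ↔ p ≤ j ∧ j < ze p := by
    intro j hj
    constructor
    · intro e
      have h1 := h.le j hj
      have h2 := h.lt j hj
      rw [e] at h1 h2
      exact ⟨h1, h2⟩
    · rintro ⟨h1, h2⟩
      rw [h.eq p hpn j hj (by omega) (by rwa [hp]), hp]
  have hqt : ∀ j < n, qs j ≠ t := by
    intro j hj e
    have h1 := h.qs_qs hj
    rw [e, (hin t (by omega)).2 ⟨hpt.le, ht⟩] at h1
    omega
  have hupd : ∀ j < n, qs j ≠ p → update (update ze t (ze p)) p t (qs j) = ze (qs j) := by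
    intro j hj hne
    rw [update_of_ne hne, update_of_ne (hqt j hj)]
  have htt : update (update ze t (ze p)) p t t = ze p := by
    rw [update_of_ne hpt.ne', update_self]
  constructor
  · intro j hj
    split_ifs with hc
    · exact hc.1
    · exact h.le j hj
  · intro j hj
    split_ifs with hc
    · rw [htt]
      exact hc.2
    · by_cases e : qs j = p
      · rw [e, update_self]
        have := (hin j hj).1 e
        omega
      · rw [hupd j hj e]
        exact h.lt j hj
  · intro j hj
    split_ifs with hc
    · rw [htt]
      exact hzp
    · by_cases e : qs j = p
      · rw [e, update_self]
        omega
      · rw [hupd j hj e]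
        exact h.ze_le j hj
  · intro j hj i hi
    by_cases hc : t ≤ j ∧ j < ze p
    · rw [if_pos hc, htt]
      intro h1 h2
      rw [if_pos ⟨h1, h2⟩]
    · rw [if_neg hc]
      by_cases e : qs j = p
      · rw [e, update_self]
        intro h1 h2
        rw [if_neg (by omega), (hin i hi).2 ⟨h1, by omega⟩]
      · rw [hupd j hj e]
        intro h1 h2
        have h3 := h.eq j hj i hi h1 h2
        rw [if_neg, h3]
        intro h4
        exact e (by rw [← h3, (hin i hi).2 ⟨by omega, h4.2⟩])

end Coarse

namespace Modular

theorem pos_mem (h : Modular n E P qs ze) {v j : ℕ} (hv : v < n) (h₁ : P.st (P.cls v) ≤ j)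
    (h₂ : j < P.en (P.cls v)) : qs j = qs (P.pos v) := by
  have hj : j < n := h₂.trans_le (h.wf.en_le v hv)
  have e := h.wf.cls_eq v hv _ (h.wf.ord_lt j hj)
  rw [h.wf.pos_ord j hj] at e
  have := h.fine _ (h.wf.ord_lt j hj) v hv (e h₁ h₂)
  rwa [h.wf.pos_ord j hj] at this

/-- Refinement moves a vertex only within its class, and the class lies in one coarse interval. -/
theorem qs_pos (h : Modular n E P qs ze) (hr : Refines n P P') {v : ℕ} (hv : v < n) :
    qs (P'.pos v) = qs (P.pos v) :=
  h.pos_mem hv (hr.lo v hv) (hr.hi v hv)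

theorem of_refines (h : Modular n E P qs ze) (hr : Refines n P P') (hP' : P'.WF n) :
    Modular n E P' qs ze where
  wf := hP'
  coarse := h.coarse
  fine v hv w hw e := by
    rw [h.qs_pos hr hv, h.qs_pos hr hw]
    exact h.fine v hv w hw (hr.cls_eq v hv w hw e)
  hom x hx y hy z hz e := by
    rw [h.qs_pos hr hx, h.qs_pos hr hy]
    exact h.hom x hx y hy z hz (hr.cls_eq y hy z hz e)

theorem qs_le_st (h : Modular n E P qs ze) {v : ℕ} (hv : v < n) :
    qs (P.pos v) ≤ P.st (P.cls v) := by
  have h1 := h.wf.lo v hv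
  have h2 := h.wf.hi v hv
  have := h.pos_mem hv le_rfl (by omega)
  rw [← this]
  exact h.coarse.le _ (h1.trans_lt (h.wf.pos_lt v hv))

theorem en_le_ze (h : Modular n E P qs ze) {v : ℕ} (hv : v < n) :
    P.en (P.cls v) ≤ ze (qs (P.pos v)) := by
  have h1 := h.wf.lo v hv
  have h2 := h.wf.hi v hv
  have h3 := h.wf.en_le v hv
  have := h.pos_mem hv (j := P.en (P.cls v) - 1) (by omega) (by omega)
  have h4 := h.coarse.lt (P.en (P.cls v) - 1) (by omega)
  rw [this] at h4
  omega

/-- The interval of `v` consists of one class. -/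
theorem interval_eq (h : Modular n E P qs ze) {v : ℕ} (hv : v < n)
    (hone : ∀ w < n, qs (P.pos w) = qs (P.pos v) → P.cls w = P.cls v) :
    P.st (P.cls v) = qs (P.pos v) ∧ P.en (P.cls v) = ze (qs (P.pos v)) := by
  have h1 := h.qs_le_st hv
  have h2 := h.en_le_ze hv
  have hp := h.wf.pos_lt v hv
  have h3 := h.coarse.le _ hp
  have h4 := h.coarse.lt _ hp
  have h5 := h.coarse.ze_le _ hp
  have key : ∀ j, qs (P.pos v) ≤ j → j < ze (qs (P.pos v)) →
      P.st (P.cls v) ≤ j ∧ j < P.en (P.cls v) := by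
    intro j hj hj'
    have hjn : j < n := by omega
    have e := h.coarse.eq _ hp j hjn hj hj'
    have hu := h.wf.ord_lt j hjn
    have e' := hone _ hu (by rw [h.wf.pos_ord j hjn, e])
    have h6 := h.wf.lo _ hu
    have h7 := h.wf.hi _ hu
    rw [h.wf.pos_ord j hjn, e'] at h6 h7
    exact ⟨h6, h7⟩
  have h6 := key _ le_rfl (by omega)
  have h7 := key (ze (qs (P.pos v)) - 1) (by omega) (by omega)
  omega

end Modular

/-- The vertices in the intervals that begin outside of `p, …, e - 1` are in one class for each
interval. -/
def DoneOutside (n p e : ℕ) (P : OrdPart) (qs : ℕ → ℕ) : Prop :=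
  ∀ v < n, ∀ w < n, qs (P.pos v) = qs (P.pos w) → (qs (P.pos v) < p ∨ e ≤ qs (P.pos v)) →
    P.cls v = P.cls w

open Function in
/-- Split the interval of `p` at `t`, where one of the parts is a class `c`, and refine by the
edges that leave `c`. -/
theorem Modular.split {p e t c : ℕ} (h : Modular n E P qs ze) (hdone : DoneOutside n p e P qs)
    (hpn : p < n) (hpe : p < e) (hp : qs p = p) (hpt : p < t) (ht : t < ze p) (hze : ze p ≤ e)
    (hbd : ∀ v < n, P.st (P.cls v) < t → P.en (P.cls v) ≤ t)
    (hc : (∀ v < n, qs (P.pos v) = p → (P.cls v = c ↔ t ≤ P.pos v)) ∨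
      (∀ v < n, qs (P.pos v) = p → (P.cls v = c ↔ P.pos v < t)))
    (hcp : ∀ v < n, P.cls v = c → qs (P.pos v) = p)
    (hpr : ClassSplit n E c P P')
    (hin : ∀ a < n, P.cls a = c → ∀ y < n, ∀ z < n, P.cls y ≠ c → P.cls z ≠ c →
      P'.cls y = P'.cls z → (E a y ↔ E a z))
    (hout : ∀ b < n, P.cls b ≠ c → ∀ y < n, ∀ z < n, P.cls y = c → P.cls z = c →
      P'.cls y = P'.cls z → (E b y ↔ E b z)) :
    Modular n E P' (fun j => if t ≤ j ∧ j < ze p then t else qs j)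
        (update (update ze t (ze p)) p t) ∧
      DoneOutside n p e P' (fun j => if t ≤ j ∧ j < ze p then t else qs j) := by
  set qs' : ℕ → ℕ := fun j => if t ≤ j ∧ j < ze p then t else qs j with hqs'
  have hin' : ∀ j < n, qs j = p ↔ p ≤ j ∧ j < ze p := by
    intro j hj
    constructor
    · intro e
      have h1 := h.coarse.le j hj
      have h2 := h.coarse.lt j hj
      rw [e] at h1 h2
      exact ⟨h1, h2⟩
    · rintro ⟨h1, h2⟩
      rw [h.coarse.eq p hpn j hj (by omega) (by rwa [hp]), hp]
  have hside : ∀ v < n, ∀ j, P.st (P.cls v) ≤ j → j < P.en (P.cls v) →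
      (t ≤ j ↔ t ≤ P.pos v) := by
    intro v hv j h1 h2
    have h3 := hbd v hv
    have h4 := h.wf.lo v hv
    have h5 := h.wf.hi v hv
    omega
  have hqpos : ∀ v < n, ∀ j, P.st (P.cls v) ≤ j → j < P.en (P.cls v) →
      qs' j = qs' (P.pos v) := by
    intro v hv j h1 h2
    have h3 := h.pos_mem hv h1 h2
    have h4 := hside v hv j h1 h2
    have hjn : j < n := h2.trans_le (h.wf.en_le v hv)
    have h5 := hin' j hjn
    have h6 := hin' (P.pos v) (h.wf.pos_lt v hv)
    rw [h3] at h5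
    have h7 : (t ≤ j ∧ j < ze p) ↔ (t ≤ P.pos v ∧ P.pos v < ze p) := by
      constructor
      · rintro ⟨h8, h9⟩
        exact ⟨h4.1 h8, (h6.1 (h5.2 ⟨by omega, h9⟩)).2⟩
      · rintro ⟨h8, h9⟩
        exact ⟨h4.2 h8, (h5.1 (h6.2 ⟨by omega, h9⟩)).2⟩
    simp only [hqs', h7, h3]
  have hqpos' : ∀ v < n, qs' (P'.pos v) = qs' (P.pos v) := fun v hv =>
    hqpos v hv _ (hpr.refines.lo v hv) (hpr.refines.hi v hv)
  have hfine' : ∀ v < n, ∀ w < n, P.cls v = P.cls w → qs' (P.pos v) = qs' (P.pos w) := by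
    intro v hv w hw e
    refine hqpos w hw _ ?_ ?_
    · rw [← e]
      exact h.wf.lo v hv
    · rw [← e]
      exact h.wf.hi v hv
  have hqq : ∀ j < n, qs j ≠ p → qs' j = qs j := by
    intro j hj hne
    simp only [hqs']
    rw [if_neg]
    rintro ⟨h1, h2⟩
    exact hne ((hin' j hj).2 ⟨by omega, h2⟩)
  have hqp : ∀ j < n, qs j = p → qs' j = if t ≤ j then t else p := by
    intro j hj he
    have := ((hin' j hj).1 he).2
    simp [hqs', this, he]
  refine ⟨⟨hpr.wf, h.coarse.split hpn hp hpt ht, ?_, ?_⟩, ?_⟩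
  · intro v hv w hw hvw
    rw [hqpos' v hv, hqpos' w hw]
    exact hfine' v hv w hw (hpr.refines.cls_eq v hv w hw hvw)
  · intro x hx y hy z hz hyz hne
    rw [hqpos' x hx, hqpos' y hy] at hne
    have hyz' := hpr.refines.cls_eq y hy z hz hyz
    -- If the new cut separates `x` from `y`, exactly one of them lies in `c`, and all edges between
    -- `c` and the rest have just been used. Otherwise the old homogeneity suffices.
    by_cases hq : qs (P.pos x) = qs (P.pos y)
    · have hpx := h.wf.pos_lt x hx
      have hpy := h.wf.pos_lt y hy
      have hxp : qs (P.pos x) = p := by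
        by_contra hxp
        rw [hqq _ hpx hxp, hqq _ hpy (hq ▸ hxp)] at hne
        exact hne hq
      have hyp : qs (P.pos y) = p := hq ▸ hxp
      rw [hqp _ hpx hxp, hqp _ hpy hyp] at hne
      have hxy : ¬ (t ≤ P.pos x ↔ t ≤ P.pos y) := by
        intro hiff
        simp [hiff] at hne
      have hxy' : ¬ (P.cls x = c ↔ P.cls y = c) := by
        rcases hc with hc | hc
        · rw [hc x hx hxp, hc y hy hyp]
          exact hxy
        · rw [hc x hx hxp, hc y hy hyp]
          omega
      by_cases hxc : P.cls x = c
      · have hyc : P.cls y ≠ c := by tauto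
        exact hin x hx hxc y hy z hz hyc (hyz' ▸ hyc) hyz
      · have hyc : P.cls y = c := by tauto
        exact hout x hx hxc y hy z hz hyc (hyz' ▸ hyc) hyz
    · exact h.hom x hx y hy z hz hyz' hq
  · intro v hv w hw hvw hpe'
    rw [hqpos' v hv] at hpe' hvw
    rw [hqpos' w hw] at hvw
    have hpv := h.wf.pos_lt v hv
    have hpw := h.wf.pos_lt w hw
    have hvp : qs (P.pos v) ≠ p := by
      intro hvp
      rw [hqp _ hpv hvp] at hpe'
      split_ifs at hpe' <;> omega
    have hwp : qs (P.pos w) ≠ p := by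
      intro hwp
      rw [hvw, hqp _ hpw hwp] at hpe'
      split_ifs at hpe' <;> omega
    rw [hqq _ hpv hvp, hqq _ hpw hwp] at hvw
    rw [hqq _ hpv hvp] at hpe'
    have hcl := hdone v hv w hw hvw hpe'
    -- A class that fills a finished interval is seen uniformly from `c`, which lies in another
    -- interval, so it remains whole.
    refine hpr.tame v hv w hw hcl (fun hvc => hvp (hcp v hv hvc)) fun a ha hac => ?_
    exact h.hom a ha v hv w hw hcl (by rw [hcp a ha hac]; exact hvp.symm)

/-! ### The potential that pays for cuts, and the number of intervals. -/

/-- The potential of a coarse partition. -/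
def pot (n : ℕ) (w : ℕ → ℕ) (P : OrdPart) (qs ze : ℕ → ℕ) : ℕ :=
  ∑ v ∈ Finset.range n, w v * Nat.log 2 (ze (qs (P.pos v)) - qs (P.pos v))

/-- The number of intervals that begin with one of `p, …, e - 1`. -/
def cnt (qs : ℕ → ℕ) (p e : ℕ) : ℕ := ((Finset.Ico p e).filter fun j => qs j = j).card

theorem pot_congr {w : ℕ → ℕ} (h : ∀ v < n, qs (P'.pos v) = qs (P.pos v)) :
    pot n w P' qs ze = pot n w P qs ze := by
  refine Finset.sum_congr rfl fun v hv => ?_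
  rw [h v (Finset.mem_range.1 hv)]

-- On the part `[a, b)`, at most half of the interval, the logarithm of the length drops by at least
-- one; elsewhere it does not grow.
open Function in
theorem pot_split_add_le {w : ℕ → ℕ} (hP : P.IsPerm n) (h : Coarse n qs ze) {p t a b : ℕ}
    (hpn : p < n) (hp : qs p = p) (hpt : p < t) (ht : t < ze p)
    (hab : (a = t ∧ b = ze p) ∨ (a = p ∧ b = t)) (hsize : 2 * (b - a) ≤ ze p - p) :
    pot n w P (fun j => if t ≤ j ∧ j < ze p then t else qs j) (update (update ze t (ze p)) p t) +
      ∑ j ∈ Finset.Ico a b, w (P.ord j) ≤ pot n w P qs ze := by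
  have hzp := h.ze_le p hpn
  rw [hp] at hzp
  have hlog : ∀ k, 0 < k → 2 * k ≤ ze p - p → Nat.log 2 k + 1 ≤ Nat.log 2 (ze p - p) := by
    intro k hk h2
    rw [← Nat.log_mul_base (by norm_num) hk.ne', mul_comm]
    exact Nat.log_mono_right h2
  have hIco : ∑ j ∈ Finset.Ico a b, w (P.ord j) =
      ∑ j ∈ Finset.range n, if a ≤ j ∧ j < b then w (P.ord j) else 0 := by
    rw [← Finset.sum_filter]
    refine Finset.sum_congr ?_ fun _ _ => rfl
    ext j
    simp only [Finset.mem_Ico, Finset.mem_filter, Finset.mem_range]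
    omega
  unfold pot
  rw [hIco,
    ← hP.sum_ord fun v j => w v * Nat.log 2 (ze (qs j) - qs j),
    ← hP.sum_ord fun v j => w v * Nat.log 2 (update (update ze t (ze p)) p t
      (if t ≤ j ∧ j < ze p then t else qs j) - if t ≤ j ∧ j < ze p then t else qs j),
    ← Finset.sum_add_distrib]
  refine Finset.sum_le_sum fun j hj => ?_
  have hjn := Finset.mem_range.1 hj
  have hin : qs j = p ↔ p ≤ j ∧ j < ze p := by
    constructor
    · intro e
      have h1 := h.le j hjn
      have h2 := h.lt j hjn
      rw [e] at h1 h2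
      exact ⟨h1, h2⟩
    · rintro ⟨h1, h2⟩
      rw [h.eq p hpn j hjn (by omega) (by rwa [hp]), hp]
  by_cases hjp : qs j = p
  · obtain ⟨h1, h2⟩ := hin.1 hjp
    rw [hjp]
    by_cases htj : t ≤ j
    · rw [if_pos ⟨htj, h2⟩, update_of_ne hpt.ne', update_self]
      by_cases hj' : a ≤ j ∧ j < b
      · rw [if_pos hj', ← Nat.mul_succ]
        exact Nat.mul_le_mul_left _ (hlog _ (by omega) (by omega))
      · rw [if_neg hj', add_zero]
        exact Nat.mul_le_mul_left _ (Nat.log_mono_right (by omega))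
    · rw [if_neg (by omega), update_self]
      by_cases hj' : a ≤ j ∧ j < b
      · rw [if_pos hj', ← Nat.mul_succ]
        exact Nat.mul_le_mul_left _ (hlog _ (by omega) (by omega))
      · rw [if_neg hj', add_zero]
        exact Nat.mul_le_mul_left _ (Nat.log_mono_right (by omega))
  · have hnot : ¬ (p ≤ j ∧ j < ze p) := fun hcon => hjp (hin.2 hcon)
    have hqt : qs j ≠ t := by
      intro e
      have h1 := h.qs_qs hjn
      rw [e, h.eq p hpn t (by omega) (by omega) (by rwa [hp]), hp] at h1
      omega
    rw [if_neg (by omega), if_neg (by omega), update_of_ne hjp, update_of_ne hqt, add_zero]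

theorem cnt_split_le (p e t z : ℕ) :
    cnt (fun j => if t ≤ j ∧ j < z then t else qs j) p e ≤ cnt qs p e + 1 := by
  refine (Finset.card_le_card (t := insert t ((Finset.Ico p e).filter fun j => qs j = j)) ?_).trans
    (Finset.card_insert_le _ _)
  intro j
  simp only [Finset.mem_filter, Finset.mem_Ico, Finset.mem_insert]
  rintro ⟨h1, h2⟩
  split_ifs at h2 with h3
  · exact Or.inl h2.symm
  · exact Or.inr ⟨h1, h2⟩

theorem cnt_succ_le {p p' e : ℕ} (hp : qs p = p) (hpp : p < p') (hpe : p < e) :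
    cnt qs p' e + 1 ≤ cnt qs p e := by
  rw [cnt, ← Finset.card_insert_of_notMem (a := p)]
  · refine Finset.card_le_card fun j => ?_
    simp only [Finset.mem_filter, Finset.mem_Ico, Finset.mem_insert]
    rintro (rfl | h)
    · exact ⟨⟨le_rfl, hpe⟩, hp⟩
    · exact ⟨by omega, h.2⟩
  · simp only [Finset.mem_filter, Finset.mem_Ico, not_and]
    omega

end OrdPart


/-! ### Modular partitioning -/

namespace OrdPart

variable {n : ℕ} {E F : ℕ → ℕ → Prop} {P P' : OrdPart} {qs ze : ℕ → ℕ}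

/-- Split off the last vertex of a module in a lexicographic order, to the left. -/
theorem Agrees.exists_isolate (hE : ∀ a b, E a b → E b a) {σ : ℕ → ℕ}
    (hσ : Set.InjOn σ {v | v < n}) (hlex : IsLexOrder E σ {v | v < n})
    (hF : OrientsCompl E F {v | v < n}) (hP : P.WF n) (h : Agrees n E F P) {x : ℕ} (hx : x < n)
    (hmod : ∀ a < n, ∀ b < n, ∀ c < n, P.cls a = P.cls x → P.cls b = P.cls x →
      P.cls c ≠ P.cls x → (E c a ↔ E c b))
    (hmax : ∀ w < n, P.cls w = P.cls x → σ w ≤ σ x)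
    (hs : Split n (· = x) P.nid 0 P P') :
    ∃ F', OrientsCompl E F' {v | v < n} ∧ Agrees n E F' P' := by
  classical
  set M : Set ℕ := {v | v < n ∧ P.cls v = P.cls x} with hM
  have hMC : M ⊆ {v | v < n} := fun v hv => hv.1
  have hxM : x ∈ M := ⟨hx, rfl⟩
  have hmod' : IsModuleIn E M {v | v < n} := fun a ha b hb c hc hcM =>
    hmod a ha.1 b hb.1 c hc ha.2 hb.2 fun e => hcM ⟨hc, e⟩
  -- The lexicographic property is inherited by the module `M`, so its last vertex `x` is a source
  -- of some orientation `F₁` of `M`. The new orientation is `F` with `F₁` substituted on `M`.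
  obtain ⟨F₁, hF₁, hsrc⟩ := (hlex.of_isModuleIn hmod' hMC).exists_source hE
    ((Set.finite_lt_nat n).subset hMC) (hσ.mono hMC) (hF.mono hMC) hxM fun w hw => hmax w hw.1 hw.2
  refine ⟨_, hF.subst hE hF₁ hmod' hMC hxM, ?_⟩
  intro a ha b hb hab hlt hEab
  by_cases hc : P.cls a = P.cls b
  · have hiff := hs.cls_eq_iff a ha b hb
    have h1 : ¬ (a = x ↔ b = x) := fun h => hab (hiff.2 ⟨hc, Or.inr h⟩)
    by_cases hax : a = x
    · subst hax
      have hbx : b ≠ a := fun e => h1 (by simp [e])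
      have hbM : b ∈ M := ⟨hb, hc.symm⟩
      simp only [hxM, hbM, and_self, if_true]
      exact hsrc b hbM hbx hEab
    · have hbx : b = x := by tauto
      subst hbx
      exact absurd hlt (hs.right b hb a ha hc.symm (hP.cls_lt b hb).ne rfl hax
        (Nat.zero_le _)).not_gt
  · have hlt' := (hs.refines.pos_lt_iff hP ha hb hc).1 hlt
    have hen := hP.en_le_st ha hb hc hlt'
    -- Classes are intervals, so agreement for one pair of classes holds for all their members. In
    -- particular it holds for the representative `x`, to which the substituted orientation refers.
    have key : ∀ a' < n, ∀ b' < n, P.cls a' = P.cls a → P.cls b' = P.cls b → ¬ E a' b' →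
        F a' b' := by
      intro a' ha' b' hb' hca hcb
      refine h a' ha' b' hb' (by rwa [hca, hcb]) ?_
      have h2 := hP.hi a' ha'
      have h3 := hP.lo b' hb'
      rw [hca] at h2
      rw [hcb] at h3
      omega
    by_cases haM : a ∈ M <;> by_cases hbM : b ∈ M <;> simp only [haM, hbM, and_self, and_true,
      and_false, if_true, if_false]
    · exact absurd (haM.2.trans hbM.2.symm) hc
    · refine key x hx b hb haM.2.symm rfl fun hE' => hEab (hE _ _ ?_)
      exact (hmod' x hxM a haM b hb hbM).1 (hE _ _ hE')
    · refine key a ha x hx rfl hbM.2.symm fun hE' => hEab ?_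
      exact (hmod' x hxM b hbM a ha haM).1 hE'
    · exact key a ha b hb rfl rfl hEab

theorem WF.en_le_en (h : P.WF n) {u v : ℕ} (hu : u < n) (hv : v < n)
    (hlt : P.st (P.cls v) < P.en (P.cls u)) : P.en (P.cls v) ≤ P.en (P.cls u) := by
  by_cases e : P.cls v = P.cls u
  · rw [e]
  · have h1 := h.lo u hu
    have h2 := h.hi u hu
    have h3 := h.lo v hv
    have h4 := h.hi v hv
    rcases lt_trichotomy (P.pos v) (P.pos u) with h5 | h5 | h5
    · have := h.en_le_st hv hu e h5
      omega
    · exact absurd (congrArg P.cls (h.pos_inj hv hu h5)) e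
    · have := h.en_le_st hu hv (Ne.symm e) h5
      omega

theorem WF.en_le_st' (h : P.WF n) {u v : ℕ} (hu : u < n) (hv : v < n)
    (hlt : P.st (P.cls v) < P.st (P.cls u)) : P.en (P.cls v) ≤ P.st (P.cls u) := by
  have e : P.cls v ≠ P.cls u := fun e => by simp [e] at hlt
  have h1 := h.lo u hu
  have h2 := h.hi u hu
  have h3 := h.lo v hv
  have h4 := h.hi v hv
  rcases lt_trichotomy (P.pos v) (P.pos u) with h5 | h5 | h5
  · exact h.en_le_st hv hu e h5
  · exact absurd (congrArg P.cls (h.pos_inj hv hu h5)) e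
  · have := h.en_le_st hu hv (Ne.symm e) h5
    omega

/-- The state while the intervals at the positions from `p` to `e - 1` are being refined. -/
structure Region (n p e : ℕ) (E F : ℕ → ℕ → Prop) (P : OrdPart) (qs ze : ℕ → ℕ) : Prop where
  modular : Modular n E P qs ze
  done : DoneOutside n p e P qs
  agrees : Agrees n E F P
  bound : ∀ j < n, qs j < e → ze (qs j) ≤ e
  p_le : p ≤ e
  e_le : e ≤ n
  qs_p : p < e → qs p = p

namespace Region

variable {p e : ℕ}

theorem cls_ord (h : Region n p e E F P qs ze) (hpe : p < e) :
    P.ord p < n ∧ P.st (P.cls (P.ord p)) = p ∧ p < P.en (P.cls (P.ord p)) ∧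
      P.en (P.cls (P.ord p)) ≤ ze p ∧ ze p ≤ e := by
  have hpn : p < n := hpe.trans_le h.e_le
  have hwf := h.modular.wf
  have hv := hwf.ord_lt p hpn
  have h1 := h.modular.qs_le_st hv
  have h2 := h.modular.en_le_ze hv
  have h3 := hwf.lo _ hv
  have h4 := hwf.hi _ hv
  have h5 := h.bound p hpn
  rw [hwf.pos_ord p hpn] at h1 h2 h3 h4
  rw [h.qs_p hpe] at h1 h2 h5
  exact ⟨hv, by omega, h4, h2, h5 hpe⟩

/-- Once its first class fills it, the interval is finished, and the next one starts at `ze p`. -/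
theorem jump (h : Region n p e E F P qs ze) (hpe : p < e)
    (hen : P.en (P.cls (P.ord p)) = ze p) : Region n (ze p) e E F P qs ze := by
  obtain ⟨hv, hst, hlt, -, hze⟩ := h.cls_ord hpe
  have hpn : p < n := hpe.trans_le h.e_le
  have hwf := h.modular.wf
  have hco := h.modular.coarse
  have hqp := h.qs_p hpe
  refine ⟨h.modular, ?_, h.agrees, h.bound, hze, h.e_le, fun hz => ?_⟩
  · intro v hvn w hwn hq hout
    by_cases hcase : qs (P.pos v) < p ∨ e ≤ qs (P.pos v)
    · exact h.done v hvn w hwn hq hcase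
    · have hpv := hwf.pos_lt v hvn
      have hpw := hwf.pos_lt w hwn
      have hq' : qs (P.pos v) = p := by
        rw [← hco.qs_qs hpv, hco.eq p hpn (qs (P.pos v)) ((hco.le _ hpv).trans_lt hpv) (by omega)
          (by rw [hqp]; omega), hqp]
      have key : ∀ u < n, qs (P.pos u) = p → P.cls u = P.cls (P.ord p) := by
        intro u hu hqu
        have h1 := hco.le _ (hwf.pos_lt u hu)
        have h2 := hco.lt _ (hwf.pos_lt u hu)
        rw [hqu] at h1 h2
        exact hwf.cls_eq _ hv u hu (by omega) (by omega)
      rw [key v hvn hq', key w hwn (hq ▸ hq')]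
  · have := hco.qs_ze hpn
    rw [hqp] at this
    exact this (hz.trans_le h.e_le)

open Function in
theorem split {t c a b : ℕ} {w : ℕ → ℕ} (h : Region n p e E F P qs ze) (hpe : p < e)
    (hF : OrientsCompl E F {v | v < n}) (hpt : p < t) (ht : t < ze p)
    (hbd : ∀ v < n, P.st (P.cls v) < t → P.en (P.cls v) ≤ t)
    (hc : (∀ v < n, qs (P.pos v) = p → (P.cls v = c ↔ t ≤ P.pos v)) ∨
      (∀ v < n, qs (P.pos v) = p → (P.cls v = c ↔ P.pos v < t)))
    (hcp : ∀ v < n, P.cls v = c → qs (P.pos v) = p)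
    (hab : (a = t ∧ b = ze p) ∨ (a = p ∧ b = t)) (hsize : 2 * (b - a) ≤ ze p - p)
    (hpr : ClassSplit n E c P P')
    (hin : ∀ a < n, P.cls a = c → ∀ y < n, ∀ z < n, P.cls y ≠ c → P.cls z ≠ c →
      P'.cls y = P'.cls z → (E a y ↔ E a z))
    (hout : ∀ b < n, P.cls b ≠ c → ∀ y < n, ∀ z < n, P.cls y = c → P.cls z = c →
      P'.cls y = P'.cls z → (E b y ↔ E b z)) :
    ∃ qs', Region n p e E F P' qs' (update (update ze t (ze p)) p t) ∧
      cnt qs' p e ≤ cnt qs p e + 1 ∧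
      pot n w P' qs' (update (update ze t (ze p)) p t) + ∑ j ∈ Finset.Ico a b, w (P.ord j) ≤
        pot n w P qs ze := by
  obtain ⟨-, -, -, -, hze⟩ := h.cls_ord hpe
  have hpn : p < n := hpe.trans_le h.e_le
  have hwf := h.modular.wf
  have hco := h.modular.coarse
  have hqp := h.qs_p hpe
  obtain ⟨hmod, hdone⟩ := h.modular.split h.done hpn hpe hqp hpt ht hze hbd hc hcp hpr hin hout
  refine ⟨_, ⟨hmod, hdone, hpr.agrees F hF h.agrees, ?_, h.p_le, h.e_le, fun _ => ?_⟩,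
    cnt_split_le p e t _, ?_⟩
  · intro j hj hlt
    have h1 := h.bound j hj
    split_ifs at hlt ⊢ with hcase
    · rw [update_of_ne hpt.ne', update_self]
      exact hze
    · by_cases h2 : qs j = p
      · rw [h2, update_self]
        omega
      · rw [update_of_ne h2]
        by_cases h3 : qs j = t
        · rw [h3, update_self]
          exact hze
        · rw [update_of_ne h3]
          exact h1 hlt
  · exact (if_neg (by omega)).trans hqp
  -- `pot_split_add_le` speaks of the old positions; the new ones give the same potential because no
  -- class straddles the cut.
  · refine le_trans (Nat.add_le_add_right (pot_congr fun v hv => ?_).le _)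
      (pot_split_add_le hwf.toIsPerm hco hpn hqp hpt ht hab hsize)
    have h1 := hpr.refines.lo v hv
    have h2 := hpr.refines.hi v hv
    have h3 := hwf.lo v hv
    have h4 := hwf.hi v hv
    have h5 := hbd v hv
    have h6 := h.modular.qs_pos hpr.refines hv
    have hpv := hwf.pos_lt v hv
    have hpv' := hpr.wf.pos_lt v hv
    have key : ∀ j < n, qs j = p ↔ p ≤ j ∧ j < ze p := by
      intro j hj
      constructor
      · intro e
        have h1 := hco.le j hj
        have h2 := hco.lt j hj
        rw [e] at h1 h2
        exact ⟨h1, h2⟩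
      · rintro ⟨h1, h2⟩
        rw [hco.eq p hpn j hj (by omega) (by rwa [hqp]), hqp]
    have h7 := key _ hpv
    have h8 := key _ hpv'
    have h9 : (t ≤ P'.pos v ∧ P'.pos v < ze p) ↔ (t ≤ P.pos v ∧ P.pos v < ze p) := by
      rw [h6] at h8
      constructor
      · rintro ⟨h10, h11⟩
        exact ⟨by omega, (h7.1 (h8.2 ⟨by omega, h11⟩)).2⟩
      · rintro ⟨h10, h11⟩
        exact ⟨by omega, (h8.1 (h7.2 ⟨by omega, h11⟩)).2⟩
    simp only [h9, h6]

/-- If the interval of `p` is not a class, then a block at one of its ends has at most half of its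
size. -/
theorem exists_block (h : Region n p e E F P qs ze) (hpe : p < e)
    (hen : P.en (P.cls (P.ord p)) < ze p) :
    ze p - 1 < n ∧ P.ord (ze p - 1) < n ∧
    P.en (P.cls (P.ord (ze p - 1))) = ze p ∧
    P.en (P.cls (P.ord p)) ≤ P.st (P.cls (P.ord (ze p - 1))) ∧
    P.st (P.cls (P.ord (ze p - 1))) < ze p ∧
    (∀ v < n, P.cls v = P.cls (P.ord p) → qs (P.pos v) = p) ∧
    (∀ v < n, P.cls v = P.cls (P.ord (ze p - 1)) → qs (P.pos v) = p) ∧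
    (∀ v < n, qs (P.pos v) = p →
      (P.cls v = P.cls (P.ord p) ↔ P.pos v < P.en (P.cls (P.ord p)))) ∧
    (∀ v < n, qs (P.pos v) = p → (P.cls v = P.cls (P.ord (ze p - 1)) ↔
      P.st (P.cls (P.ord (ze p - 1))) ≤ P.pos v)) := by
  obtain ⟨hv, hst, hlt, -, hze⟩ := h.cls_ord hpe
  have hpn : p < n := hpe.trans_le h.e_le
  have hen' := h.e_le
  have hwf := h.modular.wf
  have hco := h.modular.coarse
  have hqp := h.qs_p hpe
  have hz : ze p - 1 < n := by omega
  have hu := hwf.ord_lt _ hz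
  have hq : qs (ze p - 1) = p := by
    rw [hco.eq p hpn _ hz (by omega) (by rw [hqp]; omega), hqp]
  have h1 := h.modular.en_le_ze hu
  have h2 := hwf.hi _ hu
  have h3 := hwf.lo _ hu
  rw [hwf.pos_ord _ hz] at h1 h2 h3
  rw [hq] at h1
  -- The first and the last class are distinct, hence disjoint; so the shorter one has at most half
  -- of the length of the interval.
  have hne : P.cls (P.ord p) ≠ P.cls (P.ord (ze p - 1)) := by
    intro e'
    rw [e'] at hen
    omega
  have h4 := hwf.en_le_st hv hu hne (by rw [hwf.pos_ord _ hz, hwf.pos_ord _ hpn]; omega)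
  refine ⟨hz, hu, by omega, h4, by omega, fun v hvn hvc => ?_, fun v hvn hvc => ?_,
    fun v hvn hvq => ⟨fun hvc => ?_, fun hlt' => ?_⟩, fun v hvn hvq => ⟨fun hvc => ?_, fun hle => ?_⟩⟩
  · have := h.modular.fine v hvn _ hv hvc
    rwa [hwf.pos_ord _ hpn, hqp] at this
  · have := h.modular.fine v hvn _ hu hvc
    rwa [hwf.pos_ord _ hz, hq] at this
  · rw [← hvc]
    exact hwf.hi v hvn
  · refine hwf.cls_eq _ hv v hvn ?_ hlt'
    rw [hst, ← hvq]
    exact hco.le _ (hwf.pos_lt v hvn)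
  · rw [← hvc]
    exact hwf.lo v hvn
  · refine hwf.cls_eq _ hu v hvn hle ?_
    have := hco.lt _ (hwf.pos_lt v hvn)
    rw [hvq] at this
    omega

end Region

theorem Refines.single (h : Refines n P P') {v : ℕ} (hv : v < n)
    (hs : ∀ w < n, P.cls w = P.cls v → w = v) : ∀ w < n, P'.cls w = P'.cls v → w = v :=
  fun w hw e => hs w hw (h.cls_eq w hw v hv e)

theorem cnt_interval_le (h : Coarse n qs ze) {p : ℕ} (hpn : p < n) (hp : qs p = p) :
    cnt qs p (ze p) ≤ 1 := by
  rw [← Finset.card_singleton p]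
  refine Finset.card_le_card fun j => ?_
  simp only [Finset.mem_filter, Finset.mem_Ico, Finset.mem_singleton]
  rintro ⟨⟨h1, h2⟩, h3⟩
  have h4 := h.ze_le p hpn
  rw [hp] at h4
  rw [← h3, h.eq p hpn j (by omega) (by omega) (by rwa [hp]), hp]

/-- Begin to refine an interval that is a class by splitting off a vertex. -/
theorem Region.of_isolate {x : ℕ} (h : Modular n E P qs ze)
    (hone : ∀ v < n, ∀ w < n, qs (P.pos v) = qs (P.pos w) → P.cls v = P.cls w) (hx : x < n)
    (hs : Split n (· = x) P.nid 0 P P') (hP' : P'.WF n) (hF : Agrees n E F P') :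
    Region n (P.st (P.cls x)) (P.en (P.cls x)) E F P' qs ze ∧
      cnt qs (P.st (P.cls x)) (P.en (P.cls x)) ≤ 1 := by
  obtain ⟨hst, hen⟩ := h.interval_eq hx fun w hw e => hone w hw x hx e
  have hpx := h.wf.pos_lt x hx
  have hlt := h.coarse.lt _ hpx
  have hle := h.coarse.le _ hpx
  have hze := h.coarse.ze_le _ hpx
  have hqq := h.coarse.qs_qs hpx
  rw [hst, hen]
  set p := qs (P.pos x) with hp
  refine ⟨⟨h.of_refines hs.refines hP', ?_, hF, ?_, by omega, hze, fun _ => hqq⟩,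
    cnt_interval_le h.coarse (by omega) hqq⟩
  · intro v hv w hw hq hout
    rw [h.qs_pos hs.refines hv] at hq hout
    rw [h.qs_pos hs.refines hw] at hq
    refine (hs.cls_eq_iff v hv w hw).2 ⟨hone v hv w hw hq, Or.inr ⟨?_, ?_⟩⟩
    · rintro rfl
      omega
    · rintro rfl
      omega
  · intro j hj hlt'
    by_contra hcon
    have h1 := h.coarse.eq j hj (ze p - 1) (by omega) (by omega) (by omega)
    have h2 := h.coarse.eq _ hpx (ze p - 1) (by omega) (by omega) (by rw [← hp]; omega)
    rw [h2, ← hp] at h1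
    rw [← h1] at hcon
    exact hcon le_rfl

end OrdPart

/-! ### The refinement loop and its amortised cost. -/

namespace RAM

open Program OrdPart

notation "rP" => (29 : ℕ)
notation "rE" => (30 : ℕ)
notation "rZe" => (31 : ℕ)
notation "rEc" => (32 : ℕ)
notation "rSl" => (33 : ℕ)
notation "rL1" => (34 : ℕ)
notation "rL2" => (35 : ℕ)
notation "rT" => (36 : ℕ)

variable {n : ℕ} {adj : ℕ → List ℕ} {s : Memory}

/-- Compare the first class of the interval at `rP` with the interval. -/
def refineTest : Program :=
  load rTmp aOrd rP ;; load rTmp aCls rTmp ;; load rEc aEn rTmp ;; load rZe aZe rP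

/-- Cut off the first or the last class of the interval at `rP`, whichever is smaller. -/
def chooseBlock : Program :=
  sub rTmp rZe rOne ;; load rTmp aOrd rTmp ;; load rTmp aCls rTmp ;; load rSl aSt rTmp ;;
  sub rL1 rEc rP ;; sub rL2 rZe rSl ;;
  ifLt rL2 rL1 (copy rT rSl ;; copy rJ rSl ;; copy rHi rZe)
    (copy rT rEc ;; copy rJ rP ;; copy rHi rEc) ;;
  store aZe rT rZe ;; store aZe rP rT

/-- Refine the intervals from `rP` to `rE` until they are classes. -/
def refineLoop : Program :=
  whileLt rP rE (refineTest ;; ifLt rEc rZe (chooseBlock ;; splitByClass) (copy rP rZe))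

/-- A block is not empty, so charging 200 for each of its vertices and list entries leaves 110 steps
for the overhead of the round. -/
theorem sum_Ico_cost_le (f : ℕ → ℕ) {a b : ℕ} (hab : a < b) :
    ∑ j ∈ Finset.Ico a b, (120 * f j + 10) + 110 ≤ 200 * ∑ j ∈ Finset.Ico a b, (f j + 1) := by
  have h1 : ∑ j ∈ Finset.Ico a b, (120 * f j + 120) = 120 * ∑ j ∈ Finset.Ico a b, (f j + 1) := by
    rw [Finset.mul_sum]
    exact Finset.sum_congr rfl fun _ _ => by ring
  have h2 : ∑ j ∈ Finset.Ico a b, (120 * f j + 120) =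
      ∑ j ∈ Finset.Ico a b, (120 * f j + 10) + (b - a) * 110 := by
    rw [show (b - a) * 110 = ∑ j ∈ Finset.Ico a b, 110 by simp, ← Finset.sum_add_distrib]
  omega

/-- Cutting off the shorter end class lowers the potential by at least the number of its vertices
and list entries, which pays for splitting by its edges. The surplus also covers the test at the
head of the loop, within the 26, and 20 for the additional interval that must be jumped over later.
-/
theorem halts_refineStep {F : ℕ → ℕ → Prop} {p e : ℕ} {qs : ℕ → ℕ} (hadj : IsAdjList n adj)
    (hg : GraphMem n adj s) (hbkt : ∀ b < n, s.arr aBkt b = 0)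
    (hF : OrientsCompl (fun a b => b ∈ adj a) F {v | v < n})
    (hR : Region n p e (fun a b => b ∈ adj a) F s.part qs (s.arr aZe)) (hpe : p < e)
    (hp : s.reg rP = p) (hec : s.reg rEc = s.part.en (s.part.cls (s.part.ord p)))
    (hze : s.reg rZe = s.arr aZe p) (hlt : s.reg rEc < s.reg rZe) :
    ∃ T, Halts (chooseBlock ;; splitByClass) s T fun s' => ∃ qs',
      GraphMem n adj s' ∧ (∀ b < n, s'.arr aBkt b = 0) ∧
      Region n p e (fun a b => b ∈ adj a) F s'.part qs' (s'.arr aZe) ∧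
      Refines n s.part s'.part ∧
      T + 26 + 200 * pot n (fun v => (adj v).length + 1) s'.part qs' (s'.arr aZe) +
        20 * cnt qs' p e ≤
        200 * pot n (fun v => (adj v).length + 1) s.part qs (s.arr aZe) + 20 * cnt qs p e := by
  obtain ⟨hv, hst, hpen, hen, hzee⟩ := hR.cls_ord hpe
  obtain ⟨hzn, hu, hen', hle, hlt', hcp₁, hcp₂, hc₁, hc₂⟩ := hR.exists_block hpe (by omega)
  have hwf := hR.modular.wf
  have hpn : p < n := hpe.trans_le hR.e_le
  set P := s.part with hP
  set z := s.arr aZe p with hz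
  set ec := P.en (P.cls (P.ord p)) with hecdef
  set sl := P.st (P.cls (P.ord (z - 1))) with hsl
  -- Common form of both choices: the class `c` of `v` fills `[a, b)`, and the cut is at `t`.
  have main : ∀ t c v a b, v < n → P.cls v = c → P.st c = a → P.en c = b →
      p < t → t < z → (∀ v < n, P.st (P.cls v) < t → P.en (P.cls v) ≤ t) →
      ((∀ v < n, qs (P.pos v) = p → (P.cls v = c ↔ t ≤ P.pos v)) ∨
        (∀ v < n, qs (P.pos v) = p → (P.cls v = c ↔ P.pos v < t))) →
      (∀ v < n, P.cls v = c → qs (P.pos v) = p) →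
      ((a = t ∧ b = z) ∨ (a = p ∧ b = t)) → 2 * (b - a) ≤ z - p →
      (chooseBlock.exec s).reg rJ = a → (chooseBlock.exec s).reg rHi = b →
      (chooseBlock.exec s).arr aZe = Function.update (Function.update (s.arr aZe) t z) p t →
      ∃ T, Halts (chooseBlock ;; splitByClass) s T fun s' => ∃ qs',
        GraphMem n adj s' ∧ (∀ b < n, s'.arr aBkt b = 0) ∧
        Region n p e (fun a b => b ∈ adj a) F s'.part qs' (s'.arr aZe) ∧
        Refines n P s'.part ∧
        T + 26 + 200 * pot n (fun v => (adj v).length + 1) s'.part qs' (s'.arr aZe) +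
          20 * cnt qs' p e ≤
          200 * pot n (fun v => (adj v).length + 1) P qs (s.arr aZe) + 20 * cnt qs p e := by
    intro t c v a b hvn hvc hsta henb hpt htz hbd hc hcp hab hsize hJ hHi hzearr
    refine ⟨12 + (∑ j ∈ Finset.Ico a b, (120 * (adj (P.ord j)).length + 10) + 4),
      Halts.comp_exec rfl (by decide) fun hf₁ => ?_⟩
    set s₁ := exec _ s with hs₁
    have hpart₁ : s₁.part = P := OrdPart.ext (hf₁.arr aOrd rfl) (hf₁.arr aPos rfl)
      (hf₁.arr aCls rfl) (hf₁.arr aSt rfl) (hf₁.arr aEn rfl) (hf₁.arr aTw rfl) (hf₁.reg rNid rfl)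
    have hbkt₁ : ∀ b < n, s₁.arr aBkt b = 0 := fun b hb =>
      (congrFun (hf₁.arr aBkt rfl) b).trans (hbkt b hb)
    have hg₁ : GraphMem n adj s₁ := hg.congr (hf₁.reg _ rfl) (hf₁.reg _ rfl) (hf₁.reg _ rfl)
      (hf₁.reg _ rfl) (hf₁.arr _ rfl) (fun _ _ => congrFun (hf₁.arr _ rfl) _)
      fun _ _ => congrFun (hf₁.arr _ rfl) _
    clear_value s₁
    have hsplit := halts_splitByClass hadj hg₁ (hpart₁ ▸ hwf) hbkt₁ hvn (hpart₁ ▸ hvc)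
      (by rw [hpart₁, hsta, hJ]) (by rw [hpart₁, henb, hHi])
    rw [hpart₁, hsta, henb] at hsplit
    refine hsplit.mono le_rfl fun s₂ hf₂ ⟨hg₂, hbkt₂, hpr, hin, hout⟩ => ?_
    obtain ⟨qs', hR', hcnt, hpot⟩ := hR.split (w := fun v => (adj v).length + 1) hpe hF hpt htz
      hbd hc hcp hab hsize hpr hin hout
    have hze₂ : s₂.arr aZe = Function.update (Function.update (s.arr aZe) t z) p t :=
      (hf₂.arr aZe rfl).trans hzearr
    rw [← hz, ← hze₂] at hR' hpot
    refine ⟨qs', hg₂, hbkt₂, hR', hpr.refines, ?_⟩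
    have hpos := hwf.lo v hvn
    have hpos' := hwf.hi v hvn
    rw [hvc, hsta] at hpos
    rw [hvc, henb] at hpos'
    have hsum := sum_Ico_cost_le (fun j => (adj (P.ord j)).length) (show a < b by omega)
    omega
  have hec' : s.reg rEc - s.reg rP = ec - p := by rw [hec, hp]
  have hsl' : s.arr aSt (s.arr aCls (s.arr aOrd (s.reg rZe - s.reg rOne))) = sl := by
    rw [hze, hg.one]
    rfl
  by_cases hcase : z - sl < ec - p
  · have hb : s.reg rZe - s.arr aSt (s.arr aCls (s.arr aOrd (s.reg rZe - s.reg rOne))) <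
        s.reg rEc - s.reg rP := by rwa [hec', hsl', hze]
    refine main sl (P.cls (P.ord (z - 1))) (P.ord (z - 1)) sl z hu rfl rfl hen' (by omega) hlt'
      (fun v hv h => hwf.en_le_st' hu hv h) (Or.inl hc₂) hcp₂ (Or.inl ⟨rfl, rfl⟩) (by omega)
      ?_ ?_ ?_
    · simp [chooseBlock, exec, hb]
      exact hsl'
    · simp [chooseBlock, exec, hb]
      exact hze
    · simp [chooseBlock, exec, hb]
      rw [hsl', hze, hp]
  · have hb : ¬ (s.reg rZe - s.arr aSt (s.arr aCls (s.arr aOrd (s.reg rZe - s.reg rOne))) <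
        s.reg rEc - s.reg rP) := by rwa [hec', hsl', hze]
    refine main ec (P.cls (P.ord p)) (P.ord p) p ec hv rfl hst rfl hpen (by omega)
      (fun v hvn h => hwf.en_le_en hv hvn h) (Or.inr hc₁) hcp₁ (Or.inr ⟨rfl, rfl⟩) (by omega)
      ?_ ?_ ?_
    · simp [chooseBlock, exec, hb]
      exact hp
    · simp [chooseBlock, exec, hb]
      exact hec
    · simp [chooseBlock, exec, hb]
      rw [hec, hze, hp]

/-- The final potential stands on the left because what is not spent here serves the later rounds;
hence `exists_runs_loop` instead of `Halts.loop`. The starts `qs` of the intervals exist only in the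
proof, the memory holds only their ends. -/
theorem exists_runs_refineLoop {F : ℕ → ℕ → Prop} {qs : ℕ → ℕ} (hadj : IsAdjList n adj)
    (hg : GraphMem n adj s) (hbkt : ∀ b < n, s.arr aBkt b = 0)
    (hF : OrientsCompl (fun a b => b ∈ adj a) F {v | v < n})
    (hR : Region n (s.reg rP) (s.reg rE) (fun a b => b ∈ adj a) F s.part qs (s.arr aZe)) :
    ∃ t s' qs', Runs refineLoop s t s' ∧
      t + 200 * pot n (fun v => (adj v).length + 1) s'.part qs' (s'.arr aZe) ≤
        200 * pot n (fun v => (adj v).length + 1) s.part qs (s.arr aZe) +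
          20 * cnt qs (s.reg rP) (s.reg rE) + 1 ∧
      GraphMem n adj s' ∧ (∀ b < n, s'.arr aBkt b = 0) ∧ Refines n s.part s'.part ∧
      Modular n (fun a b => b ∈ adj a) s'.part qs' (s'.arr aZe) ∧
      (∀ v < n, ∀ w < n, qs' (s'.part.pos v) = qs' (s'.part.pos w) →
        s'.part.cls v = s'.part.cls w) ∧
      Agrees n (fun a b => b ∈ adj a) F s'.part := by
  have hloop := exists_runs_loop
    (p := refineTest ;; ifLt rEc rZe (chooseBlock ;; splitByClass) (copy rP rZe))
    (x := rP) (y := rE) (s₀ := s) (fun k s' => ∃ qs', GraphMem n adj s' ∧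
      (∀ b < n, s'.arr aBkt b = 0) ∧
      Region n (s'.reg rP) (s.reg rE) (fun a b => b ∈ adj a) F s'.part qs' (s'.arr aZe) ∧
      Refines n s.part s'.part ∧
      k = 200 * pot n (fun v => (adj v).length + 1) s'.part qs' (s'.arr aZe) +
        20 * cnt qs' (s'.reg rP) (s.reg rE)) ?_ _
      ⟨qs, hg, hbkt, hR, Refines.refl hR.modular.wf, rfl⟩
  · obtain ⟨t, s', k, hruns, ht, ⟨qs', hg', hbkt', hR', hr', rfl⟩, hlt⟩ := hloop
    have hE : s'.reg rE = s.reg rE := hruns.frame.reg rE rfl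
    refine ⟨t, s', qs', hruns, by omega, hg', hbkt', hr', hR'.modular, fun v hv w hw hq => ?_,
      hR'.agrees⟩
    exact hR'.done v hv w hw hq (by have := hR'.p_le; omega)
  · rintro _ s₁ hf₁ ⟨qs₁, hg₁, hbkt₁, hR₁, hr₁, rfl⟩ hlt
    rw [hf₁.reg rE rfl] at hlt
    have hE₁ : s₁.reg rE = s.reg rE := hf₁.reg rE rfl
    set p := s₁.reg rP with hp
    set e := s.reg rE with he
    set s₂ := refineTest.exec s₁ with hs₂
    have hpart₂ : s₂.part = s₁.part := rfl
    have hp₂ : s₂.reg rP = p := rfl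
    have hec₂ : s₂.reg rEc = s₁.part.en (s₁.part.cls (s₁.part.ord p)) := rfl
    have hze₂ : s₂.reg rZe = s₁.arr aZe p := rfl
    have hzearr₂ : s₂.arr aZe = s₁.arr aZe := rfl
    have hbkt₂ : ∀ b < n, s₂.arr aBkt b = 0 := hbkt₁
    have hg₂ : GraphMem n adj s₂ := hg₁.congr rfl rfl rfl rfl rfl (fun _ _ => rfl) fun _ _ => rfl
    by_cases hcase : s₂.reg rEc < s₂.reg rZe
    · obtain ⟨T, hT⟩ := halts_refineStep hadj hg₂ hbkt₂ hF (hzearr₂ ▸ hpart₂ ▸ hR₁) hlt hp₂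
        (hpart₂ ▸ hec₂) (hzearr₂ ▸ hze₂) hcase
      refine ⟨4 + (T + 1), Halts.comp_exec rfl le_rfl fun hf₂ => ?_⟩
      rw [← hs₂]
      clear_value s₂
      refine Halts.ite (fun _ => ?_) fun h => absurd hcase h
      refine hT.mono le_rfl ?_
      rintro s₃ hf₃ ⟨qs₃, hg₃, hbkt₃, hR₃, hr₃, hle⟩
      have hp₃ : s₃.reg rP = p := (hf₃.reg _ rfl).trans hp₂
      rw [hpart₂, hzearr₂] at hle
      rw [hpart₂] at hr₃
      refine ⟨_, ?_, qs₃, hg₃, hbkt₃, hp₃.symm ▸ hR₃, hr₁.trans hR₁.modular.wf hr₃, rfl⟩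
      rw [hp₃]
      omega
    · refine ⟨4 + (1 + 1), Halts.comp_exec rfl le_rfl fun hf₂ => ?_⟩
      rw [← hs₂]
      clear_value s₂
      refine Halts.ite (fun h => absurd h hcase) fun _ => ?_
      obtain ⟨hv, hst, hpen, hen, hzee⟩ := hR₁.cls_ord hlt
      have hjump := hR₁.jump hlt (by omega)
      refine Halts.of_exec rfl le_rfl fun hf₃ => ?_
      set s₃ := exec _ s₂ with hs₃
      have hpart₃ : s₃.part = s₁.part := hpart₂
      have hp₃ : s₃.reg rP = s₁.arr aZe p := hze₂
      have hze₃ : s₃.arr aZe = s₁.arr aZe := hzearr₂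
      have hbkt₃ : ∀ b < n, s₃.arr aBkt b = 0 := hbkt₂
      have hg₃ : GraphMem n adj s₃ :=
        hg₂.congr rfl rfl rfl rfl rfl (fun _ _ => rfl) fun _ _ => rfl
      clear_value s₃
      have hcnt := cnt_succ_le (hR₁.qs_p hlt) (p' := s₁.arr aZe p) (by omega) hlt
      refine ⟨_, ?_, qs₁, hg₃, hbkt₃, ?_, ?_, rfl⟩
      · rw [hpart₃, hp₃, hze₃]
        omega
      · rw [hpart₃, hp₃, hze₃]
        exact hjump
      · rw [hpart₃]
        exact hr₁

/-- Refine the partition until its classes are single vertices, where the vertices are split off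
in the reverse of the order in the array `aSig`. -/
def refineAll : Program :=
  (store aZe rZero rN ;; copy rI rN) ;;
  whileLt rZero rI ((sub rI rI rOne ;; load rX aSig rI ;; load rTmp aCls rX ;; load rP aSt rTmp ;;
    load rE aEn rTmp) ;; isolate rX ;; refineLoop)

/-- Between rounds every coarse interval is one class, hence every class is a module. Vertices are
isolated in reverse search order, so all vertices after `x` are already singletons and `x` is the
last of its class. The orientation that the partition agrees with may change in every round. The
potential is shared by all rounds, and each of the `n` rounds adds a constant. -/
theorem halts_refineAll {F : ℕ → ℕ → Prop} {σ : ℕ → ℕ} (hadj : IsAdjList n adj)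
    (hg : GraphMem n adj s) (hbkt : ∀ b < n, s.arr aBkt b = 0) (hwf : s.part.WF n)
    (hone : ∀ v < n, ∀ w < n, s.part.cls v = s.part.cls w)
    (hF : OrientsCompl (fun a b => b ∈ adj a) F {v | v < n})
    (hσ : ∀ v < n, σ v < n ∧ s.arr aSig (σ v) = v)
    (hsig : ∀ j < n, s.arr aSig j < n ∧ σ (s.arr aSig j) = j)
    (hlex : IsLexOrder (fun a b => b ∈ adj a) σ {v | v < n}) :
    Halts refineAll s (200 * (∑ v ∈ Finset.range n, ((adj v).length + 1) * Nat.log 2 n) +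
        200 * n + 3) fun s' =>
      s'.part.IsPerm n ∧ ∃ F', OrientsCompl (fun a b => b ∈ adj a) F' {v | v < n} ∧
        ∀ a < n, ∀ b < n, s'.part.pos a < s'.part.pos b → b ∉ adj a → F' a b := by
  have hσi : Set.InjOn σ {v | v < n} := fun a ha b hb e => by
    rw [← (hσ a ha).2, e, (hσ b hb).2]
  set W := 200 * (∑ v ∈ Finset.range n, ((adj v).length + 1) * Nat.log 2 n) + 200 * n with hW
  refine (Halts.comp_exec (T₁ := 2) (T₂ := W + 1) rfl le_rfl fun hf => ?_).mono (by omega)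
    fun _ _ h => h
  set s₁ := exec _ s with hs₁
  have hpart₁ : s₁.part = s.part := rfl
  have hi₁ : s₁.reg rI = n := hg.n_eq
  have hg₁ : GraphMem n adj s₁ := hg.congr rfl rfl rfl rfl rfl (fun _ _ => rfl) fun _ _ => rfl
  have hbkt₁ : ∀ b < n, s₁.arr aBkt b = 0 := hbkt
  have hsig₁ : s₁.arr aSig = s.arr aSig := rfl
  have hze₁ : s₁.arr aZe 0 = n := by
    simp [hs₁, exec, hg.zero, hg.n_eq]
  clear_value s₁
  refine (Halts.loop (fun k s' => ∃ qs F', GraphMem n adj s' ∧ (∀ b < n, s'.arr aBkt b = 0) ∧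
    Modular n (fun a b => b ∈ adj a) s'.part qs (s'.arr aZe) ∧
    (∀ v < n, ∀ w < n, qs (s'.part.pos v) = qs (s'.part.pos w) →
      s'.part.cls v = s'.part.cls w) ∧
    OrientsCompl (fun a b => b ∈ adj a) F' {v | v < n} ∧
    Agrees n (fun a b => b ∈ adj a) F' s'.part ∧ s'.reg rI ≤ n ∧
    (∀ v < n, s'.reg rI ≤ σ v → ∀ w < n, s'.part.cls w = s'.part.cls v → w = v) ∧
    k = 200 * pot n (fun v => (adj v).length + 1) s'.part qs (s'.arr aZe) + 200 * s'.reg rI)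
    ?_ W ?_).mono le_rfl ?_
  · rintro _ s₂ hf₂ ⟨qs, F', hg₂, hbkt₂, hmod, hone₂, hF', hag, hin, hsingle, rfl⟩ hlt
    rw [hg₂.zero] at hlt
    have hsig₂ : s₂.arr aSig = s.arr aSig := (hf₂.arr aSig rfl).trans hsig₁
    set i := s₂.reg rI - 1 with hi
    have hin' : i < n := by omega
    set x := s.arr aSig i with hx
    obtain ⟨hxn, hσx⟩ := hsig i hin'
    rw [← hx] at hxn hσx
    set P := s₂.part with hP
    set pt := pot n (fun v => (adj v).length + 1) P qs (s₂.arr aZe) with hpt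
    have hmax : ∀ w < n, P.cls w = P.cls x → σ w ≤ σ x := by
      intro w hw e
      by_contra hcon
      have := hsingle w hw (by omega) x hxn e.symm
      rw [this] at hcon
      exact hcon le_rfl
    obtain ⟨t₃, hr₃, ht₃⟩ := (sub rI rI rOne ;; load rX aSig rI ;; load rTmp aCls rX ;;
      load rP aSt rTmp ;; load rE aEn rTmp).exists_runs_exec rfl s₂
    set s₃ := exec _ s₂ with hs₃
    have hpart₃ : s₃.part = P := rfl
    have hi₃ : s₃.reg rI = i := by
      rw [hi, ← hg₂.one]
      rfl
    have hx₃ : s₃.reg rX = x := by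
      rw [hx, ← hsig₂, ← hi₃]
      rfl
    have hp₃ : s₃.reg rP = P.st (P.cls x) := by
      rw [← hx₃]
      rfl
    have he₃ : s₃.reg rE = P.en (P.cls x) := by
      rw [← hx₃]
      rfl
    have hze₃ : s₃.arr aZe = s₂.arr aZe := rfl
    have hbkt₃ : ∀ b < n, s₃.arr aBkt b = 0 := hbkt₂
    have hg₃ : GraphMem n adj s₃ := hg₂.congr rfl rfl rfl rfl rfl (fun _ _ => rfl) fun _ _ => rfl
    change t₃ ≤ 5 at ht₃
    clear_value s₃
    obtain ⟨t₄, s₄, hr₄, ht₄, hsp₄, hwf₄, hg₄⟩ :=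
      halts_isolate (r := rX) hg₃ (hpart₃ ▸ hmod.wf) (hx₃ ▸ hxn)
    have hf₄ := hr₄.frame
    rw [hpart₃, hx₃] at hsp₄
    obtain ⟨F₄, hF₄, hag₄⟩ := hag.exists_isolate hadj.symm hσi hlex hF' hmod.wf hxn
      (fun a ha b hb c hc hax hbx hcx => hmod.hom c hc a ha b hb (hax.trans hbx.symm) fun e =>
        hcx ((hone₂ c hc a ha e).trans hax)) hmax hsp₄
    obtain ⟨hreg₄, hcnt₄⟩ := Region.of_isolate hmod hone₂ hxn hsp₄ hwf₄ hag₄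
    have hp₄ : s₄.reg rP = P.st (P.cls x) := (hf₄.reg _ rfl).trans hp₃
    have he₄ : s₄.reg rE = P.en (P.cls x) := (hf₄.reg _ rfl).trans he₃
    have hze₄ : s₄.arr aZe = s₂.arr aZe := (hf₄.arr _ rfl).trans hze₃
    have hbkt₄ : ∀ b < n, s₄.arr aBkt b = 0 := fun b hb =>
      (congrFun (hf₄.arr aBkt rfl) b).trans (hbkt₃ b hb)
    rw [← hp₄, ← he₄, ← hze₄] at hreg₄
    rw [← hp₄, ← he₄] at hcnt₄
    obtain ⟨t₅, s₅, qs₅, hr₅, ht₅, hg₅, hbkt₅, href₅, hmod₅, hone₅, hag₅⟩ :=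
      exists_runs_refineLoop hadj hg₄ hbkt₄ hF₄ hreg₄
    have hpot : pot n (fun v => (adj v).length + 1) s₄.part qs (s₄.arr aZe) = pt := by
      rw [hze₄]
      exact pot_congr fun v hv => hmod.qs_pos hsp₄.refines hv
    rw [hpot] at ht₅
    have hi₅ : s₅.reg rI = i :=
      (hr₅.frame.reg _ rfl).trans ((hf₄.reg _ rfl).trans hi₃)
    refine ⟨t₃ + (t₄ + t₅), _, s₅, .seq hr₃ (.seq hr₄ hr₅), le_rfl, _, ?_, qs₅, F₄, hg₅, hbkt₅,
      hmod₅, hone₅, hF₄, hag₅, by omega, fun v hv hle => ?_, rfl⟩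
    · rw [hi₅]
      omega
    · rw [hi₅] at hle
      refine href₅.single hv ?_
      by_cases hvx : v = x
      · subst hvx
        intro w hw e
        have := ((hsp₄.cls_eq_iff w hw x hxn).1 e).2.resolve_left (hmod.wf.cls_lt w hw).ne
        exact this.2 rfl
      · refine hsp₄.refines.single hv (hsingle v hv ?_)
        by_contra hcon
        refine hvx (hσi hv hxn ?_)
        omega
  · have hpart : s₁.part.WF n := hpart₁ ▸ hwf
    -- Initially there is one coarse interval from `0` to `n`. Ends are read only at starts of
    -- intervals, so a single cell has to be set.
    refine ⟨fun _ => 0, F, hg₁, hbkt₁, ⟨hpart, ⟨?_, ?_, ?_, ?_⟩, fun _ _ _ _ _ => rfl,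
      fun _ _ _ _ _ _ _ h => absurd rfl h⟩, fun v hv w hw _ => ?_, hF, fun a ha b hb hab => ?_,
      by omega, fun v hv h => ?_, ?_⟩
    · exact fun _ _ => Nat.zero_le _
    · intro j hj
      rwa [hze₁]
    · intro j hj
      rw [hze₁]
    · exact fun _ _ _ _ _ _ => rfl
    · rw [hpart₁]
      exact hone v hv w hw
    · rw [hpart₁] at hab
      exact absurd (hone a ha b hb) hab
    · have := (hσ v hv).1
      omega
    · rw [hi₁, hW]
      simp [pot, hze₁]
  · rintro s₂ hf₂ ⟨⟨_, qs, F', hg₂, -, hmod, -, hF', hag, -, hsingle, -⟩, hlt⟩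
    rw [hg₂.zero] at hlt
    refine ⟨hmod.wf.toIsPerm, F', hF', fun a ha b hb hab => hag a ha b hb (fun e => ?_) hab⟩
    have := hsingle b hb (by omega) a ha e
    rw [this] at hab
    exact lt_irrefl _ hab

end RAM


/-! ### The algorithm -/

/-- Maximality gives totality, as a pair left unoriented could be added to `H`; and asymmetry
removes the proviso `a ≠ c` from transitivity. -/
theorem Digraph.IsTransitiveOrientationOf.orientsCompl {V : Type*} {G H : Digraph V}
    (h : H.IsTransitiveOrientationOf G.undirectedComplement) :
    OrientsCompl G.undirectedClosure.Adj H.Adj Set.univ := by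
  obtain ⟨⟨⟨hor, hle⟩, hmax⟩, htrans⟩ := h
  refine ⟨fun a _ b _ hab => (hle hab).2, fun a _ b _ hne hnot => ?_,
    fun a _ b _ hab hba => hor a b ⟨hab, hba⟩, fun a _ b _ c _ hab hbc => ?_⟩
  · by_contra hcon
    push Not at hcon
    let K : Digraph V := ⟨fun x y => H.Adj x y ∨ (x = a ∧ y = b)⟩
    have hK : K ≤ H := by
      refine hmax ⟨?_, ?_⟩ fun x y hxy => Or.inl hxy
      · rintro x y ⟨hxy | ⟨rfl, rfl⟩, hyx | ⟨h1, h2⟩⟩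
        · exact hor x y ⟨hxy, hyx⟩
        · subst h1 h2
          exact hcon.2 hxy
        · exact hcon.2 hyx
        · exact hne h2
      · rintro x y (hxy | ⟨rfl, rfl⟩)
        · exact hle hxy
        · exact ⟨hne, hnot⟩
    exact hcon.1 (hK (Or.inr ⟨rfl, rfl⟩))
  · refine htrans a b c hab hbc ?_
    rintro rfl
    exact hor a b ⟨hab, hbc⟩

namespace RAM

open Program OrdPart

variable {n : ℕ} {adj : ℕ → List ℕ} {s : Memory}

/-- Add the element in register `b` to the list of the element in register `a`. -/
def addArc (a b : ℕ) : Program :=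
  store aVal rFree b ;; load rTmp aAdj a ;; store aNxt rFree rTmp ;; store aAdj a rFree ;;
  succ rFree rFree

open Function in
theorem GraphMem.addArc (hg : GraphMem n adj s) {a b : ℕ} (ha : a ≠ rTmp) (hna : s.reg a < n) :
    GraphMem n (update adj (s.reg a) (s.reg b :: adj (s.reg a))) ((addArc a b).exec s) := by
  have hval : ((RAM.addArc a b).exec s).arr aVal = update (s.arr aVal) (s.reg rFree) (s.reg b) := rfl
  have hnxt : ((RAM.addArc a b).exec s).arr aNxt =
      update (s.arr aNxt) (s.reg rFree) (s.arr aAdj (s.reg a)) := rfl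
  have hadj : ((RAM.addArc a b).exec s).arr aAdj =
      update (s.arr aAdj) (s.reg a) (s.reg rFree) := by
    simp [RAM.addArc, exec, ha]
  have hfree : ((RAM.addArc a b).exec s).reg rFree = s.reg rFree + 1 := rfl
  refine ⟨hg.n_eq, hg.zero, hg.one, hfree ▸ Nat.succ_pos _, fun v hv => ?_⟩
  rw [hval, hnxt, hadj, hfree]
  by_cases hva : v = s.reg a
  · rw [hva, update_self, update_self]
    exact (hg.list _ hna).cons hg.free_pos _
  · rw [update_of_ne hva, update_of_ne hva]
    exact (hg.list v hv).congr (Nat.le_succ _) (fun k hk => update_of_ne hk.ne _ _)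
      fun k hk => update_of_ne hk.ne _ _

/-- The identical permutation. -/
def initOrd : Program :=
  (const rOne 1 ;; const rNid 1 ;; const rFree 1 ;; const rI 0) ;;
  whileLt rI rN (store aOrd rI rI ;; store aPos rI rI ;; succ rI rI)

theorem halts_initOrd (hn : s.reg rN = n) (hz : s.reg rZero = 0) (hadj : ∀ v, s.arr aAdj v = 0) :
    Halts initOrd s (4 * n + 5) fun s' => GraphMem n (fun _ => []) s' ∧ s'.part.IsPerm n ∧
      s'.part.nid = 1 := by
  refine (Halts.comp_exec (T₁ := 4) (T₂ := 4 * n + 1) rfl le_rfl fun hf => ?_).mono (by omega)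
    fun _ _ h => h
  set s₁ := exec _ s with hs₁
  have hn₁ : s₁.reg rN = n := hn
  have hi₁ : s₁.reg rI = 0 := rfl
  have hnid₁ : s₁.reg rNid = 1 := rfl
  have hg₁ : GraphMem n (fun _ => []) s₁ := ⟨hn, hz, rfl, Nat.one_pos, fun v _ => hadj v⟩
  clear_value s₁
  refine (Halts.loop (fun k s' => s'.reg rI ≤ n ∧ (∀ v < s'.reg rI, s'.arr aOrd v = v) ∧
    (∀ v < s'.reg rI, s'.arr aPos v = v) ∧ k = 4 * (n - s'.reg rI)) ?_ (4 * n)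
    (by simp [hi₁])).mono le_rfl ?_
  · rintro _ s₂ hf₂ ⟨hi, ho, hp, rfl⟩ hlt
    rw [hf₂.reg rN rfl, hn₁] at hlt
    refine ⟨3, Halts.of_exec rfl le_rfl fun _ => ⟨4 * (n - (s₂.reg rI + 1)), by omega, ?_, ?_, ?_, ?_⟩⟩
    · simpa [exec] using hlt
    · intro v hv
      have hv' : v < s₂.reg rI + 1 := hv
      change Function.update (s₂.arr aOrd) (s₂.reg rI) (s₂.reg rI) v = v
      by_cases h : v = s₂.reg rI
      · rw [h, Function.update_self]
      · rw [Function.update_of_ne h]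
        exact ho v (by omega)
    · intro v hv
      have hv' : v < s₂.reg rI + 1 := hv
      change Function.update (s₂.arr aPos) (s₂.reg rI) (s₂.reg rI) v = v
      by_cases h : v = s₂.reg rI
      · rw [h, Function.update_self]
      · rw [Function.update_of_ne h]
        exact hp v (by omega)
    · simp [exec]
  · rintro s₂ hf₂ ⟨⟨_, hi, ho, hp, -⟩, hlt⟩
    rw [hf₂.reg rN rfl, hn₁] at hlt
    have ho' : ∀ v < n, s₂.part.ord v = v := fun v hv => ho v (by omega)
    have hp' : ∀ v < n, s₂.part.pos v = v := fun v hv => hp v (by omega)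
    refine ⟨hg₁.congr (hf₂.reg _ rfl) (hf₂.reg _ rfl) (hf₂.reg _ rfl) (hf₂.reg _ rfl)
      (hf₂.arr _ rfl) (fun _ _ => congrFun (hf₂.arr _ rfl) _)
      (fun _ _ => congrFun (hf₂.arr _ rfl) _), ⟨?_, ?_, ?_, ?_⟩, (hf₂.reg rNid rfl).trans hnid₁⟩
    · exact fun v hv => (ho' v hv).symm ▸ hv
    · exact fun v hv => (hp' v hv).symm ▸ hv
    · exact fun v hv => by rw [ho' v hv, hp' v hv]
    · exact fun v hv => by rw [hp' v hv, ho' v hv]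

/-- Make the lists of neighbours. -/
def initAdj : Program :=
  const rI 0 ;;
  whileLt rI rM ((load rA aTail rI ;; load rB aHead rI) ;; addArc rA rB ;; addArc rB rA ;;
    succ rI rI)

-- Every edge is entered at both of its ends, so the lists describe the undirected closure and have
-- total length `2 * m`. Opposite edges produce repeated entries, which splitting tolerates.
open Function in
theorem halts_initAdj {m : ℕ} (hm : s.reg rM = m) (hg : GraphMem n (fun _ => []) s)
    (hlt : ∀ j < m, s.arr aTail j < n ∧ s.arr aHead j < n) :
    Halts initAdj s (14 * m + 2) fun s' => ∃ adj, GraphMem n adj s' ∧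
      (∀ v w, w ∈ adj v ↔ ∃ j < m, (s.arr aTail j = v ∧ s.arr aHead j = w) ∨
        (s.arr aHead j = v ∧ s.arr aTail j = w)) ∧
      ∑ v ∈ Finset.range n, (adj v).length = 2 * m := by
  refine (Halts.comp_exec (T₁ := 1) (T₂ := 14 * m + 1) rfl le_rfl fun hf => ?_).mono (by omega)
    fun _ _ h => h
  set s₁ := exec _ s with hs₁
  have hm₁ : s₁.reg rM = m := hm
  have hi₁ : s₁.reg rI = 0 := rfl
  have htail₁ : s₁.arr aTail = s.arr aTail := rfl
  have hhead₁ : s₁.arr aHead = s.arr aHead := rfl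
  have hg₁ : GraphMem n (fun _ => []) s₁ :=
    hg.congr rfl rfl rfl rfl rfl (fun _ _ => rfl) fun _ _ => rfl
  clear_value s₁
  refine (Halts.loop (fun k s' => s'.reg rI ≤ m ∧ (∃ adj, GraphMem n adj s' ∧
    (∀ v w, w ∈ adj v ↔ ∃ j < s'.reg rI, (s.arr aTail j = v ∧ s.arr aHead j = w) ∨
        (s.arr aHead j = v ∧ s.arr aTail j = w)) ∧
      ∑ v ∈ Finset.range n, (adj v).length = 2 * s'.reg rI) ∧ k = 14 * (m - s'.reg rI)) ?_ (14 * m)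
    ?_).mono le_rfl ?_
  · rintro _ s₂ hf₂ ⟨hi, ⟨adj, hg₂, hmem, hsum⟩, rfl⟩ hlt'
    rw [hf₂.reg rM rfl, hm₁] at hlt'
    set i := s₂.reg rI with hi
    have htail₂ : s₂.arr aTail = s.arr aTail := (hf₂.arr _ rfl).trans htail₁
    have hhead₂ : s₂.arr aHead = s.arr aHead := (hf₂.arr _ rfl).trans hhead₁
    set a := s.arr aTail i with ha
    set b := s.arr aHead i with hb
    have han : a < n := (hlt i hlt').1
    have hbn : b < n := (hlt i hlt').2
    refine ⟨2 + (5 + (5 + 1)), ?_⟩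
    refine Halts.comp_exec rfl le_rfl fun hf₃ => ?_
    set s₃ := exec _ s₂ with hs₃
    have ha₃ : s₃.reg rA = a := by
      rw [ha, ← htail₂]
      rfl
    have hb₃ : s₃.reg rB = b := by
      rw [hb, ← hhead₂]
      rfl
    have hi₃ : s₃.reg rI = i := rfl
    have hg₃ : GraphMem n adj s₃ := hg₂.congr rfl rfl rfl rfl rfl (fun _ _ => rfl) fun _ _ => rfl
    clear_value s₃
    have hg₄ := hg₃.addArc (a := rA) (b := rB) (by decide) (by rw [ha₃]; exact han)
    rw [ha₃, hb₃] at hg₄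
    refine Halts.comp_exec rfl le_rfl fun hf₄ => ?_
    set s₄ := exec _ s₃ with hs₄
    have ha₄ : s₄.reg rA = a := (hf₄.reg _ rfl).trans ha₃
    have hb₄ : s₄.reg rB = b := (hf₄.reg _ rfl).trans hb₃
    have hi₄ : s₄.reg rI = i := (hf₄.reg _ rfl).trans hi₃
    clear_value s₄
    have hg₅ := hg₄.addArc (a := rB) (b := rA) (by decide) (by rw [hb₄]; exact hbn)
    rw [ha₄, hb₄] at hg₅
    refine Halts.comp_exec rfl le_rfl fun hf₅ => ?_
    set s₅ := exec _ s₄ with hs₅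
    have hi₅ : s₅.reg rI = i := (hf₅.reg _ rfl).trans hi₄
    clear_value s₅
    refine Halts.of_exec rfl le_rfl fun hf₆ => ?_
    set s₆ := exec _ s₅ with hs₆
    have hi₆ : s₆.reg rI = i + 1 := by
      rw [← hi₅]
      rfl
    have hg₆ := hg₅.congr (s' := s₆) rfl rfl rfl rfl rfl (fun _ _ => rfl) fun _ _ => rfl
    clear_value s₆
    refine ⟨14 * (m - (i + 1)), by omega, by omega, ⟨_, hg₆, fun v w => ?_, ?_⟩, by rw [hi₆]⟩
    · have hstep : (∃ j < s₆.reg rI, (s.arr aTail j = v ∧ s.arr aHead j = w) ∨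
          (s.arr aHead j = v ∧ s.arr aTail j = w)) ↔
          w ∈ adj v ∨ (v = a ∧ w = b) ∨ (v = b ∧ w = a) := by
        rw [hmem, hi₆]
        constructor
        · rintro ⟨j, hj, h⟩
          rcases (Nat.lt_succ_iff.1 hj).lt_or_eq with hj | rfl
          · exact Or.inl ⟨j, hj, h⟩
          · refine Or.inr (h.imp ?_ ?_) <;> rintro ⟨rfl, rfl⟩ <;> exact ⟨rfl, rfl⟩
        · rintro (⟨j, hj, h⟩ | ⟨rfl, rfl⟩ | ⟨rfl, rfl⟩)
          · exact ⟨j, by omega, h⟩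
          · exact ⟨i, by omega, Or.inl ⟨rfl, rfl⟩⟩
          · exact ⟨i, by omega, Or.inr ⟨rfl, rfl⟩⟩
      rw [hstep]
      by_cases hva : v = a <;> by_cases hvb : v = b <;> by_cases hba : b = a <;>
        simp [update_apply, hva, hvb, hba, or_comm] <;> grind
    · have h1 := sum_length_update adj han (b :: adj a)
      have h2 := sum_length_update (update adj a (b :: adj a)) hbn
        (a :: update adj a (b :: adj a) b)
      simp only [List.length_cons] at h1 h2
      rw [hi₆]
      omega
  · refine ⟨by omega, ⟨_, hg₁, fun v w => ?_, ?_⟩, by omega⟩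
    · simp [hi₁]
    · simp [hi₁]
  · rintro s₂ hf₂ ⟨⟨_, hi, ⟨adj, hg₂, hmem, hsum⟩, -⟩, hlt'⟩
    rw [hf₂.reg rM rfl, hm₁] at hlt'
    have : s₂.reg rI = m := by omega
    rw [this] at hmem hsum
    exact ⟨adj, hg₂, hmem, hsum⟩

/-- The algorithm. -/
def orient : Program := initOrd ;; initAdj ;; initPart ;; lexBFS ;; initPart ;; refineAll

theorem halts_orient {F : ℕ → ℕ → Prop} {m : ℕ} (hn : s.reg rN = n) (hm : s.reg rM = m)
    (hz : s.reg rZero = 0) (harr : ∀ a, 2 ≤ a → ∀ i, s.arr a i = 0)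
    (hlt : ∀ j < m, s.arr aTail j < n ∧ s.arr aHead j < n) {E : ℕ → ℕ → Prop}
    (hE : ∀ v w, E v w ↔ ∃ j < m, (s.arr aTail j = v ∧ s.arr aHead j = w) ∨
        (s.arr aHead j = v ∧ s.arr aTail j = w))
    (hF : OrientsCompl E F {v | v < n}) :
    Halts orient s (1000 * ((n + m + 1) * Nat.log 2 (n + m + 2))) fun s' =>
      s'.part.IsPerm n ∧ ∃ F', OrientsCompl E F' {v | v < n} ∧
        ∀ a < n, ∀ b < n, s'.part.pos a < s'.part.pos b → ¬ E a b → F' a b := by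
  -- The phases in order. The logarithm of `n + m + 2` is at least 1, so it absorbs the linear
  -- terms.
  have htime : (4 * n + 5) + ((14 * m + 2) + ((3 * n + 6) + ((100 * m + 80 * n + 2) +
      ((3 * n + 6) + (200 * ((2 * m + n) * Nat.log 2 n) + 200 * n + 3))))) ≤
      1000 * ((n + m + 1) * Nat.log 2 (n + m + 2)) := by
    have h1 : Nat.log 2 n ≤ Nat.log 2 (n + m + 2) := Nat.log_mono_right (by omega)
    have h2 : 1 ≤ Nat.log 2 (n + m + 2) := Nat.log_pos (by norm_num) (by omega)
    have h3 : (2 * m + n) * Nat.log 2 n ≤ 2 * ((n + m + 1) * Nat.log 2 (n + m + 2)) := by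
      rw [← mul_assoc]
      exact Nat.mul_le_mul (by omega) h1
    have h4 : (n + m + 1) * 1 ≤ (n + m + 1) * Nat.log 2 (n + m + 2) := Nat.mul_le_mul_left _ h2
    omega
  refine Halts.mono (?_ : Halts orient s ((4 * n + 5) + ((14 * m + 2) + ((3 * n + 6) +
    ((100 * m + 80 * n + 2) + ((3 * n + 6) + (200 * ((2 * m + n) * Nat.log 2 n) + 200 * n + 3))))))
    fun s' => s'.part.IsPerm n ∧ ∃ F', OrientsCompl E F' {v | v < n} ∧
        ∀ a < n, ∀ b < n, s'.part.pos a < s'.part.pos b → ¬ E a b → F' a b) htime fun _ _ h => h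
  refine Halts.comp (halts_initOrd hn hz fun v => harr _ (by decide) v)
    fun s₁ hf₁ ⟨hg₁, hperm₁, hnid₁⟩ => ?_
  have htail₁ : s₁.arr aTail = s.arr aTail := hf₁.arr _ rfl
  have hhead₁ : s₁.arr aHead = s.arr aHead := hf₁.arr _ rfl
  refine Halts.comp (halts_initAdj ((hf₁.reg rM rfl).trans hm) hg₁ (by rwa [htail₁, hhead₁]))
    fun s₂ hf₂ ⟨adj, hg₂, hmem, hsum⟩ => ?_
  rw [htail₁, hhead₁] at hmem
  have hEadj : ∀ v w, w ∈ adj v ↔ E v w := fun v w => (hmem v w).trans (hE v w).symm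
  obtain rfl : (fun a b => b ∈ adj a) = E := by
    ext v w
    exact hEadj v w
  have hadj : IsAdjList n adj := by
    constructor
    · intro v w
      rw [hmem, hmem]
      rintro ⟨j, hj, h⟩
      exact ⟨j, hj, h.symm.imp And.symm And.symm⟩
    · intro v w
      rw [hmem]
      rintro ⟨j, hj, ⟨-, rfl⟩ | ⟨-, rfl⟩⟩
      · exact (hlt j hj).2
      · exact (hlt j hj).1
  have hpart₂ : s₂.part = s₁.part := OrdPart.ext (hf₂.arr aOrd rfl) (hf₂.arr aPos rfl)
    (hf₂.arr aCls rfl) (hf₂.arr aSt rfl) (hf₂.arr aEn rfl) (hf₂.arr aTw rfl) (hf₂.reg rNid rfl)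
  have htw₂ : ∀ c, s₂.part.tw c < s₂.part.nid := fun c => by
    rw [hpart₂, hnid₁, show s₁.part.tw c = 0 from
      (congrFun (hf₁.arr aTw rfl) c).trans (harr _ (by decide) c)]
    exact Nat.one_pos
  refine Halts.comp (halts_initPart hg₂.n_eq hg₂.zero (hpart₂ ▸ hperm₁) htw₂)
    fun s₃ hf₃ ⟨hwf₃, _, _, hone₃⟩ => ?_
  have hg₃ := hg₂.of_initPart hf₃
  have hlex := halts_lexBFS hadj hg₃ hwf₃ hone₃
  rw [Finset.sum_add_distrib, ← Finset.mul_sum, hsum, Finset.sum_const, Finset.card_range,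
    smul_eq_mul] at hlex
  refine Halts.comp (hlex.mono (by omega) fun _ _ h => h)
    fun s₄ hf₄ ⟨hg₄, hwf₄, hlex₄, hsig₄⟩ => ?_
  refine Halts.comp (halts_initPart hg₄.n_eq hg₄.zero hwf₄.toIsPerm hwf₄.tw_lt)
    fun s₅ hf₅ ⟨hwf₅, hord₅, hpos₅, hone₅⟩ => ?_
  have hg₅ := hg₄.of_initPart hf₅
  have hbkt₅ : ∀ b < n, s₅.arr aBkt b = 0 := fun b _ => by
    rw [hf₅.arr aBkt rfl, hf₄.arr aBkt rfl, hf₃.arr aBkt rfl, hf₂.arr aBkt rfl, hf₁.arr aBkt rfl]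
    exact harr _ (by decide) b
  have hsig₅ : ∀ j < n, s₅.arr aSig j = s₄.part.ord j := fun j hj =>
    (congrFun (hf₅.arr aSig rfl) j).trans (hsig₄ j hj)
  refine (halts_refineAll (σ := s₄.part.pos) hadj hg₅ hbkt₅ hwf₅ hone₅ hF (fun v hv => ?_)
    (fun j hj => ?_) (hlex₄.isLexOrder hwf₄)).mono ?_ fun _ _ h => h
  · rw [hsig₅ _ (hwf₄.pos_lt v hv)]
    exact ⟨hwf₄.pos_lt v hv, hwf₄.ord_pos v hv⟩
  · rw [hsig₅ j hj]
    exact ⟨hwf₄.ord_lt j hj, hwf₄.pos_ord j hj⟩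
  · rw [← Finset.sum_mul, Finset.sum_add_distrib, hsum, Finset.sum_const, Finset.card_range,
      smul_eq_mul, mul_one]

end RAM

theorem mainTheorem6 :
    ∃ (P : RAM.Program) (C : ℕ),
      ∀ (n : ℕ) (G : Digraph (Fin n)) (L : List (Fin n × Fin n)),
        G.IsSimple → L.Nodup → (∀ a b, (a, b) ∈ L ↔ G.Adj a b) →
        G.undirectedComplement.IsTransitivelyOrientable →
        ∃ (t : ℕ) (s : RAM.Memory) (v : Fin n ≃ Fin n),
          RAM.Runs P (RAM.input n L) t s ∧
          t ≤ C * ((n + L.length + 1) * Nat.log 2 (n + L.length + 2)) ∧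
          RAM.HasOutput s v ∧
          (G.transitiveClosure.undirectedComplement.orientAlong v).IsTransitiveOrientationOf
            G.transitiveClosure.undirectedComplement := by
  refine ⟨RAM.orient, 1000, fun n G L _ _ hL ⟨H, hH⟩ => ?_⟩
  have hO := hH.orientsCompl
  -- The machine works with numbers, so both relations are carried over to `ℕ`, where they hold only
  -- below `n`.
  set E : ℕ → ℕ → Prop := fun v w => ∃ (hv : v < n) (hw : w < n),
    G.undirectedClosure.Adj ⟨v, hv⟩ ⟨w, hw⟩ with hE
  set F : ℕ → ℕ → Prop := fun v w => ∃ (hv : v < n) (hw : w < n), H.Adj ⟨v, hv⟩ ⟨w, hw⟩ with hFdef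
  have hF : OrientsCompl E F {v | v < n} := by
    refine ⟨?_, ?_, ?_, ?_⟩
    · rintro a - b - ⟨ha, hb, hab⟩ ⟨_, _, hEab⟩
      exact hO.not_adj _ trivial _ trivial hab hEab
    · intro a ha b hb hne hnot
      refine (hO.total ⟨a, ha⟩ trivial ⟨b, hb⟩ trivial (by simpa using hne)
        fun h => hnot ⟨ha, hb, h⟩).imp (fun h => ⟨ha, hb, h⟩) fun h => ⟨hb, ha, h⟩
    · rintro a - b - ⟨ha, hb, hab⟩ ⟨_, _, hba⟩
      exact hO.asymm _ trivial _ trivial hab hba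
    · rintro a - b - c - ⟨ha, hb, hab⟩ ⟨_, hc, hbc⟩
      exact ⟨ha, hc, hO.trans _ trivial _ trivial _ trivial hab hbc⟩
  have htail : ∀ (j : ℕ) (hj : j < L.length), (RAM.input n L).arr 0 j = L[j].1 := by
    intro j hj
    simp [RAM.input, hj]
  have hhead : ∀ (j : ℕ) (hj : j < L.length), (RAM.input n L).arr 1 j = L[j].2 := by
    intro j hj
    simp [RAM.input, hj]
  have hEL : ∀ v w, E v w ↔ ∃ j < L.length,
      ((RAM.input n L).arr 0 j = v ∧ (RAM.input n L).arr 1 j = w) ∨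
        ((RAM.input n L).arr 1 j = v ∧ (RAM.input n L).arr 0 j = w) := by
    intro v w
    constructor
    · rintro ⟨hv, hw, h | h⟩ <;> obtain ⟨j, hj, e⟩ := List.getElem_of_mem ((hL _ _).2 h)
      · exact ⟨j, hj, Or.inl (by rw [htail j hj, hhead j hj, e]; exact ⟨rfl, rfl⟩)⟩
      · exact ⟨j, hj, Or.inr (by rw [htail j hj, hhead j hj, e]; exact ⟨rfl, rfl⟩)⟩
    · rintro ⟨j, hj, h⟩
      have hmem := (hL _ _).1 (List.getElem_mem hj)
      rw [htail j hj, hhead j hj] at h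
      rcases h with ⟨rfl, rfl⟩ | ⟨rfl, rfl⟩
      · exact ⟨Fin.is_lt _, Fin.is_lt _, Or.inl hmem⟩
      · exact ⟨Fin.is_lt _, Fin.is_lt _, Or.inr hmem⟩
  obtain ⟨t, s, hr, ht, hperm, F', hF', hag⟩ := RAM.halts_orient (s := RAM.input n L) (n := n)
    (m := L.length) rfl rfl rfl
    (fun a ha i => by
      have h0 : a ≠ 0 := by omega
      have h1 : a ≠ 1 := by omega
      simp [RAM.input, h0, h1])
    (fun j hj => by rw [htail j hj, hhead j hj]; exact ⟨Fin.is_lt _, Fin.is_lt _⟩) hEL hF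
  let v : Fin n ≃ Fin n :=
    { toFun := fun i => ⟨s.part.ord i, hperm.ord_lt i i.2⟩
      invFun := fun u => ⟨s.part.pos u, hperm.pos_lt u u.2⟩
      left_inv := fun i => Fin.ext (hperm.pos_ord i i.2)
      right_inv := fun u => Fin.ext (hperm.ord_pos u u.2) }
  refine ⟨t, s, v, hr, ht, fun i => rfl, ?_⟩
  -- Non-edges directed along the computed order lie in `F'`, which is transitive and contains no
  -- edges.
  refine Digraph.isTransitiveOrientationOf_orientAlong_transitiveClosure v
    fun a b c hab hbc hEab hEbc hEac => ?_
  have h1 := hag a a.2 b b.2 hab fun ⟨_, _, h⟩ => hEab h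
  have h2 := hag b b.2 c c.2 hbc fun ⟨_, _, h⟩ => hEbc h
  exact hF'.not_adj a a.2 c c.2 (hF'.trans a a.2 b b.2 c c.2 h1 h2) ⟨a.2, c.2, hEac⟩
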